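/- Let $\mathbb{F}$ be a field with $\mathrm{char}\,\mathbb{F}\neq 2$, let $\eta\in\mathbb{F}\setminus\{0,1\}$ and let $\Phi\subseteq\{0,1\}$. Algebras are commutative, not necessarily associative or unital $\mathbb{F}$-algebras. For an element $a$ of an algebra $M$ and $s\in\mathbb{F}$ put $M_s(a)=\{x\in M: ax=sx\}$. Let $\mathcal{F}_\Phi(\eta)$ be the fusion rule on $S=\{0,1,\eta\}$ given by the symmetric operation $$0\star 0=\{0\},\quad 1\star 1=\{1\},\quad 0\star 1=\Phi,\quad 0\star\eta=1\star\eta=\{\eta\},\quad \eta\star\eta=\{0,1\}.$$ An $\mathcal{F}_\Phi(\eta)$-axis of $M$ is an idempotent $a\in M$ such that $M=\bigoplus_{s\in S}M_s(a)$ and $M_s(a)M_t(a)\subseteq\bigoplus_{u\in s\star t}M_u(a)$ for all $s,t\in S$ (no primitivity is required). A 2-generated $\mathcal{F}_\Phi(\eta)$-axial algebra is a triple $(M,a_0,a_1)$ in which $a_0,a_1$ are $\mathcal{F}_\Phi(\eta)$-axes generating the algebra $M$; a morphism $(M,a_0,a_1)\to(N,b_0,b_1)$ is an algebra homomorphism $M\to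 N$ with $a_i\mapsto b_i$ for $i=0,1$. Let $M_\Phi$ be the universal 2-generated $\mathcal{F}_\Phi(\eta)$-axial algebra, that is, the initial object of this category. (1) Suppose $\Phi\neq\{0,1\}$ and $\eta\neq\frac12$. Let $\widehat{3C}(\eta)$ be the algebra with basis $\hat q,\hat a_0,\hat a_1,\hat a_{-1}$ and multiplication $\hat q x=(\eta+1)x$ for all $x$, $\hat a_i\hat a_i=\hat a_i$, and $$\hat a_i\hat a_j=-\tfrac12\hat q+\tfrac{\eta+1}{2}(\hat a_i+\hat a_j)+\tfrac{1-\eta}{2}\hat a_k\qquad\text{whenever }\{i,j,k\}=\{0,1,-1\},$$ let $2A$ be the algebra with basis $s_0,s_1$ and multiplication $s_is_i=s_i$, $s_0s_1=0$, and let $\widehat 4=\widehat{3C}(\eta)\oplus 2A$ be their direct sum with componentwise multiplication, a 6-dimensional algebra. Then $M_\Phi$ is isomorphic to $\widehat 4$ with generating axes $\hat a_0+s_0$ and $\hat a_1+s_1$. (2) Suppose $\eta=\frac12$, and that $\Phi=\emptyset$ or $\mathrm{char}\,\mathbb{F}\notin\{3,5\}$. Then $M_\Phi$ is isomorphic to the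 infinite-dimensional algebra with basis $\hat a_i$ ($i\in\mathbb{Z}$), $\hat p_j$ ($j\in\mathbb{Z}_{>0}$) and multiplication (where $\hat p_0=0$) $$\hat a_i\hat a_j=\hat p_{|i-j|}+\tfrac12(\hat a_i+\hat a_j),\qquad \hat a_i\hat p_j=\tfrac12\hat p_j-\tfrac14\hat a_i+\tfrac18(\hat a_{i-j}+\hat a_{i+j}),$$ $$\hat p_i\hat p_j=-\tfrac14(\hat p_i+\hat p_j)+\tfrac18(\hat p_{i+j}+\hat p_{|i-j|}),$$ with generating axes $\hat a_0$ and $\hat a_1$. -/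

import Mathlib

/-! ### Fusion rules and axial algebras

A commutative nonassociative algebra over `F` is a `NonUnitalNonAssocCommRing` with a compatible
`F`-module structure; it need not have a unit. -/

/-- A fusion rule on a set `S` of elements of `F` (the admissible eigenvalues). Only the values
`star s t` with `s, t ∈ S` are ever used. -/
structure FusionRule (F : Type*) where
  S : Set F
  star : F → F → Set F

section Axial

variable (F : Type*) [Field F]

/-- The `s`-eigenspace of the multiplication by `a`. -/
def axisEigenspace {M : Type*} [NonUnitalNonAssocCommRing M] [Module F M]
    [SMulCommClass F M M] (a : M) (s : F) : Submodule F M :=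
  Module.End.eigenspace (LinearMap.mulLeft F a) s

open Classical in
/-- `a` is an `R`-axis: an idempotent such that the algebra is the direct sum of the eigenspaces of
`a` for the eigenvalues in `R.S`, and these eigenspaces obey the fusion rule `R`.
Eigenspaces may be zero, and the `1`-eigenspace may be larger than `F a` (no primitivity). -/
structure IsAxis (R : FusionRule F) {M : Type*} [NonUnitalNonAssocCommRing M] [Module F M]
    [SMulCommClass F M M] (a : M) : Prop where
  idem : a * a = a
  isInternal : DirectSum.IsInternal (fun s : R.S => axisEigenspace F a (s : F))
  fusion : ∀ s ∈ R.S, ∀ t ∈ R.S, ∀ x ∈ axisEigenspace F a s, ∀ y ∈ axisEigenspace F a t,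
    x * y ∈ ⨆ u ∈ R.star s t, axisEigenspace F a u

/-- `(M, (a i)_i)` is an `R`-axial algebra generated by the axes `a i`. -/
structure IsAxialAlgebra (R : FusionRule F) {ι : Type*} {M : Type*}
    [NonUnitalNonAssocCommRing M] [Module F M] [SMulCommClass F M M] [IsScalarTower F M M]
    (a : ι → M) : Prop where
  isAxis : ∀ i, IsAxis F R (a i)
  generates : NonUnitalAlgebra.adjoin F (Set.range a) = ⊤

/-- `(M, (a i)_i)` is the universal `R`-axial algebra generated by an `n`-tuple of axes: it is an
initial object of the category of such algebras with marked generating axes, whose morphisms are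
the algebra homomorphisms that respect the markings. The test objects range over `Type w`. -/
def IsUniversalAxialAlgebra.{u, v, w} (F : Type u) [Field F] (R : FusionRule F) {n : ℕ}
    {M : Type v} [NonUnitalNonAssocCommRing M] [Module F M] [SMulCommClass F M M]
    [IsScalarTower F M M] (a : Fin n → M) : Prop :=
  IsAxialAlgebra F R a ∧
    ∀ (N : Type w) [NonUnitalNonAssocCommRing N] [Module F N] [SMulCommClass F N N]
      [IsScalarTower F N N] (b : Fin n → N), IsAxialAlgebra F R b →
      ∃! f : M →ₙₐ[F] N, ∀ i, f (a i) = b i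

open Classical in
/-- The fusion rule `F_Φ(η)` on `{0, 1, η}`:
`0 ⋆ 0 = {0}`, `1 ⋆ 1 = {1}`, `0 ⋆ 1 = 1 ⋆ 0 = Φ`, `0 ⋆ η = η ⋆ 0 = 1 ⋆ η = η ⋆ 1 = {η}`,
`η ⋆ η = {0, 1}`. -/
noncomputable def jordanFusion {F : Type*} [Field F] (Φ : Set F) (η : F) : FusionRule F where
  S := {0, 1, η}
  star s t :=
    if s = η ∧ t = η then {0, 1}
    else if s = η ∨ t = η then {η}
    else if s = t then {s}
    else Φ

end Axial

/-! ### Commutative algebras given by a multiplication table -/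

/-- A commutative multiplication table on a basis indexed by `ι`:
`coeff i j` is the product of the `i`-th and the `j`-th basis vector. -/
structure MulTable (F : Type*) [Field F] (ι : Type*) where
  coeff : ι → ι → ι →₀ F
  comm : ∀ i j, coeff i j = coeff j i

namespace MulTable

variable {F : Type*} [Field F] {ι : Type*}

/-- The algebra with basis `ι` and the multiplication given by the table. -/
def Alg (_T : MulTable F ι) : Type _ := ι →₀ F

variable (T : MulTable F ι)

noncomputable instance : AddCommGroup T.Alg := inferInstanceAs (AddCommGroup (ι →₀ F))

noncomputable instance : Module F T.Alg := inferInstanceAs (Module F (ι →₀ F))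

/-- The basis vectors. -/
noncomputable def e (i : ι) : T.Alg := (Finsupp.single i 1 : ι →₀ F)

/-- The bilinear extension of the table. -/
noncomputable def mulBilin : (ι →₀ F) →ₗ[F] (ι →₀ F) →ₗ[F] (ι →₀ F) :=
  Finsupp.linearCombination F (fun i => Finsupp.linearCombination F (T.coeff i))

theorem mulBilin_comm (x y : ι →₀ F) : T.mulBilin x y = T.mulBilin y x := by
  have h : T.mulBilin = T.mulBilin.flip := by
    refine Finsupp.lhom_ext' fun i => LinearMap.ext_ring ?_
    refine Finsupp.lhom_ext' fun j => LinearMap.ext_ring ?_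
    simp [mulBilin, T.comm i j]
  exact LinearMap.congr_fun₂ h x y

noncomputable instance : NonUnitalNonAssocCommRing T.Alg where
  mul x y := (T.mulBilin x y : ι →₀ F)
  left_distrib x y z := (T.mulBilin x).map_add y z
  right_distrib x y z := LinearMap.map_add₂ T.mulBilin x y z
  zero_mul x := LinearMap.map_zero₂ T.mulBilin x
  mul_zero x := (T.mulBilin x).map_zero
  mul_comm x y := T.mulBilin_comm x y

instance : SMulCommClass F T.Alg T.Alg where
  smul_comm c x y := ((T.mulBilin x).map_smul c y).symm

instance : IsScalarTower F T.Alg T.Alg where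
  smul_assoc c x y := LinearMap.map_smul₂ T.mulBilin c x y

/-- Basis vectors multiply according to the table. -/
theorem e_mul_e (i j : ι) : T.e i * T.e j = (T.coeff i j : ι →₀ F) := by
  change T.mulBilin (Finsupp.single i 1) (Finsupp.single j 1) = _
  simp [mulBilin]

end MulTable

/-! ### The six-dimensional algebra -/

/-- Basis of the four-dimensional algebra `3Ĉ(η)`: `q` and `a i` for `i ∈ {0, 1, -1} = ℤ/3`. -/
inductive ThreeCHatIndex
  | q : ThreeCHatIndex
  | a (i : ZMod 3) : ThreeCHatIndex

open ThreeCHatIndex Finsupp in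
/-- The multiplication table of `3Ĉ(η)`: `q x = (η + 1) x` for all `x`, `a i * a i = a i`, and
`a i * a j = -1/2 q + (η + 1)/2 (a i + a j) + (1 - η)/2 a k` whenever `{i, j, k} = {0, 1, -1}`. -/
noncomputable def threeCHatTable {F : Type*} [Field F] (η : F) : MulTable F ThreeCHatIndex where
  coeff
    | q, x => (η + 1) • single x 1
    | a i, q => (η + 1) • single (a i) 1
    | a i, a j =>
      if i = j then single (a i) 1
      else (-(1 / 2) : F) • single q 1 + ((η + 1) / 2) • (single (a i) 1 + single (a j) 1)
        + ((1 - η) / 2) • single (a (-(i + j))) 1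
  comm := by
    rintro (_ | i) (_ | j)
    · rfl
    · rfl
    · rfl
    · by_cases h : i = j
      · subst h; rfl
      · have h' : ¬ j = i := fun e => h e.symm
        simp only [if_neg h, if_neg h']
        rw [add_comm i j, add_comm (single (a i) (1 : F))]

/-- The multiplication table of `2A`: two orthogonal idempotents `s 0`, `s 1` as basis. -/
noncomputable def twoATable (F : Type*) [Field F] : MulTable F (Fin 2) where
  coeff i j := if i = j then Finsupp.single i 1 else 0
  comm i j := by
    by_cases h : i = j
    · subst h; rfl
    · have h' : ¬ j = i := fun e => h e.symm
      simp only [if_neg h, if_neg h']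

/-- The direct sum `3Ĉ(η) ⊕ 2A`, with componentwise multiplication. -/
abbrev FourHat {F : Type*} [Field F] (η : F) : Type _ :=
  (threeCHatTable η).Alg × (twoATable F).Alg

noncomputable instance {F : Type*} [Field F] (η : F) : NonUnitalNonAssocCommRing (FourHat η) where
  __ := (inferInstance : NonUnitalNonAssocRing (FourHat η))
  mul_comm x y := Prod.ext (mul_comm x.1 y.1) (mul_comm x.2 y.2)

/-- The generating axes `a 0 + s 0` and `a 1 + s 1` of `3Ĉ(η) ⊕ 2A`. -/
noncomputable def FourHat.axis {F : Type*} [Field F] (η : F) (i : Fin 2) : FourHat η :=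
  ((threeCHatTable η).e (ThreeCHatIndex.a (if i = 0 then 0 else 1)), (twoATable F).e i)

/-! ### The infinite-dimensional algebra -/

/-- Basis of the infinite-dimensional algebra: `a i` for `i ∈ ℤ`, `p j` for `j > 0`. -/
inductive InfIndex
  | a (i : ℤ) : InfIndex
  | p (j : ℕ+) : InfIndex

/-- The vector `p n`, with the convention `p 0 = 0`. -/
noncomputable def infP (F : Type*) [Field F] (n : ℕ) : InfIndex →₀ F :=
  if h : 0 < n then Finsupp.single (InfIndex.p ⟨n, h⟩) 1 else 0

/-- The vector `a i`. -/
noncomputable def infA (F : Type*) [Field F] (i : ℤ) : InfIndex →₀ F :=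
  Finsupp.single (InfIndex.a i) 1

/-- The product `a i * p j`. -/
noncomputable def infMulAP (F : Type*) [Field F] (i : ℤ) (j : ℕ+) : InfIndex →₀ F :=
  (1 / 2 : F) • infP F j - (1 / 4 : F) • infA F i
    + (1 / 8 : F) • (infA F (i - (j : ℕ)) + infA F (i + (j : ℕ)))

open InfIndex in
/-- The multiplication table of the infinite-dimensional algebra. -/
noncomputable def infTable (F : Type*) [Field F] : MulTable F InfIndex where
  coeff
    | a i, a j => infP F (i - j).natAbs + (1 / 2 : F) • (infA F i + infA F j)
    | a i, p j => infMulAP F i j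
    | p j, a i => infMulAP F i j
    | p i, p j => (-(1 / 4) : F) • (infP F i + infP F j)
        + (1 / 8 : F) • (infP F ((i : ℕ) + j) + infP F (((i : ℕ) : ℤ) - (j : ℕ)).natAbs)
  comm := by
    rintro (i | i) (j | j)
    · show _ + _ = _ + _
      rw [add_comm (infA F i), ← Int.natAbs_neg (i - j), neg_sub]
    · rfl
    · rfl
    · show _ + _ = _ + _
      rw [add_comm (infP F i), add_comm (i : ℕ), ← Int.natAbs_neg (((i : ℕ) : ℤ) - (j : ℕ)), neg_sub]

/-- The generating axes `a 0` and `a 1` of the infinite-dimensional algebra. -/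
noncomputable def infAxis (F : Type*) [Field F] (i : Fin 2) : (infTable F).Alg :=
  (infTable F).e (InfIndex.a (if i = 0 then 0 else 1))

universe u v w

/-! Both model algebras are spanned by explicit eigenvectors of their generating axes, and they obey
even the strongest rule, where 0- and 1-eigenvectors annihilate each other (`isAxis_of_span`). So
the point is to map the model to an arbitrary algebra generated by two axes. Uniqueness of the map
follows from generation, and `universal_of_exists_hom` turns this into both assertions.

The fusion rule is graded by ℤ/2 with η odd, so each axis defines an automorphism that is -1 on its
η-eigenspace and 1 on the other two. The two generating axes spread under the dihedral group so
obtained to a sequence a_i, i ∈ ℤ (`exists_dihedralSeq`). The vector P_{j,i} = a_i a_{i+j} - η(a_i +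
a_{i+j}) is fixed by the reflections in i and i + j, hence depends only on i modulo j. The sum
a_{m+k} + a_{m-k} splits into a 0- and a 1-eigenvector of a_m that are explicit in terms of P_{k,m}.
Multiplying such parts by the fusion rule, at different centres m, yields all relations.

Let η ≠ 1/2 and Φ ⊆ {0}. The square of P_{1,0} can be computed at every centre, and two consecutive
centres give a linear relation. It says that the defects d_i, by which a_i - a_{i+3} differs from
(P_{2,i} - P_{2,i+1})/(1 - 2η), satisfy η d_{i+1} = 2 d_i - η d_{i-1}. Commutativity of a_i a_{i+3}
gives (4 + 2η - 5η²) d_i = 0, and commutativity of the products of defects gives a second relation;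
together they force d_i = 0 (`defectVec_eq_zero`). Then the s_i = a_i (a_i - a_{i+3}) are orthogonal
idempotents of period 2, the a_i - s_i have period 3, and they multiply as in the two summands of
the model. The case Φ = {1} reduces to Φ = {0} on replacing a by 1 - a in the unitization, which
exchanges 0 with 1 and η with 1 - η.

For η = 1/2 the linear relation degenerates. Here closure of the 0- and 1-eigenspaces alone computes
products of the P's at every centre, and independence of the centre shows by induction on j that
P_{j,i} does not depend on i (`half_pairVec_const`). The differences are killed by 6 when j = 2 and
by 10 when j > 2, which is where characteristics 3 and 5 enter. If Φ is empty, a second formula for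
the same product leaves only a factor 4. -/

set_option linter.unusedSectionVars false

/-! ### Relations forced by the eigenspaces of a single idempotent. -/

section CenterRelations

variable {F : Type*} [Field F] {M : Type*} [NonUnitalNonAssocCommRing M] [Module F M]
  [SMulCommClass F M M] [IsScalarTower F M M]

/-- The eigenvalue relations of an idempotent `c` whose `0`- and `1`-eigenspaces multiply into
themselves. -/
structure EigenClosed (c : M) : Prop where
  idem : c * c = c
  zero_zero : ∀ x y, c * x = 0 → c * y = 0 → c * (x * y) = 0
  one_one : ∀ x y, c * x = x → c * y = y → c * (x * y) = x * y

/-- The mixed products of `0`- and `1`-eigenvectors are `0`-eigenvectors. -/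
def ZeroOneZero (c : M) : Prop := ∀ x y, c * x = 0 → c * y = y → c * (x * y) = 0

/-- U splits as X + Y with X killed and Y fixed by c. The rules for 0 ⋆ 0 and 0 ⋆ 1 put XU into the
0-eigenspace, which determines cP; the three rules together give c(UU) = YY, which determines pp. In
the application U and W are the sums of the neighbours of c at distance 1 and 2, and P, Q are the
two values of `pairVec η a 2`. -/
theorem center_mul_orbit_product {η : F} (hη : η ≠ 1) {c U W p P Q : M}
    (hc : EigenClosed c) (h01 : ZeroOneZero c)
    (hU : c * U = (2 : F) • p + (2 * η) • c + η • U)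
    (hW : c * W = (2 : F) • Q + (2 * η) • c + η • W)
    (hp : (2 : F) • (c * p) = (2 * (1 - η)) • p - (2 * η ^ 2) • c + (η * (1 - η)) • U)
    (hUp : (2 : F) • (U * p) = (4 * (1 - η)) • p - (2 * η ^ 2) • U
      + (η * (1 - η)) • ((2 : F) • c + W))
    (hUU : U * U = U + (2 : F) • (P + η • U)) :
    (2 : F) • (c * P) = (1 - 2 * η) • (c * U) - (2 * η) • c + η • (c * W) ∧
    (8 : F) • (p * p) = (8 * (1 - 4 * η + 2 * η ^ 2)) • p + (2 * η * (1 - 2 * η)) •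
      ((2 * (1 - η)) • c + (2 - η) • U - η • W) + (4 * η) • Q - (4 * η ^ 2) • P := by
  have hX : c * ((1 - η) • U - (2 : F) • p - (2 * η) • c) = 0 := by
    simp only [mul_sub, mul_smul_comm, hU, hc.idem]
    linear_combination (norm := module) -hp
  have hY : c * ((2 : F) • p + (2 * η) • c + η • U) = (2 : F) • p + (2 * η) • c + η • U := by
    simp only [mul_add, mul_smul_comm, hU, hc.idem]
    linear_combination (norm := module) hp
  have hXX := hc.zero_zero _ _ hX hX
  have hXY := h01 _ _ hX hY
  have hYY := hc.one_one _ _ hY hY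
  have hXU : c * (((1 - η) • U - (2 : F) • p - (2 * η) • c) * U) = 0 := by
    have : U = ((1 - η) • U - (2 : F) • p - (2 * η) • c)
      + ((2 : F) • p + (2 * η) • c + η • U) := by module
    conv_lhs => enter [2, 2]; rw [this]
    rw [mul_add, mul_add, hXX, hXY, add_zero]
  have hYU : c * (U * U) = ((2 : F) • p + (2 * η) • c + η • U) *
      ((2 : F) • p + (2 * η) • c + η • U) := by
    have : U = ((1 - η) • U - (2 : F) • p - (2 * η) • c)
      + ((2 : F) • p + (2 * η) • c + η • U) := by module
    have : U * U = ((1 - η) • U - (2 : F) • p - (2 * η) • c) *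
          ((1 - η) • U - (2 : F) • p - (2 * η) • c)
        + (2 : F) • (((1 - η) • U - (2 : F) • p - (2 * η) • c) *
          ((2 : F) • p + (2 * η) • c + η • U))
        + ((2 : F) • p + (2 * η) • c + η • U) * ((2 : F) • p + (2 * η) • c + η • U) := by
      conv_lhs => rw [this]
      generalize (1 - η) • U - (2 : F) • p - (2 * η) • c = x
      generalize (2 : F) • p + (2 * η) • c + η • U = y
      rw [add_mul, mul_add, mul_add, mul_comm y x]
      module
    rw [this, mul_add, mul_add, mul_smul_comm, hXX, hXY, hYY]
    simp
  have hcUU : c * (U * U) = (1 + 2 * η) • (c * U) + (2 : F) • (c * P) := by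
    rw [hUU]; simp only [mul_add, mul_smul_comm]; module
  have hccU : c * (c * U) = c * U := by rw [hU, hY]
  have hpU : (2 : F) • (c * (p * U)) = (4 * (1 - η)) • (c * p) - (2 * η ^ 2) • (c * U)
      + (η * (1 - η)) • ((2 : F) • c + c * W) := by
    rw [mul_comm p, ← mul_smul_comm, hUp]
    simp only [mul_add, mul_sub, mul_smul_comm, hc.idem]
  have key : (2 : F) • (c * P) = (1 - 2 * η) • (c * U) - (2 * η) • c + η • (c * W) := by
    simp only [sub_mul, mul_sub, smul_mul_assoc, mul_smul_comm, hcUU, hccU] at hXU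
    have h1 : (1 - η) ≠ 0 := sub_ne_zero.2 hη.symm
    apply smul_right_injective M h1
    simp only
    linear_combination (norm := module) hXU + hpU + (2 * (1 - η)) • hp
      - (2 * (1 - η) ^ 2) • hU
  refine ⟨key, ?_⟩
  rw [hcUU, key] at hYU
  simp only [add_mul, mul_add, smul_mul_assoc, mul_smul_comm, hc.idem, mul_comm U c,
    mul_comm p c, mul_comm p U, hUU] at hYU
  linear_combination (norm := module) (-2 : F) • hYU - (4 * η) • hUp - (8 * η) • hp
    + (4 - 8 * η ^ 2) • hU + (2 * η) • hW

end CenterRelations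

/-! ### Sequences of idempotents permuted by reflections. -/

section DihedralSequences

variable {F : Type*} [Field F] {M : Type*} [NonUnitalNonAssocCommRing M] [Module F M]
  [SMulCommClass F M M] [IsScalarTower F M M]

/-- A sequence of idempotents permuted by the reflections `i ↦ 2 m - i`, where the reflection in `m`
is `-1` on the `η`-eigenspace of `a m` and `1` on the `0`- and `1`-eigenspaces. -/
structure DihedralSeq (η : F) (a : ℤ → M) : Prop where
  closed : ∀ i, EigenClosed (a i)
  odd : ∀ m k, a m * (a (m + k) - a (m - k)) = η • (a (m + k) - a (m - k))
  even : ∀ m k, a m * (a m * (a (m + k) + a (m - k))) = a m * (a (m + k) + a (m - k))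

/-- The vector `a i * a (i + j) - η (a i + a (i + j))`, which is fixed by the reflections in `i`
and `i + j`. -/
def pairVec (η : F) (a : ℤ → M) (j i : ℤ) : M := a i * a (i + j) - η • (a i + a (i + j))

namespace DihedralSeq

variable {η : F} {a : ℤ → M} (H : DihedralSeq η a)
include H

theorem mul_eq (j i : ℤ) : a i * a (i + j) = pairVec η a j i + η • (a i + a (i + j)) := by
  simp [pairVec]

theorem mul_eq' {i k : ℤ} (j : ℤ) (h : k = i + j) :
    a i * a k = pairVec η a j i + η • (a i + a k) := by
  subst h; exact H.mul_eq j i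

/-- Oddness of a_{i+j} - a_{i-j} at the centre i says exactly that the pairs (i, i + j) and (i - j,
i) give the same vector. So `pairVec η a j` has period j, and is constant for j = 1. -/
theorem pairVec_sub (j i : ℤ) : pairVec η a j (i - j) = pairVec η a j i := by
  have h := H.odd i j
  rw [mul_sub] at h
  simp only [pairVec, sub_add_cancel, mul_comm (a (i - j))]
  linear_combination (norm := module) -h

theorem pairVec_add (j i : ℤ) : pairVec η a j (i + j) = pairVec η a j i := by
  rw [← H.pairVec_sub, add_sub_cancel_right]

theorem pairVec_one (i : ℤ) : pairVec η a 1 i = pairVec η a 1 0 := by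
  induction i using Int.induction_on with
  | zero => rfl
  | succ i ih => rw [H.pairVec_add, ih]
  | pred i ih => rw [H.pairVec_sub, ih]

theorem pairVec_neg (j i : ℤ) : pairVec η a (-j) i = pairVec η a j i := by
  rw [← H.pairVec_sub j i]
  simp only [pairVec, sub_add_cancel, mul_comm (a (i - j)), ← sub_eq_add_neg,
    add_comm (a (i - j))]

theorem mul_sub_eq (j i : ℤ) : a i * a (i - j) = pairVec η a j i + η • (a i + a (i - j)) := by
  rw [← H.pairVec_neg]; exact H.mul_eq' (-j) (by ring)

theorem mul_orbit (m k : ℤ) : a m * (a (m + k) + a (m - k)) =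
    (2 : F) • pairVec η a k m + (2 * η) • a m + η • (a (m + k) + a (m - k)) := by
  rw [mul_add, H.mul_eq, H.mul_sub_eq]; module

theorem mul_pairVec (m k : ℤ) : (2 : F) • (a m * pairVec η a k m) =
    (2 * (1 - η)) • pairVec η a k m - (2 * η ^ 2) • a m
      + (η * (1 - η)) • (a (m + k) + a (m - k)) := by
  have h := H.even m k
  have h' := H.mul_orbit m k
  rw [h'] at h
  rw [mul_add, mul_add, mul_smul_comm, mul_smul_comm, (H.closed m).idem, mul_smul_comm] at h
  linear_combination (norm := module) h - η • h'

theorem mul_self_orbit (m k : ℤ) : (a (m + k) + a (m - k)) * (a (m + k) + a (m - k)) =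
    (a (m + k) + a (m - k)) +
      (2 : F) • (pairVec η a (2 * k) (m + k) + η • (a (m + k) + a (m - k))) := by
  have h : a (m - k) * a (m + k) = _ := H.mul_eq' (2 * k) (by ring)
  have h' := H.pairVec_sub (2 * k) (m + k)
  rw [show m + k - 2 * k = m - k by ring] at h'
  rw [add_mul, mul_add, mul_add, (H.closed _).idem, (H.closed _).idem, mul_comm (a (m + k)), h, h']
  module

theorem mul_pairVec_one (m : ℤ) : (2 : F) • (a m * pairVec η a 1 0) =
    (2 * (1 - η)) • pairVec η a 1 0 - (2 * η ^ 2) • a m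
      + (η * (1 - η)) • (a (m + 1) + a (m - 1)) := by
  have := H.mul_pairVec m 1
  rwa [H.pairVec_one] at this

theorem pairVec_two_sub_one (m : ℤ) : pairVec η a 2 (m - 1) = pairVec η a 2 (m + 1) := by
  rw [← H.pairVec_sub 2 (m + 1)]; congr 1; ring

/-- The left side of the second formula does not involve m, so its right side takes the same value
at all centres. The terms in the a's carry the factor 1 - 2η, which is why η = 1/2 needs another
argument. -/
theorem center_relations (hη : η ≠ 1) (h01 : ∀ i, ZeroOneZero (a i)) (m : ℤ) :
    (2 : F) • (a m * pairVec η a 2 (m + 1)) = (1 - 2 * η) • (a m * (a (m + 1) + a (m - 1)))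
      - (2 * η) • a m + η • (a m * (a (m + 2) + a (m - 2))) ∧
    (8 : F) • (pairVec η a 1 0 * pairVec η a 1 0) =
      (8 * (1 - 4 * η + 2 * η ^ 2)) • pairVec η a 1 0 + (2 * η * (1 - 2 * η)) •
      ((2 * (1 - η)) • a m + (2 - η) • (a (m + 1) + a (m - 1)) - η • (a (m + 2) + a (m - 2)))
      + (4 * η) • pairVec η a 2 m - (4 * η ^ 2) • pairVec η a 2 (m + 1) := by
  have hU := H.mul_orbit m 1
  rw [H.pairVec_one] at hU
  refine center_mul_orbit_product hη (H.closed m) (h01 m) hU (H.mul_orbit m 2)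
    (H.mul_pairVec_one m) ?_ ?_
  · have h1 := H.mul_pairVec_one (m + 1)
    have h2 := H.mul_pairVec_one (m - 1)
    rw [show m + 1 + 1 = m + 2 by ring, show m + 1 - 1 = m by ring] at h1
    rw [show m - 1 + 1 = m by ring, show m - 1 - 1 = m - 2 by ring] at h2
    rw [add_mul]
    linear_combination (norm := module) h1 + h2
  · exact H.mul_self_orbit m 1

end DihedralSeq

end DihedralSequences

/-! ### The case η ≠ 1/2: a recurrence for the defects. -/

section Rigidity

variable {F : Type*} [Field F] {M : Type*} [NonUnitalNonAssocCommRing M] [Module F M]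
  [SMulCommClass F M M] [IsScalarTower F M M]

/-- The difference of two neighbouring vectors `pairVec η a 2 i`, divided by `1 - 2 η`. -/
def gapVec (η : F) (a : ℤ → M) (i : ℤ) : M :=
  (1 - 2 * η)⁻¹ • (pairVec η a 2 i - pairVec η a 2 (i + 1))

/-- The failure of `a i - a (i + 3)` to equal `gapVec η a i`. -/
def defectVec (η : F) (a : ℤ → M) (i : ℤ) : M := a i - a (i + 3) - gapVec η a i

namespace DihedralSeq

variable {η : F} {a : ℤ → M} (H : DihedralSeq η a)
include H

theorem smul_gapVec (hh : 1 - 2 * η ≠ 0) (i : ℤ) :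
    (1 - 2 * η) • gapVec η a i = pairVec η a 2 i - pairVec η a 2 (i + 1) := by
  rw [gapVec, smul_inv_smul₀ hh]

theorem pairVec_two_add_two {i k : ℤ} (h : k = i + 2) : pairVec η a 2 k = pairVec η a 2 i := by
  rw [h, H.pairVec_add]

/-- `pairVec η a 2` takes only two values, one for each parity, so their difference alternates in
sign. -/
theorem gapVec_add_one {i k : ℤ} (h : k = i + 1) : gapVec η a k = -gapVec η a i := by
  subst h
  rw [gapVec, gapVec, H.pairVec_two_add_two (show i + 1 + 1 = i + 2 by ring)]
  module

theorem gapVec_sub_one {i k : ℤ} (h : k = i - 1) : gapVec η a k = -gapVec η a i := by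
  rw [H.gapVec_add_one (show i = k + 1 by omega), neg_neg]

variable (h01 : ∀ i, ZeroOneZero (a i)) (h2 : (2 : F) ≠ 0) (hη0 : η ≠ 0) (hη1 : η ≠ 1)
  (hh : 1 - 2 * η ≠ 0)
include h01 h2 hη0 hη1 hh

/-- This equates the values of the square of `pairVec η a 1 0` computed at the centres i and i + 1.
-/
theorem smul_gapVec_eq (i : ℤ) : (2 * (1 + η)) • gapVec η a i =
    η • (a (i - 2) - a (i + 1)) - (2 : F) • (a (i - 1) - a (i + 2))
      + η • (a i - a (i + 3)) := by
  have e := (H.center_relations hη1 h01 i).2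
  have e' := (H.center_relations hη1 h01 (i + 1)).2
  rw [show i + 1 + 1 = i + 2 by ring, show i + 1 - 1 = i by ring, show i + 1 + 2 = i + 3 by ring,
    show i + 1 - 2 = i - 1 by ring, H.pairVec_two_add_two rfl] at e'
  have hg := H.smul_gapVec hh i
  apply smul_right_injective M (mul_ne_zero (mul_ne_zero h2 hη0) hh)
  simp only
  linear_combination (norm := module) e' - e + (4 * η * (1 + η)) • hg

/-- Both values of `pairVec η a 2` have known products with a_i: for the pair based at i from
evenness at i, for the other from `center_relations`. -/
theorem mul_gapVec (i : ℤ) : (2 : F) • (a i * gapVec η a i) =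
    a i * (a (i + 2) + a (i - 2)) - a i * (a (i + 1) + a (i - 1)) := by
  have e := (H.center_relations hη1 h01 i).1
  have e2 := H.mul_pairVec i 2
  have e3 := H.mul_orbit i 2
  have hg := congrArg (a i * ·) (H.smul_gapVec hh i)
  simp only [mul_sub, mul_smul_comm] at hg
  apply smul_right_injective M hh
  simp only
  linear_combination (norm := module) (2 : F) • hg + e2 - e - (1 - η) • e3

theorem mul_orbit_three (i : ℤ) : a i * (a (i + 3) + a (i - 3)) =
    (2 : F) • a i + a i * (a (i + 1) + a (i - 1)) - a i * (a (i + 2) + a (i - 2)) := by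
  have e := H.smul_gapVec_eq h01 h2 hη0 hη1 hh i
  have e' := H.smul_gapVec_eq h01 h2 hη0 hη1 hh (i - 1)
  rw [H.gapVec_sub_one rfl, show i - 1 - 2 = i - 3 by ring, show i - 1 + 1 = i by ring,
    show i - 1 - 1 = i - 2 by ring, show i - 1 + 2 = i + 1 by ring,
    show i - 1 + 3 = i + 2 by ring] at e'
  have hg := H.mul_gapVec h01 h2 hη0 hη1 hh i
  -- The difference of two consecutive gap relations is symmetric about i, so multiplication by a_i
  -- involves only products with symmetric sums.
  have e4 : (4 * (1 + η)) • gapVec η a i = (2 * η) • a i - (η + 2) • (a (i + 1) + a (i - 1))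
      + (η + 2) • (a (i + 2) + a (i - 2)) - η • (a (i + 3) + a (i - 3)) := by
    linear_combination (norm := module) e - e'
  have e5 := congrArg (a i * ·) e4
  simp only [mul_sub, mul_add, mul_smul_comm, (H.closed i).idem] at e5 hg ⊢
  apply smul_right_injective M hη0
  simp only
  linear_combination (norm := module) e5 - (2 * (1 + η)) • hg

/-- The product a_i a_{i+3} is computed twice, at the centre i and at the centre i + 3, by
`mul_orbit_three` and oddness. Commutativity equates the results. -/
theorem smul_gapVec_eq_six (i : ℤ) : (2 * (1 - 2 * η)) • gapVec η a i =
    (2 * (1 - η)) • (a i - a (i + 3)) + η • (-(a (i - 3) - a i) - (a (i - 2) - a (i + 1))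
      + (a (i - 1) - a (i + 2)) + (a (i + 1) - a (i + 4)) - (a (i + 2) - a (i + 5))
      - (a (i + 3) - a (i + 6))) := by
  have e := H.mul_orbit_three h01 h2 hη0 hη1 hh i
  have e' := H.mul_orbit_three h01 h2 hη0 hη1 hh (i + 3)
  have o := H.odd i 3
  have o' := H.odd (i + 3) 3
  have hg := H.smul_gapVec hh i
  have u1 := H.mul_orbit i 1
  have u2 := H.mul_orbit i 2
  have v1 := H.mul_orbit (i + 3) 1
  have v2 := H.mul_orbit (i + 3) 2
  rw [show i + 3 + 1 = i + 4 by ring, show i + 3 - 1 = i + 2 by ring] at v1 e'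
  rw [show i + 3 + 2 = i + 5 by ring, show i + 3 - 2 = i + 1 by ring] at v2 e'
  rw [show i + 3 + 3 = i + 6 by ring, show i + 3 - 3 = i by ring] at o' e'
  rw [H.pairVec_one] at u1 v1
  rw [H.pairVec_two_add_two (show i + 3 = (i + 1) + 2 by ring)] at v2
  simp only [mul_add, mul_sub, mul_comm (a (i + 3)) (a i)] at e e' o o' u1 u2 v1 v2
  linear_combination (norm := module) (2 : F) • hg + e + o + u1 - u2 - e' + o' - v1 + v2

/-- The gap relation with each a_j - a_{j+3} written as defect plus gap: as the gaps alternate in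
sign, they cancel. -/
theorem defectVec_rec (i : ℤ) :
    η • defectVec η a (i + 1) = (2 : F) • defectVec η a i - η • defectVec η a (i - 1) := by
  have e := H.smul_gapVec_eq h01 h2 hη0 hη1 hh (i + 1)
  rw [show i + 1 - 2 = i - 1 by ring, show i + 1 + 1 = i + 2 by ring,
    show i + 1 - 1 = i by ring, show i + 1 + 2 = i + 3 by ring, show i + 1 + 3 = i + 4 by ring,
    H.gapVec_add_one rfl] at e
  rw [defectVec, defectVec, defectVec, H.gapVec_add_one rfl, H.gapVec_sub_one rfl,
    show i + 1 + 3 = i + 4 by ring, show i - 1 + 3 = i + 2 by ring]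
  linear_combination (norm := module) -e

theorem defectVec_rec' {i j k : ℤ} (hj : j = i + 1) (hk : k = i + 2) :
    defectVec η a k = (2 / η) • defectVec η a j - defectVec η a i := by
  subst hj
  have e := H.defectVec_rec h01 h2 hη0 hη1 hh (i + 1)
  rw [show i + 1 + 1 = k by omega, show i + 1 - 1 = i by ring] at e
  apply smul_right_injective M hη0
  simp only [smul_sub, smul_smul, mul_div_cancel₀ _ hη0]
  exact e

/-- In the six-term relation the gap vectors cancel as well, and the recurrence reduces the
remaining combination of d_{i-3}, ..., d_{i+3} to a multiple of d_i. -/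
theorem smul_defectVec (i : ℤ) : (4 + 2 * η - 5 * η ^ 2) • defectVec η a i = 0 := by
  have e := H.smul_gapVec_eq_six h01 h2 hη0 hη1 hh i
  have g1 := H.gapVec_add_one (show i + 1 = i + 1 by ring)
  have g2 := H.gapVec_add_one (show i + 2 = i + 1 + 1 by ring)
  have g3 := H.gapVec_add_one (show i + 3 = i + 2 + 1 by ring)
  have g1' := H.gapVec_sub_one (show i - 1 = i - 1 by ring)
  have g2' := H.gapVec_sub_one (show i - 2 = i - 1 - 1 by ring)
  have g3' := H.gapVec_sub_one (show i - 3 = i - 2 - 1 by ring)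
  have d1 : a (i + 1) - a (i + 4) = defectVec η a (i + 1) - gapVec η a i := by
    rw [defectVec, g1, show i + 1 + 3 = i + 4 by ring]; module
  have d2 : a (i + 2) - a (i + 5) = defectVec η a (i + 2) + gapVec η a i := by
    rw [defectVec, g2, g1, show i + 2 + 3 = i + 5 by ring]; module
  have d3 : a (i + 3) - a (i + 6) = defectVec η a (i + 3) - gapVec η a i := by
    rw [defectVec, g3, g2, g1, show i + 3 + 3 = i + 6 by ring]; module
  have d1' : a (i - 1) - a (i + 2) = defectVec η a (i - 1) - gapVec η a i := by
    rw [defectVec, g1', show i - 1 + 3 = i + 2 by ring]; module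
  have d2' : a (i - 2) - a (i + 1) = defectVec η a (i - 2) + gapVec η a i := by
    rw [defectVec, g2', g1', show i - 2 + 3 = i + 1 by ring]; module
  have d3' : a (i - 3) - a i = defectVec η a (i - 3) - gapVec η a i := by
    rw [defectVec, g3', g2', g1', show i - 3 + 3 = i by ring]; module
  have d0 : a i - a (i + 3) = defectVec η a i + gapVec η a i := by rw [defectVec]; module
  rw [d0, d1, d2, d3, d1', d2', d3'] at e
  have r1 := H.defectVec_rec h01 h2 hη0 hη1 hh i
  have r2 := H.defectVec_rec h01 h2 hη0 hη1 hh (i + 1)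
  have r3 := H.defectVec_rec h01 h2 hη0 hη1 hh (i + 2)
  have r2' := H.defectVec_rec h01 h2 hη0 hη1 hh (i - 1)
  have r3' := H.defectVec_rec h01 h2 hη0 hη1 hh (i - 2)
  rw [show i + 1 + 1 = i + 2 by ring, show i + 1 - 1 = i by ring] at r2
  rw [show i + 2 + 1 = i + 3 by ring, show i + 2 - 1 = i + 1 by ring] at r3
  rw [show i - 1 + 1 = i by ring, show i - 1 - 1 = i - 2 by ring] at r2'
  rw [show i - 2 + 1 = i - 1 by ring, show i - 2 - 1 = i - 3 by ring] at r3'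
  apply smul_right_injective M h2
  simp only
  linear_combination (norm := module) (η ^ 2) • e - (η ^ 2) • (r3 + (2 : F) • r1 + r3')
    - (η * (2 + η)) • (r2 + r2') + (4 * η ^ 2 - 4 - 2 * η) • r1

end DihedralSeq

end Rigidity

/-! ### The defects vanish. -/

section Rigidity

variable {F : Type*} [Field F] {M : Type*} [NonUnitalNonAssocCommRing M] [Module F M]
  [SMulCommClass F M M] [IsScalarTower F M M]

namespace DihedralSeq

variable {η : F} {a : ℤ → M} (H : DihedralSeq η a)
  (h01 : ∀ i, ZeroOneZero (a i)) (h2 : (2 : F) ≠ 0) (hη0 : η ≠ 0) (hη1 : η ≠ 1)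
  (hh : 1 - 2 * η ≠ 0)
include H h01 h2 hη0 hη1 hh

theorem mul_defectVec_sub_one (i : ℤ) : (2 : F) • (a i * defectVec η a (i - 1)) =
    η • (defectVec η a (i - 1) + defectVec η a (i - 2)) := by
  have g := H.mul_gapVec h01 h2 hη0 hη1 hh i
  have o1 := H.odd i 1
  have o2 := H.odd i 2
  rw [defectVec, defectVec, H.gapVec_sub_one (show i - 2 = i - 1 - 1 by ring),
    H.gapVec_sub_one (show i - 1 = i - 1 by rfl), show i - 1 + 3 = i + 2 by ring,
    show i - 2 + 3 = i + 1 by ring]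
  simp only [mul_sub, mul_add, mul_neg] at g o1 o2 ⊢
  linear_combination (norm := module) g - o1 - o2

theorem mul_defectVec_sub_two (i : ℤ) : (2 : F) • (a i * defectVec η a (i - 2)) =
    η • (defectVec η a (i - 1) + defectVec η a (i - 2)) := by
  have g := H.mul_gapVec h01 h2 hη0 hη1 hh i
  have o1 := H.odd i 1
  have o2 := H.odd i 2
  rw [defectVec, defectVec, H.gapVec_sub_one (show i - 2 = i - 1 - 1 by ring),
    H.gapVec_sub_one (show i - 1 = i - 1 by rfl), show i - 1 + 3 = i + 2 by ring,
    show i - 2 + 3 = i + 1 by ring]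
  simp only [mul_sub, mul_add, mul_neg] at g o1 o2 ⊢
  linear_combination (norm := module) - g - o1 - o2

/-- Every `a i` acts on the span of the defects through the reflection in `i`. -/
theorem mul_defectVec (i j k : ℤ) (hjk : j + k = 2 * i - 3) :
    (2 : F) • (a i * defectVec η a j) = η • (defectVec η a j + defectVec η a k) := by
  have hr : ∀ i j k : ℤ, j = i + 1 → k = i + 2 →
      defectVec η a k = (2 / η) • defectVec η a j - defectVec η a i :=
    fun i j k hj hk => H.defectVec_rec' h01 h2 hη0 hη1 hh hj hk
  -- The reflection in i pairs the indices i - 1 + n and i - 2 - n. The induction carries two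
  -- consecutive pairs, since the recurrence has order two.
  have key : ∀ n : ℕ, ((2 : F) • (a i * defectVec η a (i - 1 + n)) =
        η • (defectVec η a (i - 1 + n) + defectVec η a (i - 2 - n)) ∧
      (2 : F) • (a i * defectVec η a (i - 2 - n)) =
        η • (defectVec η a (i - 1 + n) + defectVec η a (i - 2 - n))) ∧
      ((2 : F) • (a i * defectVec η a (i + n)) =
        η • (defectVec η a (i + n) + defectVec η a (i - 3 - n)) ∧
      (2 : F) • (a i * defectVec η a (i - 3 - n)) =
        η • (defectVec η a (i + n) + defectVec η a (i - 3 - n))) := by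
    have e1 := H.mul_defectVec_sub_one h01 h2 hη0 hη1 hh i
    have e2 := H.mul_defectVec_sub_two h01 h2 hη0 hη1 hh i
    -- The recurrence reads the same in both directions, so one linear step moves a pair outwards at
    -- both ends.
    have step : ∀ x y z x' y' z' : M, z = (2 / η) • y - x → z' = (2 / η) • y' - x' →
        (2 : F) • (a i * x) = η • (x + x') → (2 : F) • (a i * y) = η • (y + y') →
        (2 : F) • (a i * z) = η • (z + z') := by
      rintro x y _ x' y' _ rfl rfl hx hy
      simp only [mul_sub, mul_smul_comm]
      linear_combination (norm := module) (2 / η) • hy - hx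
    intro n
    induction n with
    | zero =>
      simp only [Nat.cast_zero, add_zero, sub_zero]
      have r := hr (i - 2) (i - 1) i (by ring) (by ring)
      have r' := hr (i - 3) (i - 2) (i - 1) (by ring) (by ring)
      have r'' : defectVec η a (i - 3) =
          (2 / η) • defectVec η a (i - 2) - defectVec η a (i - 1) := by
        rw [r']; module
      refine ⟨⟨e1, e2⟩, step _ _ _ _ _ _ r r'' (by rw [e2, add_comm]) e1, ?_⟩
      rw [add_comm (defectVec η a i)]
      exact step _ _ _ _ _ _ r'' r e1 (by rw [e2, add_comm])
    | succ n ih =>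
      obtain ⟨⟨p1, p2⟩, p3, p4⟩ := ih
      have f1 : i - 1 + ((n + 1 : ℕ) : ℤ) = i + n := by push_cast; ring
      have f2 : i - 2 - ((n + 1 : ℕ) : ℤ) = i - 3 - n := by push_cast; ring
      rw [f1, f2]
      have r := hr (i - 1 + n) (i + n) (i + (n + 1 : ℕ)) (by ring) (by push_cast; ring)
      have r' := hr (i - 3 - (n + 1 : ℕ)) (i - 3 - n) (i - 2 - n) (by push_cast; ring)
        (by push_cast; ring)
      have r'' : defectVec η a (i - 3 - (n + 1 : ℕ)) =
          (2 / η) • defectVec η a (i - 3 - n) - defectVec η a (i - 2 - n) := by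
        rw [r']; module
      refine ⟨⟨p3, p4⟩, step _ _ _ _ _ _ r r'' p1 p3, ?_⟩
      rw [add_comm (defectVec η a (i + (n + 1 : ℕ)))]
      exact step _ _ _ _ _ _ r'' r (by rw [p2, add_comm]) (by rw [p4, add_comm])
  rcases le_or_gt (i - 1) j with h | h
  · obtain ⟨n, hn⟩ := Int.eq_ofNat_of_zero_le (sub_nonneg.2 h)
    have := (key n).1.1
    rwa [show i - 1 + (n : ℤ) = j by omega, show i - 2 - (n : ℤ) = k by omega] at this
  · obtain ⟨n, hn⟩ := Int.eq_ofNat_of_zero_le (show 0 ≤ i - 2 - j by omega)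
    have := (key n).1.2
    rwa [show i - 1 + (n : ℤ) = k by omega, show i - 2 - (n : ℤ) = j by omega,
      add_comm (defectVec η a k)] at this

/-- A linear relation among the defects, from the commutativity of their products. -/
theorem defectVec_relation (i : ℤ) :
    η • (-(defectVec η a (i + 1) + defectVec η a (i - 1))
      - (defectVec η a (i + 2) + defectVec η a (i - 2))
      + (defectVec η a (i + 4) + defectVec η a (i - 4))
      + (defectVec η a (i + 5) + defectVec η a (i - 5))
      + (defectVec η a (i + 6) + defectVec η a (i - 6)) - (2 : F) • defectVec η a i) = 0 := by
  have A := H.mul_defectVec h01 h2 hη0 hη1 hh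
  have x0 : defectVec η a (i - 1) = a (i - 1) - a (i + 2) + gapVec η a i := by
    rw [defectVec, H.gapVec_sub_one rfl, show i - 1 + 3 = i + 2 by ring]; module
  have x1 : defectVec η a i = a i - a (i + 3) - gapVec η a i := rfl
  have x2 : defectVec η a (i + 1) = a (i + 1) - a (i + 4) + gapVec η a i := by
    rw [defectVec, H.gapVec_add_one rfl, show i + 1 + 3 = i + 4 by ring]; module
  -- One factor of each product is expanded into a's and the gap vector. The products with the gap
  -- vector are unknown, but they cancel in the sum of the three commutation relations.
  have c01 := mul_comm (defectVec η a (i - 1)) (defectVec η a i)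
  have c12 := mul_comm (defectVec η a i) (defectVec η a (i + 1))
  have c02 := mul_comm (defectVec η a (i - 1)) (defectVec η a (i + 1))
  nth_rw 1 [x0] at c01
  nth_rw 2 [x1] at c01
  nth_rw 1 [x1] at c12
  nth_rw 2 [x2] at c12
  nth_rw 1 [x0] at c02
  nth_rw 2 [x2] at c02
  simp only [add_mul, sub_mul] at c01 c12 c02
  have b1 := A (i - 1) i (i - 5) (by ring)
  have b2 := A (i + 2) i (i + 1) (by ring)
  have b3 := A i (i - 1) (i - 2) (by ring)
  have b4 := A (i + 3) (i - 1) (i + 4) (by ring)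
  have b5 := A i (i + 1) (i - 4) (by ring)
  have b6 := A (i + 3) (i + 1) (i + 2) (by ring)
  have b7 := A (i + 1) i (i - 1) (by ring)
  have b8 := A (i + 4) i (i + 5) (by ring)
  have b9 := A (i - 1) (i + 1) (i - 6) (by ring)
  have b10 := A (i + 2) (i + 1) i (by ring)
  have b11 := A (i + 1) (i - 1) i (by ring)
  have b12 := A (i + 4) (i - 1) (i + 6) (by ring)
  linear_combination (norm := module) (2 : F) • (c01 + c12 + c02) - b1 + b2 + b3
    - b4 - b5 + b6 + b7 - b8
    - b9 + b10 + b11 - b12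

/-- Unless d_i = 0, the factor 4 + 2η - 5η² vanishes. Then the second relation reduces modulo it to
15(3 - 2c) d_i = 0 with c = 2/η, and this coefficient can vanish in no characteristic compatible
with the hypotheses. -/
theorem defectVec_eq_zero (i : ℤ) : defectVec η a i = 0 := by
  have e := H.smul_defectVec h01 h2 hη0 hη1 hh i
  rcases smul_eq_zero.1 e with h | h
  swap
  · exact h
  have R := H.defectVec_relation h01 h2 hη0 hη1 hh i
  have hr : ∀ i j k : ℤ, j = i + 1 → k = i + 2 →
      defectVec η a k = (2 / η) • defectVec η a j - defectVec η a i :=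
    fun i j k hj hk => H.defectVec_rec' h01 h2 hη0 hη1 hh hj hk
  have hr' : ∀ i j k : ℤ, j = i - 1 → k = i - 2 →
      defectVec η a k = (2 / η) • defectVec η a j - defectVec η a i := by
    intro i j k hj hk
    rw [hr k j i (by omega) (by omega)]; module
  -- With c as the coefficient of the recurrence, d_{i+n} + d_{i-n} is a polynomial in c of
  -- Chebyshev type times d_i, and the vanishing factor becomes c² + c - 5.
  obtain ⟨c, hc⟩ : ∃ c, c = 2 / η := ⟨_, rfl⟩
  have hcη : c * η = 2 := by rw [hc]; field_simp
  have hc2 : c ^ 2 + c - 5 = 0 := by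
    rw [hc]; field_simp; linear_combination h
  rw [← hc] at hr hr'
  generalize defectVec η a = d at *
  have hC : ∀ n : ℕ, d (i + (n + 2 : ℕ)) + d (i - (n + 2 : ℕ)) =
      c • (d (i + (n + 1 : ℕ)) + d (i - (n + 1 : ℕ))) - (d (i + n) + d (i - n)) := by
    intro n
    rw [hr (i + n) (i + (n + 1 : ℕ)) (i + (n + 2 : ℕ)) (by push_cast; ring) (by push_cast; ring),
      hr' (i - n) (i - (n + 1 : ℕ)) (i - (n + 2 : ℕ)) (by push_cast; ring) (by push_cast; ring)]
    module
  have h1 : d (i + 1) + d (i - 1) = c • d i := by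
    rw [hr (i - 1) i (i + 1) (by ring) (by ring)]; module
  have C2 := hC 0
  have C3 := hC 1
  have C4 := hC 2
  have C5 := hC 3
  have C6 := hC 4
  norm_num at C2 C3 C4 C5 C6
  have S2 : d (i + 2) + d (i - 2) = (c ^ 2 - 2) • d i := by
    linear_combination (norm := module) C2 + c • h1
  have S3 : d (i + 3) + d (i - 3) = (c ^ 3 - 3 * c) • d i := by
    linear_combination (norm := module) C3 + c • S2 - h1
  have S4 : d (i + 4) + d (i - 4) = (c ^ 4 - 4 * c ^ 2 + 2) • d i := by
    linear_combination (norm := module) C4 + c • S3 - S2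
  have S5 : d (i + 5) + d (i - 5) = (c ^ 5 - 5 * c ^ 3 + 5 * c) • d i := by
    linear_combination (norm := module) C5 + c • S4 - S3
  have S6 : d (i + 6) + d (i - 6) = (c ^ 6 - 6 * c ^ 4 + 9 * c ^ 2 - 2) • d i := by
    linear_combination (norm := module) C6 + c • S5 - S4
  have hz : (c ^ 2 + c - 5) • d i = 0 := by rw [hc2, zero_smul]
  -- Division of the resulting sextic by c² + c - 5 has quotient c⁴ - 5c + 9 and remainder 15(3 -
  -- 2c).
  have R' : (15 * (3 - 2 * c)) • d i = 0 := by
    apply smul_right_injective M hη0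
    simp only
    linear_combination (norm := module) R + η • (h1 + S2 - S4 - S5 - S6)
      - (η * (9 - 5 * c + c ^ 4)) • hz
  rcases smul_eq_zero.1 R' with h' | h'
  swap
  · exact h'
  exfalso
  -- In characteristic 5 the quadratic forces η = -2 and in characteristic 3 it forces η = -1; in
  -- both cases 1 - 2η = 0. Otherwise 3η = 4, and elimination from the quadratic leaves 20 = 0.
  have h3 : 15 * (3 * η - 4) = 0 := by linear_combination η * h' + 30 * hcη
  have h5 : (5 : F) ≠ 0 := by
    intro h5
    have h6 : 2 * (η + 2) = 0 := by linear_combination h + η ^ 2 * h5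
    apply hh
    have := (mul_eq_zero.1 h6).resolve_left h2
    linear_combination -2 * this + h5
  have h3' : (3 : F) ≠ 0 := by
    intro h3
    have h6 : 2 * (η + 1) ^ 2 = 0 := by linear_combination -h + (2 + 2 * η - η ^ 2) * h3
    have := pow_eq_zero_iff two_ne_zero |>.1 ((mul_eq_zero.1 h6).resolve_left h2)
    apply hh
    linear_combination -2 * this + h3
  have h15 : (15 : F) ≠ 0 := by
    rw [show (15 : F) = 3 * 5 by norm_num]; exact mul_ne_zero h3' h5
  have h4 := (mul_eq_zero.1 h3).resolve_left h15
  have h20 : (2 * 2 * 5 : F) = 0 := by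
    linear_combination -9 * h - (15 * η + 14) * h4
  exact mul_ne_zero (mul_ne_zero h2 h2) h5 h20

end DihedralSeq

end Rigidity

/-! ### The relations of a rigid sequence when Φ ⊆ {0}. -/

section Rigidity

variable {F : Type*} [Field F] {M : Type*} [NonUnitalNonAssocCommRing M] [Module F M]
  [SMulCommClass F M M] [IsScalarTower F M M]

/-- The mixed products of `0`- and `1`-eigenvectors are `1`-eigenvectors. -/
def ZeroOneOne (c : M) : Prop := ∀ x y, c * x = 0 → c * y = y → c * (x * y) = x * y

/-- The relations that hold in a sequence of axes when `η ≠ 1 / 2` and the mixed products of `0`-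
and `1`-eigenvectors are eigenvectors for a single eigenvalue. -/
structure RigidSeq (η : F) (a : ℤ → M) : Prop where
  gap : ∀ i, pairVec η a 2 i - pairVec η a 2 (i + 1) = (1 - 2 * η) • (a i - a (i + 3))
  alternate : ∀ i, a (i + 1) - a (i + 4) = -(a i - a (i + 3))
  mul_gap : ∀ i, a i * (a i - a (i + 3)) =
    pairVec η a 2 i - pairVec η a 1 0 + η • (a i - a (i + 3))
  pair_mul_pair : ∀ i, (2 : F) • (pairVec η a 1 0 * pairVec η a 1 0) =
    (2 * (1 - 4 * η + 2 * η ^ 2)) • pairVec η a 1 0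
      + (η * (1 - η) * (1 - 2 * η)) • (a i + a (i + 1) + a (i - 1))
      + (η * (1 - η)) • pairVec η a 2 i
  pair_mul : ∀ i, pairVec η a 1 0 * (a i * (a i - a (i + 3))) = -η • (a i * (a i - a (i + 3)))

/-- Ys is fixed by c and Xs is killed by c, but they are negatives of each other. -/
theorem EigenClosed.mul_eq_zero {c s U X Y : M} (hc : EigenClosed c) (h01 : ZeroOneZero c)
    (hs : c * s = s) (hX : c * X = 0) (hY : c * Y = Y) (hU : U = X + Y) (hUs : U * s = 0) :
    Y * s = 0 := by
  have h1 := hc.one_one _ _ hY hs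
  have h2 := h01 _ _ hX hs
  have h3 : Y * s = -(X * s) := by
    rw [hU, add_mul] at hUs
    exact eq_neg_of_add_eq_zero_right hUs
  rw [← h1, h3, mul_neg, h2, neg_zero]

namespace DihedralSeq

variable {η : F} {a : ℤ → M} (H : DihedralSeq η a)
include H

theorem mul_fixed_part (m : ℤ) : a m * ((2 : F) • pairVec η a 1 0 + (2 * η) • a m
      + η • (a (m + 1) + a (m - 1))) =
    (2 : F) • pairVec η a 1 0 + (2 * η) • a m + η • (a (m + 1) + a (m - 1)) := by
  have h := H.even m 1
  rwa [H.mul_orbit, H.pairVec_one] at h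

theorem mul_killed_part (m : ℤ) : a m * ((1 - η) • (a (m + 1) + a (m - 1))
    - (2 : F) • pairVec η a 1 0 - (2 * η) • a m) = 0 := by
  have h := H.mul_orbit m 1
  have h' := H.mul_fixed_part m
  rw [H.pairVec_one] at h
  simp only [mul_add, mul_sub, mul_smul_comm] at h h' ⊢
  linear_combination (norm := module) h - h'

theorem rigid_of_zeroOneZero (h01 : ∀ i, ZeroOneZero (a i)) (h2 : (2 : F) ≠ 0) (hη0 : η ≠ 0)
    (hη1 : η ≠ 1) (hh : 1 - 2 * η ≠ 0) : RigidSeq η a := by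
  have g : ∀ i, gapVec η a i = a i - a (i + 3) := fun i =>
    (sub_eq_zero.1 (H.defectVec_eq_zero h01 h2 hη0 hη1 hh i)).symm
  have gap : ∀ i, pairVec η a 2 i - pairVec η a 2 (i + 1) = (1 - 2 * η) • (a i - a (i + 3)) := by
    intro i
    rw [← g, H.smul_gapVec hh]
  have alt : ∀ i k l, k = i + 1 → l = i + 4 → a k - a l = -(a i - a (i + 3)) := by
    rintro i _ l rfl hl
    rw [← g, ← H.gapVec_add_one rfl, g, hl, show i + 1 + 3 = i + 4 by ring]
  have w : ∀ i, a (i + 2) + a (i - 2) = a (i + 1) + a (i - 1) + (2 : F) • (a i - a (i + 3)) := by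
    intro i
    have e1 := alt (i - 2) (i - 1) (i + 2) (by ring) (by ring)
    have e2 := alt (i - 1) i (i + 3) (by ring) (by ring)
    rw [show i - 2 + 3 = i + 1 by ring] at e1
    rw [show i - 1 + 3 = i + 2 by ring] at e2
    linear_combination (norm := module) e1 - (2 : F) • e2
  have mg : ∀ i, a i * (a i - a (i + 3)) =
      pairVec η a 2 i - pairVec η a 1 0 + η • (a i - a (i + 3)) := by
    intro i
    have e := H.mul_gapVec h01 h2 hη0 hη1 hh i
    rw [H.mul_orbit, H.mul_orbit, w, g, H.pairVec_one] at e
    apply smul_right_injective M h2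
    simp only
    linear_combination (norm := module) e
  refine ⟨gap, fun i => alt i _ _ rfl rfl, mg, ?_, ?_⟩
  · intro i
    have e := (H.center_relations hη1 h01 i).2
    have e' := gap i
    rw [w] at e
    apply smul_right_injective M (mul_ne_zero h2 h2)
    simp only
    linear_combination (norm := module) e + (4 * η ^ 2) • e'
  · intro i
    -- Twice a_i (a_i - a_{i+3}) is the difference of the products of a_i with the symmetric sums at
    -- distances 2 and 1, and both products are fixed by a_i.
    have hs : ∀ i, a i * (a i * (a i - a (i + 3))) = a i * (a i - a (i + 3)) := by
      intro i
      have e := H.mul_gapVec h01 h2 hη0 hη1 hh i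
      rw [g] at e
      have e' := congrArg (fun x => a i * x) e
      beta_reduce at e'
      rw [mul_sub (a i) (a i * _), H.even, H.even, ← e, mul_smul_comm] at e'
      exact smul_right_injective M h2 e'
    -- With s_j = a_j (a_j - a_{j+3}), s_i equals s_{i+1} - (a_{i+1} - a_{i+4}), whose product with
    -- a_{i+1} is s_{i+1} - s_{i+1}.
    have n1 : a (i + 1) * (a i * (a i - a (i + 3))) = 0 := by
      have : a i * (a i - a (i + 3)) = (a (i + 1) * (a (i + 1) - a (i + 1 + 3)))
          - (a (i + 1) - a (i + 1 + 3)) := by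
        rw [mg, mg, alt i (i + 1) (i + 1 + 3) rfl (by ring)]
        linear_combination (norm := module) gap i
      rw [this, mul_sub, hs, sub_self]
    have n2 : a (i - 1) * (a i * (a i - a (i + 3))) = 0 := by
      have : a i * (a i - a (i + 3)) = (a (i - 1) * (a (i - 1) - a (i - 1 + 3)))
          - (a (i - 1) - a (i - 1 + 3)) := by
        have e := gap (i - 1)
        rw [sub_add_cancel] at e
        rw [mg, mg, alt (i - 1) i (i + 3) (by ring) (by ring)]
        linear_combination (norm := module) - e
      rw [this, mul_sub, hs, sub_self]
    have hY := (H.closed i).mul_eq_zero (h01 i) (hs i) (H.mul_killed_part i) (H.mul_fixed_part i)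
      (U := a (i + 1) + a (i - 1)) (by module) (by rw [add_mul, n1, n2, add_zero])
    simp only [add_mul, smul_mul_assoc, n1, n2, hs] at hY
    apply smul_right_injective M h2
    simp only
    linear_combination (norm := module) hY

end DihedralSeq

end Rigidity

/-! ### The case Φ ⊆ {1}, by passing to the complements 1 - a. -/

section Rigidity

variable {F : Type*} [Field F] {M : Type*} [NonUnitalNonAssocCommRing M] [Module F M]
  [SMulCommClass F M M] [IsScalarTower F M M]

noncomputable instance unitizationNonUnitalNonAssocCommRing :
    NonUnitalNonAssocCommRing (Unitization F M) where
  __ := (inferInstance : NonAssocRing (Unitization F M))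
  mul_comm x y := by
    ext
    · simp [mul_comm]
    · simp only [Unitization.snd_mul, mul_comm x.snd]; abel

instance unitizationSMulCommClass : SMulCommClass F (Unitization F M) (Unitization F M) where
  smul_comm c x y := by
    ext
    · simp [mul_left_comm]
    · simp only [Unitization.snd_mul, Unitization.snd_smul, Unitization.fst_smul, mul_smul_comm,
        smul_eq_mul]
      module

instance unitizationIsScalarTower : IsScalarTower F (Unitization F M) (Unitization F M) where
  smul_assoc c x y := by
    ext
    · simp [mul_assoc]
    · simp only [Unitization.snd_mul, Unitization.snd_smul, Unitization.fst_smul, smul_mul_assoc,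
        smul_eq_mul]
      module

@[simp] theorem unitization_fst_sub (X Y : Unitization F M) :
    (X - Y).toProd.1 = X.toProd.1 - Y.toProd.1 := rfl

@[simp] theorem unitization_snd_sub (X Y : Unitization F M) :
    (X - Y).toProd.2 = X.toProd.2 - Y.toProd.2 := rfl

/-- The complement `1 - a` of an element of a nonunital algebra, in the unitization. -/
noncomputable def complAxis (F : Type*) [Field F] {M : Type*} [NonUnitalNonAssocCommRing M]
    [Module F M] (a : M) : Unitization F M := 1 - Unitization.inr a

@[simp] theorem fst_complAxis (a : M) : (complAxis F a).fst = 1 := by simp [complAxis]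

@[simp] theorem snd_complAxis (a : M) : (complAxis F a).snd = -a := by simp [complAxis]

theorem complAxis_mul (a : M) (X : Unitization F M) :
    complAxis F a * X = X - Unitization.inr (X.fst • a + a * X.snd) := by
  ext
  · simp
  · simp only [Unitization.snd_mul, fst_complAxis, snd_complAxis, unitization_snd_sub,
      Unitization.snd_inr]
    simp only [neg_mul]; module

theorem complAxis_mul_eq_zero_iff {a : M} {X : Unitization F M} :
    complAxis F a * X = 0 ↔ X.fst = 0 ∧ a * X.snd = X.snd := by
  rw [complAxis_mul, sub_eq_zero]
  constructor
  · intro h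
    have h0 : X.fst = 0 := by rw [h]; simp
    have h1 := congrArg (fun X : Unitization F M => X.toProd.2) h
    simp only [h0, zero_smul, zero_add, Unitization.snd_inr] at h1
    exact ⟨h0, h1.symm⟩
  · rintro ⟨h0, h1⟩
    ext <;> simp [h0, h1]

theorem complAxis_mul_eq_self_iff {a : M} {X : Unitization F M} :
    complAxis F a * X = X ↔ a * X.snd = -(X.fst • a) := by
  rw [complAxis_mul, sub_eq_self]
  constructor
  · intro h
    have h1 := congrArg (fun X : Unitization F M => X.toProd.2) h
    simp only [Unitization.snd_inr, Unitization.snd_zero] at h1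
    exact eq_neg_of_add_eq_zero_right h1
  · intro h
    rw [h, add_neg_cancel, Unitization.inr_zero]

/-- Multiplication by 1 - a exchanges the eigenvalues 0 and 1. An element of the unitization fixed
by 1 - a corresponds to its second component plus its scalar part times a, which is killed by a. -/
theorem EigenClosed.complAxis {a : M} (h : EigenClosed a) : EigenClosed (complAxis F a) where
  idem := by
    rw [complAxis_mul_eq_self_iff]; simp [h.idem]
  zero_zero X Y hX hY := by
    rw [complAxis_mul_eq_zero_iff] at *
    simp only [Unitization.fst_mul, Unitization.snd_mul, hX.1, hY.1, zero_smul, zero_add, mul_zero,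
      true_and]
    exact h.one_one _ _ hX.2 hY.2
  one_one X Y hX hY := by
    rw [complAxis_mul_eq_self_iff] at *
    have e := h.zero_zero (X.snd + X.fst • a) (Y.snd + Y.fst • a)
      (by rw [mul_add, hX, mul_smul_comm, h.idem]; abel)
      (by rw [mul_add, hY, mul_smul_comm, h.idem]; abel)
    simp only [mul_add, add_mul, smul_mul_assoc, mul_smul_comm, mul_comm _ a, hX, hY, h.idem,
      mul_neg] at e
    simp only [Unitization.fst_mul, Unitization.snd_mul, mul_add, mul_smul_comm, hX, hY]
    linear_combination (norm := module) e

theorem ZeroOneOne.complAxis {a : M} (h : EigenClosed a) (h' : ZeroOneOne a) :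
    ZeroOneZero (complAxis F a) := by
  intro X Y hX hY
  rw [complAxis_mul_eq_zero_iff] at *
  rw [complAxis_mul_eq_self_iff] at hY
  have e := h' (Y.snd + Y.fst • a) X.snd
      (by rw [mul_add, hY, mul_smul_comm, h.idem]; abel) hX.2
  refine ⟨by simp [hX.1], ?_⟩
  simp only [add_mul, smul_mul_assoc, hX.2] at e
  simp only [Unitization.snd_mul, hX.1, zero_smul, zero_add, mul_comm X.snd]
  rwa [add_comm]

namespace DihedralSeq

variable {η : F} {a : ℤ → M} (H : DihedralSeq η a)
include H

/-- The differences of the sequence only change sign, and an η-eigenvector of a is a (1 -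
η)-eigenvector of 1 - a. -/
theorem complAxis : DihedralSeq (1 - η) (fun i => complAxis F (a i)) where
  closed i := (H.closed i).complAxis
  odd m k := by
    have h := H.odd m k
    ext
    · simp
    · rw [complAxis_mul]
      simp only [unitization_snd_sub, Unitization.snd_inr, unitization_fst_sub, fst_complAxis,
        snd_complAxis, Unitization.snd_smul, mul_sub, mul_neg] at h ⊢
      linear_combination (norm := module) h
  even m k := by
    have h := H.even m k
    rw [complAxis_mul_eq_self_iff, complAxis_mul]
    simp only [unitization_fst_sub, unitization_snd_sub, Unitization.fst_add, Unitization.snd_add,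
      Unitization.fst_inr, Unitization.snd_inr, fst_complAxis, snd_complAxis, mul_add, mul_sub,
      mul_neg, mul_smul_comm, (H.closed m).idem] at h ⊢
    linear_combination (norm := module) h

theorem pairVec_complAxis (j i : ℤ) : pairVec (1 - η) (fun i => _root_.complAxis F (a i)) j i =
    Unitization.inr (pairVec η a j i) - (1 - 2 * η) • 1 := by
  ext
  · simp [pairVec]; ring
  · simp only [pairVec, unitization_snd_sub, Unitization.snd_mul, Unitization.snd_smul,
      Unitization.snd_add, Unitization.snd_inr, Unitization.snd_one, fst_complAxis, snd_complAxis,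
      neg_mul, mul_neg]
    module

/-- The rigid relations for the complements, with parameter 1 - η, are projected to the nonunital
part; the scalar shift in `pairVec_complAxis` is absorbed by the symmetry of the relations under η ↦
1 - η. -/
theorem rigid_of_zeroOneOne (h01 : ∀ i, ZeroOneOne (a i)) (h2 : (2 : F) ≠ 0) (hη0 : η ≠ 0)
    (hη1 : η ≠ 1) (hh : 1 - 2 * η ≠ 0) : RigidSeq η a := by
  have R := (H.complAxis).rigid_of_zeroOneZero (fun i => (h01 i).complAxis (H.closed i)) h2
    (sub_ne_zero.2 hη1.symm) (by simpa using hη0)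
    (by rw [show 1 - 2 * (1 - η) = -(1 - 2 * η) by ring]; exact neg_ne_zero.2 hh)
  have d : ∀ i, _root_.complAxis F (a i) - _root_.complAxis F (a (i + 3)) =
      Unitization.inr (-(a i - a (i + 3))) := by
    intro i; ext
    · simp
    · simp; abel
  have alt : ∀ i, a (i + 1) - a (i + 4) = -(a i - a (i + 3)) := by
    intro i
    have e := congrArg (fun X : Unitization F M => X.toProd.2) (R.alternate i)
    simp at e
    linear_combination (norm := module) -e
  have mg : ∀ i, a i * (a i - a (i + 3)) =
      pairVec η a 2 i - pairVec η a 1 0 + η • (a i - a (i + 3)) := by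
    intro i
    have e := congrArg (fun X : Unitization F M => X.toProd.2) (R.mul_gap i)
    simp only [d, H.pairVec_complAxis] at e
    simp [complAxis_mul, mul_sub] at e
    rw [mul_sub]
    linear_combination (norm := module) e
  refine ⟨fun i => ?_, alt, mg, ?_, ?_⟩
  · have e := congrArg (fun X : Unitization F M => X.toProd.2) (R.gap i)
    simp only [d, H.pairVec_complAxis] at e
    simp at e
    linear_combination (norm := module) e
  · intro i
    have e := congrArg (fun X : Unitization F M => X.toProd.2) (R.pair_mul_pair i)
    simp only [H.pairVec_complAxis] at e
    simp [mul_sub, sub_mul] at e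
    linear_combination (norm := module) e
  · intro i
    have e := congrArg (fun X : Unitization F M => X.toProd.2) (R.pair_mul i)
    simp only [d, H.pairVec_complAxis] at e
    simp only [complAxis_mul, sub_mul, smul_mul_assoc, one_mul] at e
    simp [mul_sub] at e
    have e1 := H.mul_pairVec_one i
    have e2 := H.mul_pairVec_one (i + 3)
    have e3 := alt i
    have e4 := alt (i - 1)
    rw [show i + 3 + 1 = i + 4 by ring, show i + 3 - 1 = i + 2 by ring] at e2
    rw [sub_add_cancel, show i - 1 + 4 = i + 3 by ring, show i - 1 + 3 = i + 2 by ring] at e4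
    apply smul_right_injective M h2
    simp only [mul_sub, mul_comm (pairVec η a 1 0) (a _)] at e ⊢
    linear_combination (norm := module) (2 : F) • e + e1 - e2 + (η * (1 - η)) • (e3 + e4)

end DihedralSeq

end Rigidity

/-! ### The case η = 1/2: the pair vectors do not depend on the base point. -/

section HalfSequences

variable {F : Type*} [Field F] {M : Type*} [NonUnitalNonAssocCommRing M] [Module F M]
  [SMulCommClass F M M] [IsScalarTower F M M]

/-- For `η = 1 / 2`: the product of two pair vectors. -/
theorem half_center_mul (h2 : (2 : F) ≠ 0) {c U U' p p' S D pS pD f : M}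
    (hc : EigenClosed c) (hU : (2 : F) • (c * U) = (4 : F) • p + (2 : F) • c + U)
    (hU' : (2 : F) • (c * U') = (4 : F) • p' + (2 : F) • c + U')
    (hS : (2 : F) • (c * S) = (4 : F) • pS + (2 : F) • c + S)
    (hD : (2 : F) • (c * D) = (4 : F) • pD + (2 : F) • c + D)
    (hp : (8 : F) • (c * p) = (4 : F) • p - (2 : F) • c + U)
    (hp' : (8 : F) • (c * p') = (4 : F) • p' - (2 : F) • c + U')
    (hUp : (8 : F) • (U * p') = (8 : F) • p' - (2 : F) • U + S + D)
    (hUp' : (8 : F) • (U' * p) = (8 : F) • p - (2 : F) • U' + S + D)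
    (hUU : U * U' = f + (2 : F) • pD + U + U') :
    (16 : F) • (p * p') = -(4 : F) • (p + p') + (2 : F) • pD - f + (4 : F) • pS := by
  have hX : c * (U - (4 : F) • p - (2 : F) • c) = 0 := by
    apply smul_right_injective M h2
    simp only [mul_sub, mul_smul_comm, hc.idem, smul_zero]
    linear_combination (norm := module) hU - hp
  have hX' : c * (U' - (4 : F) • p' - (2 : F) • c) = 0 := by
    apply smul_right_injective M h2
    simp only [mul_sub, mul_smul_comm, hc.idem, smul_zero]
    linear_combination (norm := module) hU' - hp'
  have hY : c * (U + (4 : F) • p + (2 : F) • c) = U + (4 : F) • p + (2 : F) • c := by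
    apply smul_right_injective M h2
    simp only [mul_add, mul_smul_comm, hc.idem]
    linear_combination (norm := module) hU + hp
  have hY' : c * (U' + (4 : F) • p' + (2 : F) • c) = U' + (4 : F) • p' + (2 : F) • c := by
    apply smul_right_injective M h2
    simp only [mul_add, mul_smul_comm, hc.idem]
    linear_combination (norm := module) hU' + hp'
  -- Put Z = 4p + 2c and Z' = 4p' + 2c, so that X = U - Z and Y = U + Z, and likewise for X', Y'.
  -- Then c(YY' - XX') = YY', where under c only the known cross terms UZ' and ZU' survive. This
  -- determines ZZ', hence pp', without any rule for 0 ⋆ 1.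
  have hXX := hc.zero_zero _ _ hX hX'
  have hYY := hc.one_one _ _ hY hY'
  have cUp := congrArg (fun x => c * x) hUp
  have cUp' := congrArg (fun x => c * x) hUp'
  have cU := congrArg (fun x => c * x) hU
  have cU' := congrArg (fun x => c * x) hU'
  simp only [add_mul, mul_add, sub_mul, mul_sub, smul_mul_assoc, mul_smul_comm, hc.idem,
    mul_comm U c, mul_comm p c, mul_comm p U'] at hXX hYY cUp cUp' cU cU'
  apply smul_right_injective M h2
  simp only
  linear_combination (norm := module) (2 : F) • (hXX - hYY + cUp + cUp' - hUU + hp + hp' + hS + hD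
    - hU - hU') + (4 : F) • (cU + cU') - hUp - hUp'

/-- For `η = 1 / 2`: the product of two pair vectors when `0`- and `1`-eigenvectors annihilate each
other. -/
theorem half_center_mul_of_annihilate {c U U' p p' pD f : M}
    (hc : EigenClosed c) (h01 : ∀ x y, c * x = 0 → c * y = y → x * y = 0) (h2 : (2 : F) ≠ 0)
    (hU : (2 : F) • (c * U) = (4 : F) • p + (2 : F) • c + U)
    (hU' : (2 : F) • (c * U') = (4 : F) • p' + (2 : F) • c + U')
    (hp : (8 : F) • (c * p) = (4 : F) • p - (2 : F) • c + U)
    (hp' : (8 : F) • (c * p') = (4 : F) • p' - (2 : F) • c + U')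
    (hUU : U * U' = f + (2 : F) • pD + U + U') :
    (16 : F) • (p * p') = -(4 : F) • (p + p') + (2 : F) • pD + f := by
  have hX : c * (U - (4 : F) • p - (2 : F) • c) = 0 := by
    apply smul_right_injective M h2
    simp only [mul_sub, mul_smul_comm, hc.idem, smul_zero]
    linear_combination (norm := module) hU - hp
  have hX' : c * (U' - (4 : F) • p' - (2 : F) • c) = 0 := by
    apply smul_right_injective M h2
    simp only [mul_sub, mul_smul_comm, hc.idem, smul_zero]
    linear_combination (norm := module) hU' - hp'
  have hY : c * (U + (4 : F) • p + (2 : F) • c) = U + (4 : F) • p + (2 : F) • c := by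
    apply smul_right_injective M h2
    simp only [mul_add, mul_smul_comm, hc.idem]
    linear_combination (norm := module) hU + hp
  have hY' : c * (U' + (4 : F) • p' + (2 : F) • c) = U' + (4 : F) • p' + (2 : F) • c := by
    apply smul_right_injective M h2
    simp only [mul_add, mul_smul_comm, hc.idem]
    linear_combination (norm := module) hU' + hp'
  -- With Z = 4p + 2c and Z' = 4p' + 2c, the sum XY' + X'Y is 2(UU' - ZZ'), so ZZ' = UU'.
  have hXY := h01 _ _ hX hY'
  have hYX := h01 _ _ hX' hY
  simp only [mul_add, sub_mul, smul_mul_assoc, mul_smul_comm, hc.idem,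
    mul_comm U c, mul_comm p c, mul_comm p U', mul_comm p' c, mul_comm p' U, mul_comm U' U,
    mul_comm U' c, mul_comm p' p] at hXY hYX
  apply smul_right_injective M h2
  simp only
  linear_combination (norm := module) -hXY - hYX + (2 : F) • hUU - (2 : F) • (hp + hp')

namespace DihedralSeq

variable {η : F} {a : ℤ → M} (H : DihedralSeq η a) (hη : 2 * η = 1) (h2 : (2 : F) ≠ 0)
include H

theorem pairVec_natAbs (j i : ℤ) : pairVec η a (j.natAbs : ℤ) i = pairVec η a j i := by
  rcases Int.natAbs_eq j with h | h
  · rw [← h]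
  · rw [← H.pairVec_neg, ← h]

include hη h2

theorem half_mul_orbit (m k : ℤ) : (2 : F) • (a m * (a (m + k) + a (m - k))) =
    (4 : F) • pairVec η a k m + (2 : F) • a m + (a (m + k) + a (m - k)) := by
  have h := H.mul_orbit m k
  have hs : ∀ x : M, (2 * η) • x = x := fun x => by rw [hη, one_smul]
  linear_combination (norm := module) (2 : F) • h + (2 : F) • hs (a m)
    + hs (a (m + k) + a (m - k))

theorem half_mul_pairVec (m k : ℤ) : (8 : F) • (a m * pairVec η a k m) =
    (4 : F) • pairVec η a k m - (2 : F) • a m + (a (m + k) + a (m - k)) := by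
  have h := H.mul_pairVec m k
  have hs : ∀ x : M, (2 * η) • x = x := fun x => by rw [hη, one_smul]
  have hs2 : ∀ x : M, (4 * η ^ 2) • x = x := fun x => by
    rw [show 4 * η ^ 2 = (2 * η) * (2 * η) by ring, hη, one_mul, one_smul]
  linear_combination (norm := module) (4 : F) • h - (4 : F) • hs (pairVec η a k m)
    - (2 : F) • hs2 (a m) + (2 : F) • hs (a (m + k) + a (m - k)) - hs2 (a (m + k) + a (m - k))

theorem orbit_mul_orbit (m k l : ℤ) : (a (m + k) + a (m - k)) * (a (m + l) + a (m - l)) =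
    (pairVec η a (k + l) (m + k) + pairVec η a (k + l) (m - k))
      + (pairVec η a (k - l) (m + k) + pairVec η a (k - l) (m - k))
      + (a (m + k) + a (m - k)) + (a (m + l) + a (m - l)) := by
  have e1 : a (m + k) * a (m + l) = _ := H.mul_eq' (-(k - l)) (by ring)
  have e2 : a (m + k) * a (m - l) = _ := H.mul_eq' (-(k + l)) (by ring)
  have e3 : a (m - k) * a (m + l) = _ := H.mul_eq' (k + l) (by ring)
  have e4 : a (m - k) * a (m - l) = _ := H.mul_eq' (k - l) (by ring)
  have hs : ∀ x : M, (2 * η) • x = x := fun x => by rw [hη, one_smul]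
  rw [H.pairVec_neg] at e1 e2
  rw [mul_add, add_mul, add_mul]
  linear_combination (norm := module) e1 + e2 + e3 + e4
    + hs (a (m + k) + a (m - k)) + hs (a (m + l) + a (m - l))

theorem half_orbit_mul_pairVec (m k l : ℤ) (hl : ∀ i, pairVec η a l i = pairVec η a l 0) :
    (8 : F) • ((a (m + k) + a (m - k)) * pairVec η a l 0) =
      (8 : F) • pairVec η a l 0 - (2 : F) • (a (m + k) + a (m - k))
      + (a (m + (k + l)) + a (m - (k + l))) + (a (m + (k - l)) + a (m - (k - l))) := by
  have e1 := H.half_mul_pairVec hη h2 (m + k) l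
  have e2 := H.half_mul_pairVec hη h2 (m - k) l
  rw [hl, show m + k + l = m + (k + l) by ring, show m + k - l = m + (k - l) by ring] at e1
  rw [hl, show m - k + l = m - (k - l) by ring, show m - k - l = m - (k + l) by ring] at e2
  rw [add_mul]
  linear_combination (norm := module) e1 + e2

/-- Only the pair vectors of distance k + l keep a base point. The left side is free of m, so
comparing two values of m constrains the next distance in the induction. -/
theorem half_pairVec_mul (m k l : ℤ) (hk : ∀ i, pairVec η a k i = pairVec η a k 0)
    (hl : ∀ i, pairVec η a l i = pairVec η a l 0)
    (hkl : ∀ i, pairVec η a (k - l) i = pairVec η a (k - l) 0) :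
    (16 : F) • (pairVec η a k 0 * pairVec η a l 0) =
      -(4 : F) • (pairVec η a k 0 + pairVec η a l 0) + (2 : F) • pairVec η a (k - l) 0
      - (pairVec η a (k + l) (m + k) + pairVec η a (k + l) (m - k))
      + (4 : F) • pairVec η a (k + l) m := by
  have o := H.half_mul_orbit hη h2 m
  have p := H.half_mul_pairVec hη h2 m
  have e := H.half_orbit_mul_pairVec hη h2 m l k hk
  have oo := H.orbit_mul_orbit hη h2 m k l
  have ok := o k
  have ol := o l
  have pk := p k
  have pl := p l
  have okl := o (k - l)
  rw [hk] at ok pk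
  rw [hl] at ol pl
  rw [hkl] at okl
  rw [hkl (m + k), hkl (m - k), ← two_smul F (pairVec η a (k - l) 0)] at oo
  rw [add_comm l k, show l - k = -(k - l) by ring, ← sub_eq_add_neg, sub_neg_eq_add,
    add_comm (a (m - (k - l)))] at e
  exact half_center_mul h2 (H.closed m) ok ol (o (k + l)) okl pk pl
    (H.half_orbit_mul_pairVec hη h2 m k l hl) e oo

theorem half_pairVec_mul_of_annihilate (h01 : ∀ i x y, a i * x = 0 → a i * y = y → x * y = 0)
    (m k l : ℤ) (hk : ∀ i, pairVec η a k i = pairVec η a k 0)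
    (hl : ∀ i, pairVec η a l i = pairVec η a l 0)
    (hkl : ∀ i, pairVec η a (k - l) i = pairVec η a (k - l) 0) :
    (16 : F) • (pairVec η a k 0 * pairVec η a l 0) =
      -(4 : F) • (pairVec η a k 0 + pairVec η a l 0) + (2 : F) • pairVec η a (k - l) 0
      + (pairVec η a (k + l) (m + k) + pairVec η a (k + l) (m - k)) := by
  have oo := H.orbit_mul_orbit hη h2 m k l
  have ok := H.half_mul_orbit hη h2 m k
  have ol := H.half_mul_orbit hη h2 m l
  have pk := H.half_mul_pairVec hη h2 m k
  have pl := H.half_mul_pairVec hη h2 m l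
  rw [hk] at ok pk
  rw [hl] at ol pl
  rw [hkl (m + k), hkl (m - k), ← two_smul F (pairVec η a (k - l) 0)] at oo
  exact half_center_mul_of_annihilate (H.closed m) (h01 m) h2 ok ol pk pl oo

/-- Write P_m for the pair vector of distance n at m. The split n = 1 + (n - 1) shows that 4P_m -
P_{m+1} - P_{m-1} does not depend on m. If 0- and 1-eigenvectors annihilate each other, P_{m+1} +
P_{m-1} is constant too, and 4 can be cancelled. Otherwise periodicity settles n = 2, and a second
split n = 2 + (n - 2) settles larger n. -/
theorem half_pairVec_const_of_lt (n : ℕ) (hn : 2 ≤ n)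
    (ih : ∀ j : ℤ, j.natAbs < n → ∀ i, pairVec η a j i = pairVec η a j 0)
    (hyp : (∀ i x y, a i * x = 0 → a i * y = y → x * y = 0) ∨ ((3 : F) ≠ 0 ∧ (5 : F) ≠ 0))
    (m : ℤ) : pairVec η a n (m + 1) = pairVec η a n m := by
  have B := fun m => H.half_pairVec_mul hη h2 m 1 (n - 1) (ih _ (by omega)) (ih _ (by omega))
    (ih _ (by omega))
  simp only [show (1 : ℤ) + (n - 1) = n by ring] at B
  rcases hyp with h01 | ⟨h3, h5⟩
  · have A := fun m => H.half_pairVec_mul_of_annihilate hη h2 h01 m 1 (n - 1) (ih _ (by omega))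
      (ih _ (by omega)) (ih _ (by omega))
    simp only [show (1 : ℤ) + (n - 1) = n by ring] at A
    apply smul_right_injective M (mul_ne_zero h2 h2)
    simp only
    linear_combination (norm := module) B m - B (m + 1) + A m - A (m + 1)
  · have B0 := B m
    have B1 := B (m + 1)
    rw [add_sub_cancel_right] at B1
    -- For n = 2, P_{m-1} = P_{m+1}, and 6 kills P_m - P_{m+1}. The split 2 + (n - 2) is unavailable
    -- here because distance 2 is not yet covered by the induction.
    rcases hn.eq_or_lt with rfl | hn
    · have p1 := H.pairVec_add 2 m
      have p2 := H.pairVec_two_sub_one m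
      simp only [Nat.cast_ofNat] at B0 B1 ⊢
      rw [show m + 1 + 1 = m + 2 by ring, p1] at B1
      rw [p2] at B0
      apply smul_right_injective M (mul_ne_zero h2 h3)
      simp only
      linear_combination (norm := module) B0 - B1
    · have G := fun m => H.half_pairVec_mul hη h2 m 2 (n - 2) (ih _ (by omega)) (ih _ (by omega))
        (ih _ (by omega))
      simp only [show (2 : ℤ) + (n - 2) = n by ring] at G
      have B2 := B (m + 2)
      have Bm := B (m - 1)
      have G0 := G m
      have G1 := G (m + 1)
      rw [show m + 1 + 1 = m + 2 by ring] at B1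
      rw [show m + 2 + 1 = m + 3 by ring, show m + 2 - 1 = m + 1 by ring] at B2
      rw [show m - 1 + 1 = m by ring, show m - 1 - 1 = m - 2 by ring] at Bm
      rw [show m + 1 + 2 = m + 3 by ring, show m + 1 - 2 = m - 1 by ring] at G1
      -- On the differences the shift E satisfies E + E⁻¹ = 4 from the first split and E² + E⁻² = 4
      -- from the second. The former implies E² + E⁻² = 14, so 10 kills the differences.
      apply smul_right_injective M (mul_ne_zero h2 h5)
      simp only
      linear_combination (norm := module) (4 : F) • (B0 - B1) + (Bm - B0) + (B1 - B2) + (G1 - G0)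

theorem half_pairVec_const
    (hyp : (∀ i x y, a i * x = 0 → a i * y = y → x * y = 0) ∨ ((3 : F) ≠ 0 ∧ (5 : F) ≠ 0))
    (j i : ℤ) : pairVec η a j i = pairVec η a j 0 := by
  obtain ⟨n, hn⟩ : ∃ n : ℕ, j.natAbs = n := ⟨_, rfl⟩
  induction n using Nat.strong_induction_on generalizing j i with
  | _ n ih =>
  have step : ∀ m, pairVec η a n (m + 1) = pairVec η a n m := by
    rcases Nat.lt_or_ge n 2 with h | h
    · interval_cases n
      · intro m
        simp [pairVec, (H.closed _).idem, ← two_smul F, smul_smul, mul_comm η, hη]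
      · intro m
        simpa using (H.pairVec_one (m + 1)).trans (H.pairVec_one m).symm
    · exact H.half_pairVec_const_of_lt hη h2 n h (fun j hj i => ih _ hj j i rfl) hyp
  rw [← H.pairVec_natAbs, ← H.pairVec_natAbs j 0, hn]
  induction i using Int.induction_on with
  | zero => rfl
  | succ i h => rw [step, h]
  | pred i h => rw [← step, sub_add_cancel, h]

end DihedralSeq

end HalfSequences

/-! ### The multiplication tables of 2A and 3Ĉ inside a rigid sequence. -/

section RigidTable

variable {F : Type*} [Field F] {M : Type*} [NonUnitalNonAssocCommRing M] [Module F M]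
  [SMulCommClass F M M] [IsScalarTower F M M]

/-- The idempotents that span the copy of `2A`; the `i`-th one depends on `i` modulo `2`. -/
def twoAVec (a : ℤ → M) (i : ℤ) : M := a i * (a i - a (i + 3))

/-- The idempotents in the copy of `3Ĉ`; the `i`-th one depends on `i` modulo `3`. -/
def threeCVec (a : ℤ → M) (i : ℤ) : M := a i - twoAVec a i

/-- The multiple of the identity in the copy of `3Ĉ`. -/
def threeCUnit (η : F) (a : ℤ → M) : M :=
  -(2 : F) • pairVec η a 1 0 - (2 * η) • (twoAVec a 0 + twoAVec a 1)
    + (1 - η) • (threeCVec a 0 + threeCVec a 1 + threeCVec a 2)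

namespace RigidSeq

variable {η : F} {a : ℤ → M} (R : RigidSeq η a) (H : DihedralSeq η a) (h2 : (2 : F) ≠ 0)
include R

theorem alternate' {i k l : ℤ} (hk : k = i + 1) (hl : l = i + 4) :
    a k - a l = -(a i - a (i + 3)) := by subst hk hl; exact R.alternate i

theorem twoAVec_eq (i : ℤ) : twoAVec a i =
    pairVec η a 2 i - pairVec η a 1 0 + η • (a i - a (i + 3)) := R.mul_gap i

/-- This is a_i - a_{i+3} = s_i - s_{i+1} for s = `twoAVec a`. With the alternation of a_i - a_{i+3}
it yields period 2 for s, and then period 3 for a - s. -/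
theorem twoAVec_add_one (i : ℤ) : twoAVec a (i + 1) = twoAVec a i - (a i - a (i + 3)) := by
  rw [R.twoAVec_eq, R.twoAVec_eq, R.alternate' rfl (by ring)]
  linear_combination (norm := module) -R.gap i

theorem twoAVec_add_two (i : ℤ) : twoAVec a (i + 2) = twoAVec a i := by
  rw [show i + 2 = i + 1 + 1 by ring, R.twoAVec_add_one, R.twoAVec_add_one,
    R.alternate' rfl (by ring)]
  abel

theorem threeCVec_add_three (i : ℤ) : threeCVec a (i + 3) = threeCVec a i := by
  rw [threeCVec, threeCVec, show i + 3 = i + 1 + 2 by ring, R.twoAVec_add_two, R.twoAVec_add_one,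
    show i + 1 + 2 = i + 3 by ring]
  abel

theorem orbit_two (i : ℤ) : a (i + 2) + a (i - 2) =
    a (i + 1) + a (i - 1) + (2 : F) • (twoAVec a i - twoAVec a (i + 1)) := by
  have e1 := R.alternate' (i := i - 2) (k := i - 1) (l := i + 2) (by ring) (by ring)
  have e2 := R.alternate' (i := i - 1) (k := i) (l := i + 3) (by ring) (by ring)
  rw [show i - 2 + 3 = i + 1 by ring] at e1
  rw [show i - 1 + 3 = i + 2 by ring] at e2
  rw [R.twoAVec_add_one]
  linear_combination (norm := module) e1 - (2 : F) • e2

theorem twoAVec_sub_one (i : ℤ) : twoAVec a (i - 1) = twoAVec a (i + 1) := by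
  rw [← R.twoAVec_add_two]; congr 1; ring

theorem twoAVec_sum (i : ℤ) : twoAVec a i + twoAVec a (i + 1) = twoAVec a 0 + twoAVec a 1 := by
  induction i using Int.induction_on with
  | zero => rfl
  | succ i ih => rw [← ih, show (i : ℤ) + 1 + 1 = i + 2 by ring, R.twoAVec_add_two, add_comm]
  | pred i ih => rw [← ih, sub_add_cancel, R.twoAVec_sub_one, add_comm]

theorem threeCVec_sum (i : ℤ) : threeCVec a (i - 1) + threeCVec a i + threeCVec a (i + 1) =
    threeCVec a 0 + threeCVec a 1 + threeCVec a 2 := by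
  induction i using Int.induction_on with
  | zero =>
    rw [show (0 : ℤ) - 1 = -1 by rfl, ← R.threeCVec_add_three (-1)]
    norm_num; abel
  | succ i ih =>
    rw [← ih, show (i : ℤ) + 1 + 1 = i - 1 + 3 by ring, R.threeCVec_add_three, add_sub_cancel_right]
    abel
  | pred i ih =>
    rw [← ih, ← R.threeCVec_add_three (-(i : ℤ) - 1 - 1), sub_add_cancel,
      show -(i : ℤ) - 1 - 1 + 3 = -i + 1 by ring]
    abel

theorem threeCUnit_eq (i : ℤ) : threeCUnit η a = -(2 : F) • pairVec η a 1 0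
    - (2 * η) • (twoAVec a i + twoAVec a (i + 1))
    + (1 - η) • (threeCVec a (i - 1) + threeCVec a i + threeCVec a (i + 1)) := by
  rw [threeCUnit, R.twoAVec_sum, R.threeCVec_sum]

include H h2

theorem mul_twoAVec (i : ℤ) : a i * twoAVec a i = twoAVec a i := by
  have e1 := H.mul_pairVec_one i
  have e2 := H.mul_pairVec i 2
  have e3 := R.twoAVec_eq i
  have e4 := congrArg (fun x => a i * x) e3
  have e5 : a i * (a i - a (i + 3)) = twoAVec a i := rfl
  simp only [mul_add, mul_smul_comm, mul_sub (a i) (pairVec _ _ _ _)] at e4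
  rw [e5] at e4
  have e6 := R.orbit_two i
  rw [R.twoAVec_add_one] at e6
  apply smul_right_injective M h2
  simp only
  linear_combination (norm := module) (2 : F) • e4 + e2 - e1 + (η * (1 - η)) • e6
    - (2 * (1 - η)) • e3

theorem mul_twoAVec_add_one (i : ℤ) : a i * twoAVec a (i + 1) = 0 := by
  rw [R.twoAVec_add_one, mul_sub, R.mul_twoAVec H h2]
  exact sub_self _

theorem succ_mul_twoAVec (i : ℤ) : a (i + 1) * twoAVec a i = 0 := by
  rw [← R.twoAVec_add_two, show i + 2 = i + 1 + 1 by ring, R.mul_twoAVec_add_one H h2]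

/-- Multiplying a_i - a_{i+3} = s_i - s_{i+1} by s_i and by s_{i+1} expresses both squares through
s_i s_{i+1}. Since a_i kills the square of s_{i+1} and fixes that of s_i, the mixed product is zero.
-/
theorem twoAVec_mul_aux (i : ℤ) : twoAVec a i * twoAVec a (i + 1) = 0 ∧
    twoAVec a i * twoAVec a i = twoAVec a i := by
  have h : a i - a (i + 3) = twoAVec a i - twoAVec a (i + 1) := by
    rw [R.twoAVec_add_one]; abel
  have h3 : a (i + 3) * twoAVec a (i + 1) = twoAVec a (i + 1) := by
    rw [← R.twoAVec_add_two, show i + 1 + 2 = i + 3 by ring, R.mul_twoAVec H h2]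
  have h4 : a (i + 3) * twoAVec a i = 0 := by
    rw [← R.twoAVec_add_two, show i + 3 = i + 2 + 1 by ring, R.succ_mul_twoAVec H h2]
  have e1 := congrArg (· * twoAVec a i) h
  have e2 := congrArg (· * twoAVec a (i + 1)) h
  simp only [sub_mul, R.mul_twoAVec H h2, R.mul_twoAVec_add_one H h2, h3, h4,
    mul_comm (twoAVec a (i + 1)) (twoAVec a i)] at e1 e2
  have f1 := (H.closed i).one_one _ _ (R.mul_twoAVec H h2 i) (R.mul_twoAVec H h2 i)
  have f2 := (H.closed i).zero_zero _ _ (R.mul_twoAVec_add_one H h2 i)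
    (R.mul_twoAVec_add_one H h2 i)
  have e1' : twoAVec a i * twoAVec a i = twoAVec a i * twoAVec a (i + 1) + twoAVec a i := by
    linear_combination (norm := module) -e1
  have e2' : twoAVec a (i + 1) * twoAVec a (i + 1) =
      twoAVec a i * twoAVec a (i + 1) + twoAVec a (i + 1) := by
    linear_combination (norm := module) e2
  rw [e1', mul_add, R.mul_twoAVec H h2] at f1
  rw [e2', mul_add, R.mul_twoAVec_add_one H h2, add_zero] at f2
  rw [f2, zero_add] at f1
  have f3 : twoAVec a i * twoAVec a (i + 1) = 0 := by
    linear_combination (norm := module) -f1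
  exact ⟨f3, by rw [e1', f3, zero_add]⟩

theorem twoAVec_mul_self (i : ℤ) : twoAVec a i * twoAVec a i = twoAVec a i :=
  (R.twoAVec_mul_aux H h2 i).2

theorem twoAVec_mul_succ (i : ℤ) : twoAVec a i * twoAVec a (i + 1) = 0 :=
  (R.twoAVec_mul_aux H h2 i).1

theorem threeCVec_mul_twoAVec_self (i : ℤ) : threeCVec a i * twoAVec a i = 0 := by
  rw [threeCVec, sub_mul, R.mul_twoAVec H h2, R.twoAVec_mul_self H h2, sub_self]

theorem threeCVec_mul_twoAVec_succ (i : ℤ) : threeCVec a i * twoAVec a (i + 1) = 0 := by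
  rw [threeCVec, sub_mul, R.mul_twoAVec_add_one H h2, R.twoAVec_mul_succ H h2, sub_self]

theorem threeCVec_mul_self (i : ℤ) : threeCVec a i * threeCVec a i = threeCVec a i := by
  nth_rw 2 [threeCVec]
  rw [mul_sub, R.threeCVec_mul_twoAVec_self H h2, threeCVec, sub_mul, (H.closed i).idem,
    mul_comm, R.mul_twoAVec H h2, sub_zero]

theorem threeCVec_mul_succ (i : ℤ) : threeCVec a i * threeCVec a (i + 1) =
    pairVec η a 1 0 + η • (a i + a (i + 1)) := by
  nth_rw 2 [threeCVec]
  rw [mul_sub, R.threeCVec_mul_twoAVec_succ H h2, threeCVec, sub_mul, mul_comm (twoAVec a i),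
    R.succ_mul_twoAVec H h2, H.mul_eq, H.pairVec_one, sub_zero, sub_zero]

theorem pairVec_mul_threeCVec (i : ℤ) : (2 : F) • (pairVec η a 1 0 * threeCVec a i) =
    (2 * (1 - η)) • pairVec η a 1 0 - (2 * η ^ 2) • a i
      + (η * (1 - η)) • (a (i + 1) + a (i - 1)) + (2 * η) • twoAVec a i := by
  have e1 := H.mul_pairVec_one i
  have e2 : pairVec η a 1 0 * twoAVec a i = -η • twoAVec a i := R.pair_mul i
  rw [threeCVec, mul_sub, e2, mul_comm _ (a i)]
  linear_combination (norm := module) e1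

theorem threeCUnit_mul_twoAVec (i : ℤ) : threeCUnit η a * twoAVec a i = 0 := by
  have e2 : pairVec η a 1 0 * twoAVec a i = -η • twoAVec a i := R.pair_mul i
  have e3 := R.threeCVec_mul_twoAVec_succ H h2 (i - 1)
  have e4 : threeCVec a (i + 1) * twoAVec a i = 0 := by
    rw [← R.twoAVec_add_two, show i + 2 = i + 1 + 1 by ring, R.threeCVec_mul_twoAVec_succ H h2]
  rw [sub_add_cancel] at e3
  rw [R.threeCUnit_eq i]
  simp only [add_mul, sub_mul, smul_mul_assoc, e2, e3, e4, R.threeCVec_mul_twoAVec_self H h2,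
    R.twoAVec_mul_self H h2, mul_comm (twoAVec a (i + 1)), R.twoAVec_mul_succ H h2]
  module

theorem threeCUnit_mul_threeCVec (i : ℤ) :
    threeCUnit η a * threeCVec a i = (η + 1) • threeCVec a i := by
  have e1 := R.pairVec_mul_threeCVec H h2 i
  have e3 := R.threeCVec_mul_succ H h2 (i - 1)
  have e4 := R.threeCVec_mul_succ H h2 i
  rw [sub_add_cancel] at e3
  rw [R.threeCUnit_eq i]
  simp only [add_mul, sub_mul, smul_mul_assoc, mul_comm (twoAVec a _), e3,
    R.threeCVec_mul_twoAVec_self H h2, R.threeCVec_mul_twoAVec_succ H h2,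
    R.threeCVec_mul_self H h2, mul_comm (threeCVec a (i + 1)), e4]
  rw [threeCVec]
  rw [threeCVec] at e1
  linear_combination (norm := module) -e1

/-- The second factor is expanded. All products are then known except the one with `pairVec η a 1
0`, which `hqp` computes from `pair_mul_pair`. -/
theorem threeCUnit_mul_self : threeCUnit η a * threeCUnit η a = (η + 1) • threeCUnit η a := by
  have u0 := R.threeCUnit_mul_threeCVec H h2 0
  have u1 := R.threeCUnit_mul_threeCVec H h2 (0 + 1)
  have u2 := R.threeCUnit_mul_threeCVec H h2 (0 - 1)
  have v0 := R.threeCUnit_mul_twoAVec H h2 0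
  have v1 := R.threeCUnit_mul_twoAVec H h2 (0 + 1)
  have p0 := R.pairVec_mul_threeCVec H h2 0
  have p1 := R.pairVec_mul_threeCVec H h2 (0 + 1)
  have p2 := R.pairVec_mul_threeCVec H h2 (0 - 1)
  have w0 : pairVec η a 1 0 * twoAVec a 0 = -η • twoAVec a 0 := R.pair_mul 0
  have w1 : pairVec η a 1 0 * twoAVec a (0 + 1) = -η • twoAVec a (0 + 1) := R.pair_mul _
  have pp := R.pair_mul_pair 0
  have hW := R.orbit_two 0
  have hQ := R.twoAVec_eq 0
  have hs := R.twoAVec_add_one 0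
  have hq := R.threeCUnit_eq 0
  have hqp : (2 : F) • (threeCUnit η a * pairVec η a 1 0) =
      (2 * (η + 1)) • pairVec η a 1 0 + (2 * η * (η + 1)) • (twoAVec a 0 + twoAVec a (0 + 1)) := by
    rw [hq]
    simp only [add_mul, sub_mul, smul_mul_assoc, mul_comm (twoAVec a _), mul_comm (threeCVec a _),
      w0, w1]
    rw [R.twoAVec_sub_one, show (0 : ℤ) - 1 + 1 = 0 by rfl,
      show (0 : ℤ) - 1 - 1 = 0 - 2 by rfl] at p2
    rw [show (0 : ℤ) + 1 + 1 = 0 + 2 by rfl, show (0 : ℤ) + 1 - 1 = 0 by rfl] at p1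
    linear_combination (norm := module) -(2 : F) • pp + (1 - η) • (p0 + p1 + p2)
      + (η * (1 - η) ^ 2) • hW + (2 * η * (1 - η)) • hQ + (2 * η ^ 2 * (1 - η)) • hs
  nth_rw 2 [hq]
  simp only [mul_add, mul_sub, mul_smul_comm, u0, u1, u2, v0, v1]
  nth_rw 2 [hq]
  linear_combination (norm := module) -hqp

end RigidSeq

end RigidTable

/-! ### The ℤ/2-grading of the fusion rule and the reflection of an axis. -/

section AxisReflections

variable {F : Type*} [Field F] {M : Type*} [NonUnitalNonAssocCommRing M] [Module F M]
  [SMulCommClass F M M] [IsScalarTower F M M]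

theorem mem_axisEigenspace_iff {a : M} {s : F} {x : M} :
    x ∈ axisEigenspace F a s ↔ a * x = s • x := by
  rw [axisEigenspace, Module.End.mem_eigenspace_iff, LinearMap.mulLeft_apply]

section JordanFusion

variable {Φ : Set F} {η : F}

theorem jordanFusion_star_zero_zero (hη0 : η ≠ 0) : (jordanFusion Φ η).star 0 0 = {0} := by
  simp [jordanFusion, hη0.symm]

theorem jordanFusion_star_one_one (hη1 : η ≠ 1) : (jordanFusion Φ η).star 1 1 = {1} := by
  simp [jordanFusion, hη1.symm]

theorem jordanFusion_star_zero_one (hη0 : η ≠ 0) (hη1 : η ≠ 1) :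
    (jordanFusion Φ η).star 0 1 = Φ := by
  simp [jordanFusion, hη0.symm, hη1.symm]

theorem jordanFusion_star_eta {s : F} (hs : s ≠ η) : (jordanFusion Φ η).star s η = {η} := by
  simp [jordanFusion, hs]

theorem jordanFusion_star_eta' {s : F} (hs : s ≠ η) : (jordanFusion Φ η).star η s = {η} := by
  simp [jordanFusion, hs]

theorem jordanFusion_star_eta_eta : (jordanFusion Φ η).star η η = {0, 1} := by
  simp [jordanFusion]

theorem zero_mem_jordanFusion : (0 : F) ∈ (jordanFusion Φ η).S := by simp [jordanFusion]

theorem one_mem_jordanFusion : (1 : F) ∈ (jordanFusion Φ η).S := by simp [jordanFusion]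

theorem eta_mem_jordanFusion : η ∈ (jordanFusion Φ η).S := by simp [jordanFusion]

end JordanFusion

namespace IsAxis

variable {Φ : Set F} {η : F} {a : M}

theorem exists_decomposition (h : IsAxis F (jordanFusion Φ η) a) (x : M) :
    ∃ x₀ x₁ y, a * x₀ = 0 ∧ a * x₁ = x₁ ∧ a * y = η • y ∧ x = x₀ + x₁ + y := by
  classical
  have ht := h.isInternal.submodule_iSup_eq_top
  have hle : (⨆ s : (jordanFusion Φ η).S, axisEigenspace F a (s : F)) ≤
      axisEigenspace F a 0 ⊔ axisEigenspace F a 1 ⊔ axisEigenspace F a η := by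
    refine iSup_le ?_
    rintro ⟨s, hs⟩
    rcases hs with rfl | rfl | rfl
    · exact le_sup_left.trans le_sup_left
    · exact le_sup_right.trans le_sup_left
    · exact le_sup_right
  have hx : x ∈ axisEigenspace F a 0 ⊔ axisEigenspace F a 1 ⊔ axisEigenspace F a η :=
    hle (ht ▸ Submodule.mem_top)
  obtain ⟨z, hz, y, hy, rfl⟩ := Submodule.mem_sup.1 hx
  obtain ⟨x₀, h0, x₁, h1, rfl⟩ := Submodule.mem_sup.1 hz
  rw [mem_axisEigenspace_iff] at *
  exact ⟨x₀, x₁, y, by simpa using h0, by simpa using h1, hy, rfl⟩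

theorem eigenClosed (h : IsAxis F (jordanFusion Φ η) a) (hη0 : η ≠ 0) (hη1 : η ≠ 1) :
    EigenClosed a where
  idem := h.idem
  zero_zero x y hx hy := by
    have := h.fusion 0 zero_mem_jordanFusion 0 zero_mem_jordanFusion x
      (by simpa [mem_axisEigenspace_iff]) y (by simpa [mem_axisEigenspace_iff])
    simpa [jordanFusion_star_zero_zero hη0, mem_axisEigenspace_iff] using this
  one_one x y hx hy := by
    have := h.fusion 1 one_mem_jordanFusion 1 one_mem_jordanFusion x
      (by simpa [mem_axisEigenspace_iff]) y (by simpa [mem_axisEigenspace_iff])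
    simpa [jordanFusion_star_one_one hη1, mem_axisEigenspace_iff] using this

theorem zero_mul_one_mem (h : IsAxis F (jordanFusion Φ η) a) (hη0 : η ≠ 0) (hη1 : η ≠ 1) {x y : M}
    (hx : a * x = 0) (hy : a * y = y) : x * y ∈ ⨆ u ∈ Φ, axisEigenspace F a u := by
  have := h.fusion 0 zero_mem_jordanFusion 1 one_mem_jordanFusion x
    (by simpa [mem_axisEigenspace_iff]) y (by simpa [mem_axisEigenspace_iff])
  rwa [jordanFusion_star_zero_one hη0 hη1] at this

theorem zeroOneZero (h : IsAxis F (jordanFusion Φ η) a) (hη0 : η ≠ 0) (hη1 : η ≠ 1)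
    (hΦ : Φ ⊆ {0}) : ZeroOneZero a := by
  intro x y hx hy
  have := h.zero_mul_one_mem hη0 hη1 hx hy
  have h2 : (⨆ u ∈ Φ, axisEigenspace F a u) ≤ axisEigenspace F a 0 :=
    iSup₂_le fun u hu => by rw [hΦ hu]
  simpa [mem_axisEigenspace_iff] using h2 this

theorem zeroOneOne (h : IsAxis F (jordanFusion Φ η) a) (hη0 : η ≠ 0) (hη1 : η ≠ 1)
    (hΦ : Φ ⊆ {1}) : ZeroOneOne a := by
  intro x y hx hy
  have := h.zero_mul_one_mem hη0 hη1 hx hy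
  have h2 : (⨆ u ∈ Φ, axisEigenspace F a u) ≤ axisEigenspace F a 1 :=
    iSup₂_le fun u hu => by rw [hΦ hu]
  simpa [mem_axisEigenspace_iff] using h2 this

theorem zero_mul_one_eq_zero (h : IsAxis F (jordanFusion Φ η) a) (hη0 : η ≠ 0) (hη1 : η ≠ 1)
    (hΦ : Φ = ∅) (x y : M) (hx : a * x = 0) (hy : a * y = y) : x * y = 0 := by
  have := h.zero_mul_one_mem hη0 hη1 hx hy
  simpa [hΦ] using this

theorem mul_mul_of_mem_sup {z : M} :
    z ∈ axisEigenspace F a 0 ⊔ axisEigenspace F a 1 → a * (a * z) = a * z := by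
  intro h
  obtain ⟨x, hx, y, hy, rfl⟩ := Submodule.mem_sup.1 h
  rw [mem_axisEigenspace_iff] at hx hy
  simp only [zero_smul, one_smul] at hx hy
  rw [mul_add, hx, hy, zero_add, hy]

end IsAxis

/-- The map that is `1` on the `0`- and `1`-eigenspaces of `a` and `-1` on the `η`-eigenspace. -/
noncomputable def axisReflection (η : F) (a : M) : M →ₗ[F] M :=
  LinearMap.id - (2 / (η * (η - 1))) •
    (LinearMap.mulLeft F a ∘ₗ LinearMap.mulLeft F a - LinearMap.mulLeft F a)

theorem axisReflection_apply (η : F) (a x : M) : axisReflection η a x =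
    x - (2 / (η * (η - 1))) • (a * (a * x) - a * x) := by
  simp [axisReflection]

theorem axisReflection_of_even {η : F} {a x : M} (h : a * (a * x) = a * x) :
    axisReflection η a x = x := by
  rw [axisReflection_apply, h]; simp

/-- The polynomial T² - T vanishes at 0 and 1 and equals η(η - 1) at η; hence the normalisation by
2/(η(η - 1)). -/
theorem axisReflection_of_odd {η : F} (hη0 : η ≠ 0) (hη1 : η ≠ 1) {a x : M}
    (h : a * x = η • x) : axisReflection η a x = -x := by
  have h1 := sub_ne_zero.2 hη1
  rw [axisReflection_apply, h, mul_smul_comm, h, smul_smul, ← sub_smul, smul_smul,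
    show 2 / (η * (η - 1)) * (η * η - η) = 2 by field_simp]
  module

namespace IsAxis

variable {Φ : Set F} {η : F} {a : M} (h : IsAxis F (jordanFusion Φ η) a) (hη0 : η ≠ 0)
  (hη1 : η ≠ 1)
include h

theorem exists_even_odd (x : M) : ∃ y z, a * (a * y) = a * y ∧ a * z = η • z ∧ x = y + z := by
  obtain ⟨x₀, x₁, y, h0, h1, hy, rfl⟩ := h.exists_decomposition x
  exact ⟨x₀ + x₁, y, by simp [mul_add, h0, h1], hy, rfl⟩

include hη0 hη1

theorem odd_mul_odd {x y : M} (hx : a * x = η • x) (hy : a * y = η • y) :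
    a * (a * (x * y)) = a * (x * y) := by
  have := h.fusion η eta_mem_jordanFusion η eta_mem_jordanFusion x
    (mem_axisEigenspace_iff.2 hx) y (mem_axisEigenspace_iff.2 hy)
  rw [jordanFusion_star_eta_eta, iSup_insert, iSup_singleton] at this
  exact mul_mul_of_mem_sup this

theorem even_mul_odd {x y : M} (hx : a * (a * x) = a * x) (hy : a * y = η • y) :
    a * (x * y) = η • (x * y) := by
  -- The condition a(ax) = ax characterises the even vectors: x - ax is killed and ax is fixed by a.
  have e : x = (x - a * x) + a * x := by abel
  have f0 := h.fusion 0 zero_mem_jordanFusion η eta_mem_jordanFusion (x - a * x)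
    (by simp [mem_axisEigenspace_iff, mul_sub, hx]) y (mem_axisEigenspace_iff.2 hy)
  have f1 := h.fusion 1 one_mem_jordanFusion η eta_mem_jordanFusion (a * x)
    (by simp [mem_axisEigenspace_iff, hx]) y (mem_axisEigenspace_iff.2 hy)
  rw [jordanFusion_star_eta hη0.symm, iSup_singleton, mem_axisEigenspace_iff] at f0
  rw [jordanFusion_star_eta hη1.symm, iSup_singleton, mem_axisEigenspace_iff] at f1
  rw [e, add_mul, mul_add, f0, f1, smul_add]

theorem even_mul_even (hΦ : Φ ⊆ {0, 1}) {x y : M} (hx : a * (a * x) = a * x)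
    (hy : a * (a * y) = a * y) : a * (a * (x * y)) = a * (x * y) := by
  have hx0 : a * (x - a * x) = 0 := by rw [mul_sub, hx, sub_self]
  have hy0 : a * (y - a * y) = 0 := by rw [mul_sub, hy, sub_self]
  have c := h.eigenClosed hη0 hη1
  have f00 := c.zero_zero _ _ hx0 hy0
  have f11 := c.one_one _ _ hx hy
  have hle : (⨆ u ∈ Φ, axisEigenspace F a u) ≤ axisEigenspace F a 0 ⊔ axisEigenspace F a 1 := by
    refine iSup₂_le fun u hu => ?_
    rcases hΦ hu with rfl | rfl
    · exact le_sup_left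
    · exact le_sup_right
  have f01 := mul_mul_of_mem_sup (hle (h.zero_mul_one_mem hη0 hη1 hx0 hy))
  have f10 := mul_mul_of_mem_sup (hle (h.zero_mul_one_mem hη0 hη1 hy0 hx))
  have e : x * y = (x - a * x) * (y - a * y) + (a * x) * (a * y) + (x - a * x) * (a * y)
      + (y - a * y) * (a * x) := by
    simp only [sub_mul, mul_sub, mul_comm y, mul_comm (a * y) (a * x)]
    abel
  rw [e]
  simp only [mul_add, f00, f11, f01, f10, mul_zero]

/-- The fusion rule is graded with 0, 1 even and η odd. The inclusion Φ ⊆ {0, 1} is what keeps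
products of even vectors even. -/
theorem axisReflection_mul (hΦ : Φ ⊆ {0, 1}) (x y : M) :
    axisReflection η a (x * y) = axisReflection η a x * axisReflection η a y := by
  obtain ⟨x, x', hx, hx', rfl⟩ := h.exists_even_odd x
  obtain ⟨y, y', hy, hy', rfl⟩ := h.exists_even_odd y
  have e1 := axisReflection_of_even (η := η) (h.even_mul_even hη0 hη1 hΦ hx hy)
  have e2 := axisReflection_of_even (η := η) (h.odd_mul_odd hη0 hη1 hx' hy')
  have e3 := axisReflection_of_odd hη0 hη1 (h.even_mul_odd hη0 hη1 hx hy')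
  have e4 := axisReflection_of_odd hη0 hη1 (h.even_mul_odd hη0 hη1 hy hx')
  rw [mul_comm y] at e4
  simp only [add_mul, mul_add, map_add, e1, e2, e3, e4, axisReflection_of_even hx,
    axisReflection_of_even hy, axisReflection_of_odd hη0 hη1 hx',
    axisReflection_of_odd hη0 hη1 hy', mul_neg, neg_mul]
  abel

theorem axisReflection_involutive : Function.Involutive (axisReflection η a) := by
  intro x
  obtain ⟨x, x', hx, hx', rfl⟩ := h.exists_even_odd x
  simp only [map_add, axisReflection_of_even hx, axisReflection_of_odd hη0 hη1 hx', map_neg,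
    neg_neg]

theorem mul_sub_axisReflection (x : M) :
    a * (x - axisReflection η a x) = η • (x - axisReflection η a x) := by
  obtain ⟨x, x', hx, hx', rfl⟩ := h.exists_even_odd x
  simp only [map_add, axisReflection_of_even hx, axisReflection_of_odd hη0 hη1 hx']
  rw [show x + x' - (x + -x') = x' + x' by abel, mul_add, hx', smul_add]

theorem mul_mul_add_axisReflection (x : M) :
    a * (a * (x + axisReflection η a x)) = a * (x + axisReflection η a x) := by
  obtain ⟨x, x', hx, hx', rfl⟩ := h.exists_even_odd x
  simp only [map_add, axisReflection_of_even hx, axisReflection_of_odd hη0 hη1 hx']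
  rw [show x + x' + (x + -x') = x + x by abel, mul_add, mul_add, hx]

end IsAxis

end AxisReflections

/-! ### The dihedral sequence of two axes. -/

section DihedralOrbit

variable {F : Type*} [Field F] {M : Type*} [NonUnitalNonAssocCommRing M] [Module F M]
  [SMulCommClass F M M] [IsScalarTower F M M]

variable (F M) in
/-- The linear automorphisms that preserve the multiplication. -/
def algAut : Subgroup (M ≃ₗ[F] M) where
  carrier := {e | ∀ x y, e (x * y) = e x * e y}
  mul_mem' {e f} he hf x y := by
    simp only [LinearEquiv.mul_apply]; rw [hf, he]
  one_mem' x y := rfl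
  inv_mem' {e} he x y := by
    apply e.injective
    rw [he]
    simp only [← LinearEquiv.mul_apply, mul_inv_cancel, LinearEquiv.coe_one, id]

theorem inv_apply_self' (e : M ≃ₗ[F] M) (x : M) : e⁻¹ (e x) = x := by
  rw [← LinearEquiv.mul_apply, inv_mul_cancel]; rfl

section Transport

variable {e : M ≃ₗ[F] M} (he : e ∈ algAut F M) {c : M}
include he

theorem apply_mul_eq_iff (x y : M) : e c * x = y ↔ c * e⁻¹ x = e⁻¹ y := by
  rw [← (e⁻¹).injective.eq_iff, (algAut F M).inv_mem he, inv_apply_self']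

theorem EigenClosed.map (h : EigenClosed c) : EigenClosed (e c) where
  idem := by rw [← he, h.idem]
  zero_zero x y hx hy := by
    rw [apply_mul_eq_iff he, map_zero] at *
    rw [(algAut F M).inv_mem he]
    exact h.zero_zero _ _ hx hy
  one_one x y hx hy := by
    rw [apply_mul_eq_iff he] at *
    rw [(algAut F M).inv_mem he]
    exact h.one_one _ _ hx hy

theorem ZeroOneZero.map (h : ZeroOneZero c) : ZeroOneZero (e c) := by
  intro x y hx hy
  rw [apply_mul_eq_iff he] at *
  rw [map_zero] at *
  rw [(algAut F M).inv_mem he]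
  exact h _ _ hx hy

theorem ZeroOneOne.map (h : ZeroOneOne c) : ZeroOneOne (e c) := by
  intro x y hx hy
  rw [apply_mul_eq_iff he] at *
  rw [map_zero] at hx
  rw [(algAut F M).inv_mem he]
  exact h _ _ hx hy

theorem annihilate_map (h : ∀ x y, c * x = 0 → c * y = y → x * y = 0) (x y : M)
    (hx : e c * x = 0) (hy : e c * y = y) : x * y = 0 := by
  rw [apply_mul_eq_iff he] at *
  rw [map_zero] at hx
  have := h _ _ hx hy
  rw [← (algAut F M).inv_mem he] at this
  simpa using this

end Transport

/-- The reflection at an axis as an algebra automorphism. -/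
noncomputable def reflectionEquiv (η : F) (a : M) (h : Function.Involutive (axisReflection η a)) :
    M ≃ₗ[F] M :=
  LinearEquiv.ofInvolutive (axisReflection η a) h

/-- The orbit of two vectors under the group generated by two reflections, where `r` is the product
of the reflections. -/
noncomputable def dihedralOrbit (r : M ≃ₗ[F] M) (a b : M) (i : ℤ) : M :=
  if Even i then (r ^ (i / 2)) a else (r ^ (i / 2)) b

theorem dihedralOrbit_even (r : M ≃ₗ[F] M) (a b : M) {i : ℤ} (n : ℤ) (h : i = 2 * n) :
    dihedralOrbit r a b i = (r ^ n) a := by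
  subst h
  rw [dihedralOrbit, if_pos (even_two_mul n), Int.mul_ediv_cancel_left _ two_ne_zero]

theorem dihedralOrbit_odd (r : M ≃ₗ[F] M) (a b : M) {i : ℤ} (n : ℤ) (h : i = 2 * n + 1) :
    dihedralOrbit r a b i = (r ^ n) b := by
  subst h
  rw [dihedralOrbit, if_neg (by simp), show (2 * n + 1) / 2 = n by omega]

theorem zpow_dihedralOrbit (r : M ≃ₗ[F] M) (a b : M) (n i : ℤ) :
    (r ^ n) (dihedralOrbit r a b i) = dihedralOrbit r a b (i + 2 * n) := by
  rcases Int.even_or_odd' i with ⟨k, rfl | rfl⟩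
  · rw [dihedralOrbit_even r a b k rfl, dihedralOrbit_even r a b (n + k) (by ring), zpow_add,
      LinearEquiv.mul_apply]
  · rw [dihedralOrbit_odd r a b k rfl, dihedralOrbit_odd r a b (n + k) (by ring), zpow_add,
      LinearEquiv.mul_apply]

/-- The involution s inverts the rotation r = ts, fixes a, and sends b to r⁻¹ b; this gives i ↦ -i.
The action of t follows from t = rs. -/
theorem reflect_dihedralOrbit {s t : M ≃ₗ[F] M} (hs : s * s = 1) (ht : t * t = 1) {a b : M}
    (hsa : s a = a) (htb : t b = b) (i : ℤ) :
    s (dihedralOrbit (t * s) a b i) = dihedralOrbit (t * s) a b (-i) ∧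
    t (dihedralOrbit (t * s) a b i) = dihedralOrbit (t * s) a b (2 - i) := by
  have hs' : s⁻¹ = s := inv_eq_of_mul_eq_one_left hs
  have ht' : t⁻¹ = t := inv_eq_of_mul_eq_one_left ht
  have hr : (t * s)⁻¹ = s * t := by rw [mul_inv_rev, hs', ht']
  have conj : ∀ n : ℤ, s * (t * s) ^ n = (t * s) ^ (-n) * s := by
    intro n
    have e : s * (t * s) * s⁻¹ = (t * s)⁻¹ := by
      rw [hr, hs', mul_assoc, mul_assoc, hs, mul_one]
    have := conj_zpow (i := n) (a := s) (b := t * s)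
    rw [e, inv_zpow, ← zpow_neg] at this
    rw [this, inv_mul_cancel_right]
  have hsb : s b = (t * s)⁻¹ b := by rw [hr, LinearEquiv.mul_apply, htb]
  have S : ∀ i, s (dihedralOrbit (t * s) a b i) = dihedralOrbit (t * s) a b (-i) := by
    intro i
    rcases Int.even_or_odd' i with ⟨k, rfl | rfl⟩
    · rw [dihedralOrbit_even _ a b k rfl, dihedralOrbit_even _ a b (-k) (by ring),
        ← LinearEquiv.mul_apply, conj, LinearEquiv.mul_apply, hsa]
    · rw [dihedralOrbit_odd _ a b k rfl, dihedralOrbit_odd _ a b (-k - 1) (by ring),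
        ← LinearEquiv.mul_apply, conj, LinearEquiv.mul_apply, hsb, zpow_sub_one,
        LinearEquiv.mul_apply]
  refine ⟨S i, ?_⟩
  have h1 := zpow_dihedralOrbit (t * s) a b 1 (-i)
  rw [← S, zpow_one, ← LinearEquiv.mul_apply, mul_assoc, hs, mul_one] at h1
  rw [h1]; congr 1; ring

/-- Two axes lie in a dihedral sequence whose members are images of the two axes under algebra
automorphisms. -/
theorem exists_dihedralSeq {Φ : Set F} (hΦ : Φ ⊆ {0, 1}) {η : F} (hη0 : η ≠ 0) (hη1 : η ≠ 1)
    {b : Fin 2 → M} (hb : ∀ i, IsAxis F (jordanFusion Φ η) (b i)) :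
    ∃ a : ℤ → M, a 0 = b 0 ∧ a 1 = b 1 ∧ DihedralSeq η a ∧
      ∀ i, ∃ e ∈ algAut F M, ∃ k, a i = e (b k) := by
  set s := reflectionEquiv η (b 0) ((hb 0).axisReflection_involutive hη0 hη1) with hs
  set t := reflectionEquiv η (b 1) ((hb 1).axisReflection_involutive hη0 hη1) with ht
  have hs_app : ∀ x, s x = axisReflection η (b 0) x := fun x => rfl
  have ht_app : ∀ x, t x = axisReflection η (b 1) x := fun x => rfl
  have hss : s * s = 1 := LinearEquiv.ext ((hb 0).axisReflection_involutive hη0 hη1)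
  have htt : t * t = 1 := LinearEquiv.ext ((hb 1).axisReflection_involutive hη0 hη1)
  have hsa : s (b 0) = b 0 := axisReflection_of_even (by rw [(hb 0).idem, (hb 0).idem])
  have htb : t (b 1) = b 1 := axisReflection_of_even (by rw [(hb 1).idem, (hb 1).idem])
  have hsm : s ∈ algAut F M := (hb 0).axisReflection_mul hη0 hη1 hΦ
  have htm : t ∈ algAut F M := (hb 1).axisReflection_mul hη0 hη1 hΦ
  have hrm : ∀ n : ℤ, (t * s) ^ n ∈ algAut F M := fun n =>
    (algAut F M).zpow_mem ((algAut F M).mul_mem htm hsm) n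
  have refl := reflect_dihedralOrbit hss htt hsa htb
  set a := dihedralOrbit (t * s) (b 0) (b 1) with ha
  have a0 : a 0 = b 0 := by rw [ha, dihedralOrbit_even _ _ _ 0 (by ring)]; simp
  have a1 : a 1 = b 1 := by rw [ha, dihedralOrbit_odd _ _ _ 0 (by ring)]; simp
  have shift : ∀ n i, ((t * s) ^ n) (a i) = a (i + 2 * n) := zpow_dihedralOrbit (t * s) _ _
  have odd0 : ∀ k, a 0 * (a (0 + k) - a (0 - k)) = η • (a (0 + k) - a (0 - k)) := by
    intro k
    have := (hb 0).mul_sub_axisReflection hη0 hη1 (a k)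
    rw [← hs_app, (refl k).1, ← a0] at this
    rwa [zero_add, zero_sub]
  have even0 : ∀ k, a 0 * (a 0 * (a (0 + k) + a (0 - k))) = a 0 * (a (0 + k) + a (0 - k)) := by
    intro k
    have := (hb 0).mul_mul_add_axisReflection hη0 hη1 (a k)
    rw [← hs_app, (refl k).1, ← a0] at this
    rwa [zero_add, zero_sub]
  have odd1 : ∀ k, a 1 * (a (1 + k) - a (1 - k)) = η • (a (1 + k) - a (1 - k)) := by
    intro k
    have := (hb 1).mul_sub_axisReflection hη0 hη1 (a (1 + k))
    rwa [← ht_app, (refl (1 + k)).2, ← a1, show 2 - (1 + k) = 1 - k by ring] at this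
  have even1 : ∀ k, a 1 * (a 1 * (a (1 + k) + a (1 - k))) = a 1 * (a (1 + k) + a (1 - k)) := by
    intro k
    have := (hb 1).mul_mul_add_axisReflection hη0 hη1 (a (1 + k))
    rwa [← ht_app, (refl (1 + k)).2, ← a1, show 2 - (1 + k) = 1 - k by ring] at this
  have rep : ∀ m, ∃ n : ℤ, m = 0 + 2 * n ∨ m = 1 + 2 * n := by
    intro m
    rcases Int.even_or_odd' m with ⟨n, h | h⟩
    · exact ⟨n, Or.inl (by omega)⟩
    · exact ⟨n, Or.inr (by omega)⟩
  refine ⟨a, a0, a1, ⟨?_, ?_, ?_⟩, ?_⟩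
  · intro m
    obtain ⟨n, rfl | rfl⟩ := rep m
    · rw [← shift, a0]; exact ((hb 0).eigenClosed hη0 hη1).map (hrm n)
    · rw [← shift, a1]; exact ((hb 1).eigenClosed hη0 hη1).map (hrm n)
  · intro m k
    obtain ⟨n, rfl | rfl⟩ := rep m
    · have := congrArg ((t * s) ^ n) (odd0 k)
      rw [hrm n, map_smul, map_sub, shift, shift, shift] at this
      rwa [show 0 + 2 * n + k = 0 + k + 2 * n by ring, show 0 + 2 * n - k = 0 - k + 2 * n by ring]
    · have := congrArg ((t * s) ^ n) (odd1 k)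
      rw [hrm n, map_smul, map_sub, shift, shift, shift] at this
      rwa [show 1 + 2 * n + k = 1 + k + 2 * n by ring, show 1 + 2 * n - k = 1 - k + 2 * n by ring]
  · intro m k
    obtain ⟨n, rfl | rfl⟩ := rep m
    · have := congrArg ((t * s) ^ n) (even0 k)
      rw [hrm n, hrm n, map_add, shift, shift, shift] at this
      rwa [show 0 + 2 * n + k = 0 + k + 2 * n by ring, show 0 + 2 * n - k = 0 - k + 2 * n by ring]
    · have := congrArg ((t * s) ^ n) (even1 k)
      rw [hrm n, hrm n, map_add, shift, shift, shift] at this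
      rwa [show 1 + 2 * n + k = 1 + k + 2 * n by ring, show 1 + 2 * n - k = 1 - k + 2 * n by ring]
  · intro m
    obtain ⟨n, rfl | rfl⟩ := rep m
    · exact ⟨_, hrm n, 0, by rw [← shift, a0]⟩
    · exact ⟨_, hrm n, 1, by rw [← shift, a1]⟩

end DihedralOrbit

/-! ### Recognising axes from a spanning set of eigenvectors. -/

section AxisCriterion

variable {F : Type*} [Field F] {M : Type*} [NonUnitalNonAssocCommRing M] [Module F M]
  [SMulCommClass F M M] [IsScalarTower F M M]

theorem mul_mem_of_mem_span {X Y : Set M} {P : Submodule F M} (h : ∀ x ∈ X, ∀ y ∈ Y, x * y ∈ P)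
    {x y : M} (hx : x ∈ Submodule.span F X) (hy : y ∈ Submodule.span F Y) : x * y ∈ P := by
  have h1 : ∀ x ∈ X, ∀ y ∈ Submodule.span F Y, x * y ∈ P := fun x hx y hy =>
    have le : Submodule.span F Y ≤ P.comap (LinearMap.mulLeft F x) :=
      Submodule.span_le.2 fun y hy => h x hx y hy
    le hy
  have le : Submodule.span F X ≤ P.comap (LinearMap.mulRight F y) :=
    Submodule.span_le.2 fun x hx => h1 x hx y hy
  exact le hx

/-- A criterion for axes: the algebra is spanned by eigenvectors whose products obey the strongest
of the fusion rules `F_Φ(η)`. -/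
theorem isAxis_of_span (Φ : Set F) {η : F} (hη0 : η ≠ 0) (hη1 : η ≠ 1) {a : M} (ha : a * a = a)
    {X₀ X₁ Y : Set M} (h0 : ∀ x ∈ X₀, a * x = 0) (h1 : ∀ x ∈ X₁, a * x = x)
    (hY : ∀ x ∈ Y, a * x = η • x)
    (htop : Submodule.span F X₀ ⊔ Submodule.span F X₁ ⊔ Submodule.span F Y = ⊤)
    (h00 : ∀ x ∈ X₀, ∀ y ∈ X₀, a * (x * y) = 0) (h11 : ∀ x ∈ X₁, ∀ y ∈ X₁, a * (x * y) = x * y)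
    (h01 : ∀ x ∈ X₀, ∀ y ∈ X₁, x * y = 0) (h0Y : ∀ x ∈ X₀, ∀ y ∈ Y, a * (x * y) = η • (x * y))
    (h1Y : ∀ x ∈ X₁, ∀ y ∈ Y, a * (x * y) = η • (x * y))
    (hYY : ∀ x ∈ Y, ∀ y ∈ Y, a * (a * (x * y)) = a * (x * y)) :
    IsAxis F (jordanFusion Φ η) a := by
  classical
  have le0 : Submodule.span F X₀ ≤ axisEigenspace F a 0 :=
    Submodule.span_le.2 fun x hx => mem_axisEigenspace_iff.2 (by rw [h0 x hx, zero_smul])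
  have le1 : Submodule.span F X₁ ≤ axisEigenspace F a 1 :=
    Submodule.span_le.2 fun x hx => mem_axisEigenspace_iff.2 (by rw [h1 x hx, one_smul])
  have leY : Submodule.span F Y ≤ axisEigenspace F a η :=
    Submodule.span_le.2 fun x hx => mem_axisEigenspace_iff.2 (hY x hx)
  have dec : ∀ z : M, ∃ x ∈ Submodule.span F X₀, ∃ y ∈ Submodule.span F X₁,
      ∃ w ∈ Submodule.span F Y, a * x = 0 ∧ a * y = y ∧ a * w = η • w ∧ z = x + y + w := by
    intro z
    have hz : z ∈ Submodule.span F X₀ ⊔ Submodule.span F X₁ ⊔ Submodule.span F Y :=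
      htop ▸ Submodule.mem_top
    obtain ⟨u, hu, w, hw, rfl⟩ := Submodule.mem_sup.1 hz
    obtain ⟨x, hx, y, hy, rfl⟩ := Submodule.mem_sup.1 hu
    have e0 := mem_axisEigenspace_iff.1 (le0 hx)
    have e1 := mem_axisEigenspace_iff.1 (le1 hy)
    have e2 := mem_axisEigenspace_iff.1 (leY hw)
    rw [zero_smul] at e0
    rw [one_smul] at e1
    exact ⟨x, hx, y, hy, w, hw, e0, e1, e2, rfl⟩
  have hη1' : 1 - η ≠ 0 := sub_ne_zero.2 hη1.symm
  -- The spans are the full eigenspaces: applying a once more to the eigenvalue equation isolates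
  -- the components of z with the wrong eigenvalue, as 0, 1 and η are distinct. So products need to
  -- be checked on the spanning vectors only.
  have sp0 : ∀ z, z ∈ axisEigenspace F a 0 → z ∈ Submodule.span F X₀ := by
    intro z hz
    obtain ⟨x, hx, y, hy, w, hw, e0, e1, e2, rfl⟩ := dec z
    rw [mem_axisEigenspace_iff, zero_smul, mul_add, mul_add, e0, e1, e2, zero_add] at hz
    have hz' := congrArg (fun x => a * x) hz
    simp only [mul_add, mul_smul_comm, e1, e2, mul_zero] at hz'
    have hw0 : w = 0 := by
      apply smul_right_injective M (mul_ne_zero hη0 hη1')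
      simp only [smul_zero]
      linear_combination (norm := module) hz - hz'
    rw [hw0, smul_zero, add_zero] at hz
    rw [hz, hw0, add_zero, add_zero]; exact hx
  have sp1 : ∀ z, z ∈ axisEigenspace F a 1 → z ∈ Submodule.span F X₁ := by
    intro z hz
    obtain ⟨x, hx, y, hy, w, hw, e0, e1, e2, rfl⟩ := dec z
    rw [mem_axisEigenspace_iff, one_smul, mul_add, mul_add, e0, e1, e2, zero_add] at hz
    have hz' := congrArg (fun x => a * x) hz
    simp only [mul_add, mul_smul_comm, e0, e1, e2] at hz'
    have hw0 : w = 0 := by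
      apply smul_right_injective M (mul_ne_zero hη0 hη1')
      simp only [smul_zero]
      linear_combination (norm := module) -hz'
    have hx0 : x = 0 := by
      rw [hw0] at hz
      linear_combination (norm := module) -hz
    rw [hx0, hw0, add_zero, zero_add]; exact hy
  have spY : ∀ z, z ∈ axisEigenspace F a η → z ∈ Submodule.span F Y := by
    intro z hz
    obtain ⟨x, hx, y, hy, w, hw, e0, e1, e2, rfl⟩ := dec z
    rw [mem_axisEigenspace_iff, mul_add, mul_add, e0, e1, e2, zero_add] at hz
    have hz' := congrArg (fun x => a * x) hz
    simp only [mul_add, mul_smul_comm, e0, e1, e2] at hz'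
    have hy0 : y = 0 := by
      apply smul_right_injective M hη1'
      simp only [smul_zero]
      linear_combination (norm := module) hz'
    have hx0 : x = 0 := by
      rw [hy0] at hz
      apply smul_right_injective M hη0
      simp only [smul_zero]
      linear_combination (norm := module) -hz
    rw [hx0, hy0, add_zero, zero_add]; exact hw
  have mem0 : ∀ z : M, a * z = 0 → z ∈ axisEigenspace F a 0 := fun z hz =>
    mem_axisEigenspace_iff.2 (by rw [hz, zero_smul])
  have mem1 : ∀ z : M, a * z = z → z ∈ axisEigenspace F a 1 := fun z hz =>
    mem_axisEigenspace_iff.2 (by rw [hz, one_smul])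
  have f01 : ∀ x ∈ axisEigenspace F a 0, ∀ y ∈ axisEigenspace F a 1, x * y = 0 := by
    intro x hx y hy
    have := mul_mem_of_mem_span (P := (⊥ : Submodule F M))
      (fun x hx y hy => (Submodule.mem_bot F).2 (h01 x hx y hy)) (sp0 x hx) (sp1 y hy)
    exact (Submodule.mem_bot F).1 this
  have f0Y : ∀ x ∈ axisEigenspace F a 0, ∀ y ∈ axisEigenspace F a η,
      x * y ∈ axisEigenspace F a η := fun x hx y hy => mul_mem_of_mem_span
    (fun x hx y hy => mem_axisEigenspace_iff.2 (h0Y x hx y hy)) (sp0 x hx) (spY y hy)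
  have f1Y : ∀ x ∈ axisEigenspace F a 1, ∀ y ∈ axisEigenspace F a η,
      x * y ∈ axisEigenspace F a η := fun x hx y hy => mul_mem_of_mem_span
    (fun x hx y hy => mem_axisEigenspace_iff.2 (h1Y x hx y hy)) (sp1 x hx) (spY y hy)
  refine ⟨ha, ?_, ?_⟩
  · apply DirectSum.isInternal_submodule_of_iSupIndep_of_iSup_eq_top
    · exact (Module.End.eigenspaces_iSupIndep (LinearMap.mulLeft F a)).comp
        Subtype.val_injective
    · rw [eq_top_iff, ← htop]
      refine sup_le (sup_le (le0.trans ?_) (le1.trans ?_)) (leY.trans ?_)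
      · exact le_iSup (fun s : (jordanFusion Φ η).S => axisEigenspace F a (s : F))
          ⟨0, zero_mem_jordanFusion⟩
      · exact le_iSup (fun s : (jordanFusion Φ η).S => axisEigenspace F a (s : F))
          ⟨1, one_mem_jordanFusion⟩
      · exact le_iSup (fun s : (jordanFusion Φ η).S => axisEigenspace F a (s : F))
          ⟨η, eta_mem_jordanFusion⟩
  · rintro s (rfl | rfl | rfl) t (rfl | rfl | rfl) x hx y hy
    · rw [jordanFusion_star_zero_zero hη0, iSup_singleton]
      exact mul_mem_of_mem_span (fun x hx y hy => mem0 _ (h00 x hx y hy)) (sp0 x hx) (sp0 y hy)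
    · rw [f01 x hx y hy]; exact Submodule.zero_mem _
    · rw [jordanFusion_star_eta hη0.symm, iSup_singleton]
      exact f0Y x hx y hy
    · rw [mul_comm, f01 y hy x hx]; exact Submodule.zero_mem _
    · rw [jordanFusion_star_one_one hη1, iSup_singleton]
      exact mul_mem_of_mem_span (fun x hx y hy => mem1 _ (h11 x hx y hy)) (sp1 x hx) (sp1 y hy)
    · rw [jordanFusion_star_eta hη1.symm, iSup_singleton]
      exact f1Y x hx y hy
    · rw [jordanFusion_star_eta' hη0.symm, iSup_singleton, mul_comm]
      exact f0Y y hy x hx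
    · rw [jordanFusion_star_eta' hη1.symm, iSup_singleton, mul_comm]
      exact f1Y y hy x hx
    · rw [jordanFusion_star_eta_eta, iSup_insert, iSup_singleton]
      refine mul_mem_of_mem_span (fun x hx y hy => ?_) (spY x hx) (spY y hy)
      have e := hYY x hx y hy
      rw [show x * y = (x * y - a * (x * y)) + a * (x * y) by abel]
      exact Submodule.add_mem_sup (mem0 _ (by rw [mul_sub, e, sub_self])) (mem1 _ e)

end AxisCriterion

/-! ### Homomorphisms out of tabulated algebras, and universality. -/

section Lifting

variable {F : Type u} [Field F]

theorem nonUnitalAlgHom_eq_of_adjoin_eq_top {M : Type v} {N : Type w}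
    [NonUnitalNonAssocCommRing M] [Module F M] [SMulCommClass F M M] [IsScalarTower F M M]
    [NonUnitalNonAssocCommRing N] [Module F N] {s : Set M}
    (hs : NonUnitalAlgebra.adjoin F s = ⊤) {f g : M →ₙₐ[F] N} (h : ∀ x ∈ s, f x = g x) :
    f = g := by
  ext x
  have hx : x ∈ NonUnitalAlgebra.adjoin F s := hs ▸ NonUnitalAlgebra.mem_top
  induction hx using NonUnitalAlgebra.adjoin_induction with
  | mem x hx => exact h x hx
  | add x y _ _ hx hy => rw [map_add, map_add, hx, hy]
  | zero => rw [map_zero, map_zero]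
  | mul x y _ _ hx hy => rw [map_mul, map_mul, hx, hy]
  | smul r x _ hx => rw [map_smul, map_smul, hx]

namespace MulTable

variable {ι : Type*} (T : MulTable F ι)

/-- The standard basis. -/
noncomputable def basis : Module.Basis ι F T.Alg :=
  Module.Basis.ofRepr (LinearEquiv.refl F (ι →₀ F) : (ι →₀ F) ≃ₗ[F] (ι →₀ F))

theorem basis_eq (i : ι) : T.basis i = T.e i := rfl

theorem span_range_e : Submodule.span F (Set.range T.e) = ⊤ := by
  rw [← funext T.basis_eq]
  exact T.basis.span_eq

variable {N : Type*} [NonUnitalNonAssocCommRing N] [Module F N] [SMulCommClass F N N]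
  [IsScalarTower F N N]

/-- The algebra homomorphism given by the images of the basis vectors. -/
noncomputable def lift (φ : ι → N)
    (h : ∀ i j, φ i * φ j = Finsupp.linearCombination F φ (T.coeff i j)) : T.Alg →ₙₐ[F] N where
  toFun := (Finsupp.linearCombination F φ : (ι →₀ F) → N)
  map_smul' c x := (Finsupp.linearCombination F φ).map_smul c x
  map_zero' := (Finsupp.linearCombination F φ).map_zero
  map_add' x y := (Finsupp.linearCombination F φ).map_add x y
  map_mul' x y := by
    have e : T.mulBilin.compr₂ (Finsupp.linearCombination F φ) =
        (LinearMap.mul F N).compl₁₂ (Finsupp.linearCombination F φ)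
          (Finsupp.linearCombination F φ) := by
      refine Finsupp.lhom_ext' fun i => LinearMap.ext_ring ?_
      refine Finsupp.lhom_ext' fun j => LinearMap.ext_ring ?_
      simp [mulBilin, h]
    exact LinearMap.congr_fun₂ e x y

theorem lift_e (φ : ι → N)
    (h : ∀ i j, φ i * φ j = Finsupp.linearCombination F φ (T.coeff i j)) (i : ι) :
    T.lift φ h (T.e i) = φ i := by
  change Finsupp.linearCombination F φ (Finsupp.single i 1) = φ i
  simp

end MulTable

/-- An axial algebra that has morphisms to all others is universal, and every universal algebra is
isomorphic to it. -/
theorem universal_of_exists_hom (R : FusionRule F) {n : ℕ} {A : Type u}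
    [NonUnitalNonAssocCommRing A] [Module F A] [SMulCommClass F A A] [IsScalarTower F A A]
    {c : Fin n → A} (hc : IsAxialAlgebra F R c)
    (hw : ∀ (N : Type w) [NonUnitalNonAssocCommRing N] [Module F N] [SMulCommClass F N N]
      [IsScalarTower F N N] (b : Fin n → N), IsAxialAlgebra F R b →
      ∃ f : A →ₙₐ[F] N, ∀ i, f (c i) = b i)
    (hv : ∀ (N : Type v) [NonUnitalNonAssocCommRing N] [Module F N] [SMulCommClass F N N]
      [IsScalarTower F N N] (b : Fin n → N), IsAxialAlgebra F R b →
      ∃ f : A →ₙₐ[F] N, ∀ i, f (c i) = b i) :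
    IsUniversalAxialAlgebra.{u, u, w} F R c ∧
      ∀ (M : Type v) [NonUnitalNonAssocCommRing M] [Module F M] [SMulCommClass F M M]
        [IsScalarTower F M M] (a : Fin n → M), IsUniversalAxialAlgebra.{u, v, u} F R a →
        ∃ f : M →ₙₐ[F] A, Function.Bijective f ∧ ∀ i, f (a i) = c i := by
  refine ⟨⟨hc, fun N _ _ _ _ b hb => ?_⟩, fun M _ _ _ _ a ha => ?_⟩
  · obtain ⟨f, hf⟩ := hw N b hb
    refine ⟨f, hf, fun g hg => nonUnitalAlgHom_eq_of_adjoin_eq_top hc.generates ?_⟩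
    rintro _ ⟨i, rfl⟩
    rw [hf, hg]
  · obtain ⟨f, hf, -⟩ := ha.2 A c hc
    -- The inverse is taken from `hv` because M lives in its own universe, where the universal
    -- property of A has not been tested.
    obtain ⟨g, hg⟩ := hv M a ha.1
    have e1 : f.comp g = NonUnitalAlgHom.id F A := by
      refine nonUnitalAlgHom_eq_of_adjoin_eq_top hc.generates ?_
      rintro _ ⟨i, rfl⟩
      simp [hf, hg]
    have e2 : g.comp f = NonUnitalAlgHom.id F M := by
      refine nonUnitalAlgHom_eq_of_adjoin_eq_top ha.1.generates ?_
      rintro _ ⟨i, rfl⟩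
      simp [hf, hg]
    refine ⟨f, Function.bijective_iff_has_inverse.2 ⟨g, fun x => ?_, fun x => ?_⟩, hf⟩
    · exact DFunLike.congr_fun e2 x
    · exact DFunLike.congr_fun e1 x

end Lifting

/-! ### The infinite-dimensional algebra is generated by two axes. -/

section OrbitTable

variable {F : Type*} [Field F] {M : Type*} [NonUnitalNonAssocCommRing M] [Module F M]
  [SMulCommClass F M M] [IsScalarTower F M M]

/-- The multiplication rules of the infinite-dimensional algebra, with the vectors `p j` indexed by
all integers and without denominators. -/
structure OrbitTable (F : Type*) [Field F] {M : Type*} [NonUnitalNonAssocCommRing M] [Module F M]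
    (A P : ℤ → M) : Prop where
  zero : P 0 = 0
  neg : ∀ j, P (-j) = P j
  orbit_mul : ∀ i j, (2 : F) • (A i * A j) = (2 : F) • P (i - j) + A i + A j
  orbit_mul_gap : ∀ i j, (8 : F) • (A i * P j) =
    (4 : F) • P j - (2 : F) • A i + (A (i - j) + A (i + j))
  gap_mul : ∀ i j, (8 : F) • (P i * P j) = -(2 : F) • (P i + P j) + (P (i + j) + P (i - j))

namespace OrbitTable

variable {A P : ℤ → M} (T : OrbitTable F A P)

/-- The vectors fixed by the reflection at `m`, coming from the orbit. -/
def evenVec (A : ℤ → M) (m k : ℤ) : M := A (m + k) + A (m - k)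

/-- The vectors negated by the reflection at `m`. -/
def oddVec (A : ℤ → M) (m k : ℤ) : M := A (m + k) - A (m - k)

variable (F) in
/-- The vectors fixed by the reflection at `m`, coming from the gap vectors. -/
def gapShift (A P : ℤ → M) (m k : ℤ) : M := (4 : F) • P k + (2 : F) • A m

include T

theorem orbit_mul_of_eq {i j d : ℤ} (h : d = i - j ∨ d = j - i) :
    (2 : F) • (A i * A j) = (2 : F) • P d + A i + A j := by
  rw [T.orbit_mul]
  rcases h with rfl | rfl
  · rfl
  · rw [← T.neg (i - j), neg_sub]

theorem orbit_mul_gap_of_eq {i j s d : ℤ} (hs : s = i + j) (hd : d = i - j) :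
    (8 : F) • (A i * P j) = (4 : F) • P j - (2 : F) • A i + (A d + A s) := by
  rw [T.orbit_mul_gap, hs, hd]

/-- Together with `mul_gapShift`: A m sends U = `evenVec A m k` and V = `gapShift F A P m k` both to
half of U + V. Hence U - V is a 0-eigenvector and U + V a 1-eigenvector. -/
theorem mul_evenVec (m k : ℤ) :
    (2 : F) • (A m * evenVec A m k) = evenVec A m k + gapShift F A P m k := by
  simp only [evenVec, gapShift, mul_add]
  linear_combination (norm := module) T.orbit_mul_of_eq (i := m) (j := m + k) (d := k) (by omega) +
    T.orbit_mul_of_eq (i := m) (j := m - k) (d := k) (by omega)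

theorem mul_self (h2 : (2 : F) ≠ 0) (m : ℤ) : A m * A m = A m := by
  apply smul_right_injective M h2
  have := T.orbit_mul m m
  rw [sub_self, T.zero] at this
  linear_combination (norm := module) this

theorem mul_gapShift (h2 : (2 : F) ≠ 0) (m k : ℤ) :
    (2 : F) • (A m * gapShift F A P m k) = evenVec A m k + gapShift F A P m k := by
  simp only [evenVec, gapShift, mul_add, mul_smul_comm, T.mul_self h2]
  linear_combination (norm := module) T.orbit_mul_gap m k

theorem mul_oddVec (m k : ℤ) : (2 : F) • (A m * oddVec A m k) = oddVec A m k := by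
  simp only [oddVec, mul_sub]
  linear_combination (norm := module) T.orbit_mul_of_eq (i := m) (j := m + k) (d := k) (by omega) -
    T.orbit_mul_of_eq (i := m) (j := m - k) (d := k) (by omega)

theorem evenVec_mul_evenVec (m k l : ℤ) :
    (2 : F) • (evenVec A m k * evenVec A m l) = gapShift F A P m (k + l) +
      gapShift F A P m (k - l) + (2 : F) • (evenVec A m k + evenVec A m l) - (4 : F) • A m := by
  simp only [evenVec, gapShift, mul_add, add_mul]
  linear_combination (norm := module)
    T.orbit_mul_of_eq (i := m + k) (j := m + l) (d := k - l) (by omega) +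
    T.orbit_mul_of_eq (i := m + k) (j := m - l) (d := k + l) (by omega) +
    T.orbit_mul_of_eq (i := m - k) (j := m + l) (d := k + l) (by omega) +
    T.orbit_mul_of_eq (i := m - k) (j := m - l) (d := k - l) (by omega)

theorem gapShift_mul_gapShift (h2 : (2 : F) ≠ 0) (m k l : ℤ) :
    (2 : F) • (gapShift F A P m k * gapShift F A P m l) = gapShift F A P m (k + l) +
      gapShift F A P m (k - l) + (2 : F) • (evenVec A m k + evenVec A m l) - (4 : F) • A m := by
  simp only [evenVec, gapShift, mul_add, add_mul, mul_smul_comm, smul_mul_assoc, T.mul_self h2,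
    mul_comm (P k) (A m)]
  linear_combination (norm := module) (4 : F) • T.gap_mul k l + (2 : F) • T.orbit_mul_gap m k +
    (2 : F) • T.orbit_mul_gap m l

theorem evenVec_mul_gapShift (m k l : ℤ) :
    (2 : F) • (evenVec A m k * gapShift F A P m l) = evenVec A m (k + l) +
      evenVec A m (k - l) + (2 : F) • (gapShift F A P m k + gapShift F A P m l) -
      (4 : F) • A m := by
  simp only [evenVec, gapShift, mul_add, add_mul, mul_smul_comm]
  linear_combination (norm := module)
    T.orbit_mul_gap_of_eq (i := m + k) (j := l) (s := m + (k + l)) (d := m + (k - l)) (by ring)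
      (by ring) +
    T.orbit_mul_gap_of_eq (i := m - k) (j := l) (s := m - (k - l)) (d := m - (k + l)) (by ring)
      (by ring) +
    (2 : F) • T.orbit_mul_of_eq (i := m + k) (j := m) (d := k) (by omega) +
    (2 : F) • T.orbit_mul_of_eq (i := m - k) (j := m) (d := k) (by omega)

theorem evenVec_mul_oddVec (m k l : ℤ) :
    (2 : F) • (evenVec A m k * oddVec A m l) = (2 : F) • oddVec A m l := by
  simp only [evenVec, oddVec, mul_sub, add_mul]
  linear_combination (norm := module)
    T.orbit_mul_of_eq (i := m + k) (j := m + l) (d := k - l) (by omega) -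
    T.orbit_mul_of_eq (i := m + k) (j := m - l) (d := k + l) (by omega) +
    T.orbit_mul_of_eq (i := m - k) (j := m + l) (d := k + l) (by omega) -
    T.orbit_mul_of_eq (i := m - k) (j := m - l) (d := k - l) (by omega)

theorem gapShift_mul_oddVec (m k l : ℤ) :
    (2 : F) • (gapShift F A P m k * oddVec A m l) = oddVec A m (l - k) + oddVec A m (l + k) := by
  simp only [gapShift, oddVec, mul_sub, add_mul, smul_mul_assoc, mul_comm (P k)]
  linear_combination (norm := module)
    T.orbit_mul_gap_of_eq (i := m + l) (j := k) (s := m + (l + k)) (d := m + (l - k)) (by ring)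
      (by ring) -
    T.orbit_mul_gap_of_eq (i := m - l) (j := k) (s := m - (l - k)) (d := m - (l + k)) (by ring)
      (by ring) +
    (2 : F) • T.orbit_mul_of_eq (i := m) (j := m + l) (d := l) (by omega) -
    (2 : F) • T.orbit_mul_of_eq (i := m) (j := m - l) (d := l) (by omega)

theorem oddVec_mul_oddVec (m k l : ℤ) :
    (2 : F) • (oddVec A m k * oddVec A m l) = gapShift F A P m (k - l) -
      gapShift F A P m (k + l) := by
  simp only [oddVec, gapShift, mul_sub, sub_mul]
  linear_combination (norm := module)
    T.orbit_mul_of_eq (i := m + k) (j := m + l) (d := k - l) (by omega) -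
    T.orbit_mul_of_eq (i := m + k) (j := m - l) (d := k + l) (by omega) -
    T.orbit_mul_of_eq (i := m - k) (j := m + l) (d := k + l) (by omega) +
    T.orbit_mul_of_eq (i := m - k) (j := m - l) (d := k - l) (by omega)

theorem mul_evenVec_sub (h2 : (2 : F) ≠ 0) (m k : ℤ) :
    A m * (evenVec A m k - gapShift F A P m k) = 0 := by
  apply smul_right_injective M h2
  simp only [mul_sub]
  linear_combination (norm := module) T.mul_evenVec m k - T.mul_gapShift h2 m k

theorem mul_evenVec_add (h2 : (2 : F) ≠ 0) (m k : ℤ) :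
    A m * (evenVec A m k + gapShift F A P m k) = evenVec A m k + gapShift F A P m k := by
  apply smul_right_injective M h2
  simp only [mul_add]
  linear_combination (norm := module) T.mul_evenVec m k + T.mul_gapShift h2 m k

theorem evenVec_sub_mul_sub (h2 : (2 : F) ≠ 0) (m k l : ℤ) :
    (evenVec A m k - gapShift F A P m k) * (evenVec A m l - gapShift F A P m l) =
      (2 : F) • (evenVec A m k - gapShift F A P m k) +
      (2 : F) • (evenVec A m l - gapShift F A P m l) -
      (evenVec A m (k + l) - gapShift F A P m (k + l)) -
      (evenVec A m (k - l) - gapShift F A P m (k - l)) := by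
  apply smul_right_injective M h2
  have e := T.evenVec_mul_gapShift m l k
  rw [show l - k = -(k - l) by ring, add_comm l k,
    show evenVec A m (-(k - l)) = evenVec A m (k - l) by
      simp only [evenVec, ← sub_eq_add_neg, sub_neg_eq_add]; abel] at e
  simp only [mul_sub, sub_mul, mul_comm (gapShift F A P m k) (evenVec A m l)]
  linear_combination (norm := module) T.evenVec_mul_evenVec m k l + T.gapShift_mul_gapShift h2 m k l
    - T.evenVec_mul_gapShift m k l - e

/-- The products U_k U_l and V_k V_l coincide, and U_k V_l is symmetric in k and l, so everything
cancels. This is why the vectors are axes even for Φ = ∅. -/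
theorem evenVec_sub_mul_add (h2 : (2 : F) ≠ 0) (m k l : ℤ) :
    (evenVec A m k - gapShift F A P m k) * (evenVec A m l + gapShift F A P m l) = 0 := by
  apply smul_right_injective M h2
  have e := T.evenVec_mul_gapShift m l k
  rw [show l - k = -(k - l) by ring, add_comm l k,
    show evenVec A m (-(k - l)) = evenVec A m (k - l) by
      simp only [evenVec, ← sub_eq_add_neg, sub_neg_eq_add]; abel] at e
  simp only [mul_add, sub_mul, mul_comm (gapShift F A P m k) (evenVec A m l)]
  linear_combination (norm := module) T.evenVec_mul_evenVec m k l - T.gapShift_mul_gapShift h2 m k l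
    + T.evenVec_mul_gapShift m k l - e

theorem evenVec_add_mul_add (h2 : (2 : F) ≠ 0) (m k l : ℤ) :
    (evenVec A m k + gapShift F A P m k) * (evenVec A m l + gapShift F A P m l) =
      (2 : F) • (evenVec A m k + gapShift F A P m k) +
      (2 : F) • (evenVec A m l + gapShift F A P m l) +
      (evenVec A m (k + l) + gapShift F A P m (k + l)) +
      (evenVec A m (k - l) + gapShift F A P m (k - l)) - (8 : F) • A m := by
  apply smul_right_injective M h2
  have e := T.evenVec_mul_gapShift m l k
  rw [show l - k = -(k - l) by ring, add_comm l k,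
    show evenVec A m (-(k - l)) = evenVec A m (k - l) by
      simp only [evenVec, ← sub_eq_add_neg, sub_neg_eq_add]; abel] at e
  simp only [mul_add, add_mul, mul_comm (gapShift F A P m k) (evenVec A m l)]
  linear_combination (norm := module) T.evenVec_mul_evenVec m k l + T.gapShift_mul_gapShift h2 m k l
    + T.evenVec_mul_gapShift m k l + e

/-- Each vector of the orbit is an axis, for every `Φ`. -/
theorem isAxis (Φ : Set F) {η : F} (hη : 2 * η = 1)
    (hspan : Submodule.span F (Set.range A ∪ Set.range P) = ⊤) (m : ℤ) :
    IsAxis F (jordanFusion Φ η) (A m) := by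
  have h2 : (2 : F) ≠ 0 := by rintro h; simp [h] at hη
  have hη0 : η ≠ 0 := by rintro rfl; simp at hη
  have hη1 : η ≠ 1 := by rintro rfl; exact one_ne_zero (by linear_combination hη : (1 : F) = 0)
  have half : ∀ x y : M, (2 : F) • x = y → x = η • y := by
    rintro x y rfl
    rw [smul_smul, mul_comm, hη, one_smul]
  have hZ : ∀ k, A m * oddVec A m k = η • oddVec A m k := fun k => half _ _ (T.mul_oddVec m k)
  refine isAxis_of_span Φ hη0 hη1 (T.mul_self h2 m)
    (X₀ := Set.range fun k => evenVec A m k - gapShift F A P m k)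
    (X₁ := Set.range fun k => evenVec A m k + gapShift F A P m k)
    (Y := Set.range fun k => oddVec A m k) ?_ ?_ ?_ ?_ ?_ ?_ ?_ ?_ ?_ ?_
  · rintro _ ⟨k, rfl⟩
    exact T.mul_evenVec_sub h2 m k
  · rintro _ ⟨k, rfl⟩
    exact T.mul_evenVec_add h2 m k
  · rintro _ ⟨k, rfl⟩
    exact hZ k
  · rw [eq_top_iff, ← hspan, Submodule.span_le, ← Submodule.span_union, ← Submodule.span_union]
    generalize hS : Submodule.span F ((Set.range fun k => evenVec A m k - gapShift F A P m k) ∪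
      (Set.range fun k => evenVec A m k + gapShift F A P m k) ∪
      Set.range fun k => oddVec A m k) = S
    have m0 : ∀ k, evenVec A m k - gapShift F A P m k ∈ S := fun k =>
      hS ▸ Submodule.subset_span (Or.inl (Or.inl ⟨k, rfl⟩))
    have m1 : ∀ k, evenVec A m k + gapShift F A P m k ∈ S := fun k =>
      hS ▸ Submodule.subset_span (Or.inl (Or.inr ⟨k, rfl⟩))
    have mZ : ∀ k, oddVec A m k ∈ S := fun k => hS ▸ Submodule.subset_span (Or.inr ⟨k, rfl⟩)
    have div : ∀ x, (2 : F) • x ∈ S → x ∈ S := fun x hx => (S.smul_mem_iff h2).1 hx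
    have mU : ∀ k, evenVec A m k ∈ S := fun k => div _ (by
      have := S.add_mem (m0 k) (m1 k)
      rwa [show (2 : F) • evenVec A m k = (evenVec A m k - gapShift F A P m k) +
        (evenVec A m k + gapShift F A P m k) by module])
    have mV : ∀ k, gapShift F A P m k ∈ S := fun k => div _ (by
      have := S.sub_mem (m1 k) (m0 k)
      rwa [show (2 : F) • gapShift F A P m k = (evenVec A m k + gapShift F A P m k) -
        (evenVec A m k - gapShift F A P m k) by module])
    have mA : ∀ k, A k ∈ S := fun k => div _ (by
      have := S.add_mem (mU (k - m)) (mZ (k - m))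
      rwa [show (2 : F) • A k = evenVec A m (k - m) + oddVec A m (k - m) by
        simp only [evenVec, oddVec, add_sub_cancel]; module])
    have mP : ∀ k, P k ∈ S := fun k => div _ (div _ (by
      have := S.sub_mem (mV k) (S.smul_mem (2 : F) (mA m))
      rwa [show (2 : F) • (2 : F) • P k = gapShift F A P m k - (2 : F) • A m by
        simp only [gapShift]; module]))
    rintro _ (⟨k, rfl⟩ | ⟨k, rfl⟩)
    · exact mA k
    · exact mP k
  · rintro _ ⟨k, rfl⟩ _ ⟨l, rfl⟩
    simp only [T.evenVec_sub_mul_sub h2]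
    rw [mul_sub, mul_sub, mul_add, mul_smul_comm, mul_smul_comm]
    simp only [T.mul_evenVec_sub h2, smul_zero, add_zero, sub_zero]
  · rintro _ ⟨k, rfl⟩ _ ⟨l, rfl⟩
    simp only [T.evenVec_add_mul_add h2]
    rw [mul_sub, mul_add, mul_add, mul_add, mul_smul_comm, mul_smul_comm, mul_smul_comm]
    simp only [T.mul_evenVec_add h2, T.mul_self h2]
  · rintro _ ⟨k, rfl⟩ _ ⟨l, rfl⟩
    exact T.evenVec_sub_mul_add h2 m k l
  · rintro _ ⟨k, rfl⟩ _ ⟨l, rfl⟩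
    simp only [sub_mul, mul_sub, half _ _ (T.evenVec_mul_oddVec m k l),
      half _ _ (T.gapShift_mul_oddVec m k l), mul_smul_comm, mul_add, hZ]
    module
  · rintro _ ⟨k, rfl⟩ _ ⟨l, rfl⟩
    simp only [add_mul, mul_add, half _ _ (T.evenVec_mul_oddVec m k l),
      half _ _ (T.gapShift_mul_oddVec m k l), mul_smul_comm, hZ]
    module
  · rintro _ ⟨k, rfl⟩ _ ⟨l, rfl⟩
    simp only [half _ _ (T.oddVec_mul_oddVec m k l), mul_smul_comm, mul_sub,
      half _ _ (T.mul_gapShift h2 m _), T.mul_evenVec_add h2]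

/-- The two vectors `A 0` and `A 1` generate the algebra. -/
theorem adjoin_eq_top (h2 : (2 : F) ≠ 0)
    (hspan : Submodule.span F (Set.range A ∪ Set.range P) = ⊤) {s : Set M} (h0 : A 0 ∈ s)
    (h1 : A 1 ∈ s) : NonUnitalAlgebra.adjoin F s = ⊤ := by
  set S := NonUnitalAlgebra.adjoin F s with hS
  have h0 : A 0 ∈ S := NonUnitalAlgebra.subset_adjoin F h0
  have h1 : A 1 ∈ S := NonUnitalAlgebra.subset_adjoin F h1
  have div : ∀ x, (2 : F) • x ∈ S → x ∈ S := fun x hx =>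
    (S.toSubmodule.smul_mem_iff h2).1 hx
  have gap : ∀ i j, A i ∈ S → A j ∈ S → P (i - j) ∈ S := fun i j hi hj => div _ (by
    have e : (2 : F) • P (i - j) = (2 : F) • (A i * A j) - A i - A j := by
      rw [T.orbit_mul]; module
    rw [e]
    exact sub_mem (sub_mem (SMulMemClass.smul_mem _ (mul_mem hi hj)) hi) hj)
  have hP : P 1 ∈ S := gap 1 0 h1 h0
  -- The product of A i with P 1 acts as a second-order recurrence, which reaches the whole orbit
  -- from A 0 and A 1 in both directions.
  have step : ∀ i, A i ∈ S → A (i - 1) + A (i + 1) ∈ S := fun i hi => by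
    have e : A (i - 1) + A (i + 1) = (8 : F) • (A i * P 1) - (4 : F) • P 1 + (2 : F) • A i := by
      rw [T.orbit_mul_gap]; module
    rw [e]
    exact add_mem (sub_mem (SMulMemClass.smul_mem _ (mul_mem hi hP)) (SMulMemClass.smul_mem _ hP))
      (SMulMemClass.smul_mem _ hi)
  have pair : ∀ i : ℤ, A i ∈ S ∧ A (i + 1) ∈ S := by
    intro i
    induction i using Int.induction_on with
    | zero => exact ⟨h0, by simpa using h1⟩
    | succ i ih =>
      refine ⟨ih.2, ?_⟩
      have := sub_mem (step _ ih.2) ih.1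
      rwa [add_sub_cancel_right, add_sub_cancel_left] at this
    | pred i ih =>
      rw [sub_add_cancel]
      refine ⟨?_, ih.1⟩
      have := sub_mem (step _ ih.1) ih.2
      rwa [add_sub_cancel_right] at this
  have hA : ∀ i, A i ∈ S := fun i => (pair i).1
  rw [eq_top_iff]
  intro x _
  have hx : x ∈ Submodule.span F (Set.range A ∪ Set.range P) := hspan ▸ Submodule.mem_top
  have le : Submodule.span F (Set.range A ∪ Set.range P) ≤ S.toSubmodule := by
    rw [Submodule.span_le]
    rintro _ (⟨k, rfl⟩ | ⟨k, rfl⟩)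
    · exact hA k
    · have := gap k 0 (hA _) (hA _)
      rwa [sub_zero] at this
  exact le hx

end OrbitTable

end OrbitTable

/-! ### The infinite-dimensional algebra maps to every algebra in the category. -/

section InfTable

variable (F : Type*) [Field F]

/-- The vector `a i`, as an element of the algebra. -/
noncomputable def infOrbit (i : ℤ) : (infTable F).Alg := infA F i

/-- The vector `p |j|`, as an element of the algebra. -/
noncomputable def infGap (j : ℤ) : (infTable F).Alg := infP F j.natAbs

variable {F}

theorem infGap_coe (j : ℕ+) : infGap F ((j : ℕ) : ℤ) = (infTable F).e (.p j) := by
  have : infP F (((j : ℕ) : ℤ).natAbs) = Finsupp.single (InfIndex.p j) 1 := by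
    rw [Int.natAbs_natCast, infP, dif_pos j.pos]
    rfl
  exact this

theorem infGap_zero : infGap F 0 = 0 := by
  have : infP F ((0 : ℤ).natAbs) = 0 := by simp [infP]
  exact this

theorem infGap_neg (j : ℤ) : infGap F (-j) = infGap F j := by
  rw [infGap, infGap, Int.natAbs_neg]

theorem infOrbit_mul (i j : ℤ) : infOrbit F i * infOrbit F j =
    infGap F (i - j) + (1 / 2 : F) • (infOrbit F i + infOrbit F j) :=
  (infTable F).e_mul_e (.a i) (.a j)

theorem infOrbit_mul_gap (i : ℤ) (j : ℕ+) : infOrbit F i * infGap F (j : ℕ) =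
    (1 / 2 : F) • infGap F (j : ℕ) - (1 / 4 : F) • infOrbit F i +
      (1 / 8 : F) • (infOrbit F (i - (j : ℕ)) + infOrbit F (i + (j : ℕ))) := by
  rw [infGap_coe]
  exact ((infTable F).e_mul_e (.a i) (.p j)).trans (by rw [← infGap_coe]; rfl)

theorem infGap_mul (i j : ℕ+) : infGap F (i : ℕ) * infGap F (j : ℕ) =
    (-(1 / 4) : F) • (infGap F (i : ℕ) + infGap F (j : ℕ)) +
      (1 / 8 : F) • (infGap F ((i : ℕ) + (j : ℕ)) + infGap F ((i : ℕ) - (j : ℕ))) := by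
  rw [infGap_coe, infGap_coe]
  exact ((infTable F).e_mul_e (.p i) (.p j)).trans (by rw [← infGap_coe, ← infGap_coe]; rfl)

/-- The table knows p j for positive j only. Extending the indices to ℤ by evenness and p 0 = 0
removes the absolute values from the product rules. -/
theorem gap_cases {p : ℤ → Prop} (h0 : p 0) (hneg : ∀ j, p j → p (-j))
    (hpos : ∀ j : ℕ+, p (j : ℕ)) (j : ℤ) : p j := by
  have hn : ∀ n : ℕ, p n := fun n => by
    rcases Nat.eq_zero_or_pos n with rfl | h
    · exact h0
    · exact hpos ⟨n, h⟩
  rcases Int.natAbs_eq j with h | h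
  · rw [h]; exact hn _
  · rw [h]; exact hneg _ (hn _)

theorem orbitTable_inf (h2 : (2 : F) ≠ 0) : OrbitTable F (infOrbit F) (infGap F) where
  zero := infGap_zero
  neg := infGap_neg
  orbit_mul i j := by
    rw [infOrbit_mul, smul_add, smul_smul, show (2 : F) * (1 / 2) = 1 by field_simp, one_smul,
      add_assoc]
  orbit_mul_gap i j := by
    induction j using gap_cases with
    | h0 => rw [infGap_zero, mul_zero, sub_zero, add_zero]; module
    | hneg j ih => rw [infGap_neg, ih, sub_neg_eq_add, ← sub_eq_add_neg,
        add_comm (infOrbit F (i - j))]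
    | hpos j =>
      have h8 : (8 : F) ≠ 0 := by rw [show (8 : F) = 2 ^ 3 by norm_num]; exact pow_ne_zero 3 h2
      have h4 : (4 : F) ≠ 0 := by rw [show (4 : F) = 2 ^ 2 by norm_num]; exact pow_ne_zero 2 h2
      rw [infOrbit_mul_gap, smul_add, smul_sub, smul_smul, smul_smul, smul_smul,
        show (8 : F) * (1 / 2) = 4 by field_simp; norm_num,
        show (8 : F) * (1 / 4) = 2 by field_simp; norm_num,
        show (8 : F) * (1 / 8) = 1 by field_simp, one_smul]
  gap_mul i j := by
    induction i using gap_cases with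
    | h0 => rw [infGap_zero, zero_mul, zero_add, zero_sub, infGap_neg, zero_add]; module
    | hneg i ih =>
      rw [infGap_neg, ih, show -i + j = -(i - j) by ring, show -i - j = -(i + j) by ring,
        infGap_neg, infGap_neg, add_comm (infGap F (i + j))]
    | hpos i =>
    induction j using gap_cases with
    | h0 => rw [infGap_zero, mul_zero, add_zero, sub_zero, add_zero]; module
    | hneg j ih =>
      rw [infGap_neg, ih, sub_neg_eq_add, ← sub_eq_add_neg, add_comm (infGap F (_ + j))]
    | hpos j =>
      have h8 : (8 : F) ≠ 0 := by rw [show (8 : F) = 2 ^ 3 by norm_num]; exact pow_ne_zero 3 h2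
      have h4 : (4 : F) ≠ 0 := by rw [show (4 : F) = 2 ^ 2 by norm_num]; exact pow_ne_zero 2 h2
      rw [infGap_mul, smul_add, smul_smul, smul_smul,
        show (8 : F) * -(1 / 4) = -2 by field_simp; norm_num,
        show (8 : F) * (1 / 8) = 1 by field_simp, one_smul]

theorem span_infOrbit_infGap :
    Submodule.span F (Set.range (infOrbit F) ∪ Set.range (infGap F)) = ⊤ := by
  rw [eq_top_iff, ← (infTable F).span_range_e]
  refine Submodule.span_mono ?_
  rintro _ ⟨i | j, rfl⟩
  · exact Or.inl ⟨i, rfl⟩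
  · exact Or.inr ⟨_, infGap_coe j⟩

theorem infAxis_zero : infAxis F 0 = infOrbit F 0 := rfl

theorem infAxis_one : infAxis F 1 = infOrbit F 1 := rfl

theorem isAxialAlgebra_inf (Φ : Set F) {η : F} (hη : 2 * η = 1) :
    IsAxialAlgebra F (jordanFusion Φ η) (infAxis F) := by
  have h2 : (2 : F) ≠ 0 := by rintro h; simp [h] at hη
  have T := orbitTable_inf h2
  refine ⟨fun i => ?_, T.adjoin_eq_top h2 span_infOrbit_infGap ⟨0, rfl⟩ ⟨1, rfl⟩⟩
  exact T.isAxis Φ hη span_infOrbit_infGap _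

/-- Once the pair vectors are independent of the base point, the products at a single centre are
exactly the entries of the table. -/
theorem DihedralSeq.exists_hom_inf {M : Type*} [NonUnitalNonAssocCommRing M] [Module F M]
    [SMulCommClass F M M] [IsScalarTower F M M] {η : F} {a : ℤ → M} (H : DihedralSeq η a)
    (hη : 2 * η = 1) (h2 : (2 : F) ≠ 0)
    (hyp : (∀ i x y, a i * x = 0 → a i * y = y → x * y = 0) ∨ ((3 : F) ≠ 0 ∧ (5 : F) ≠ 0)) :
    ∃ f : (infTable F).Alg →ₙₐ[F] M, ∀ i, f (infOrbit F i) = a i := by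
  set φ : InfIndex → M := fun x => match x with
    | .a i => a i
    | .p j => pairVec η a (j : ℕ) 0 with hφ
  have const := H.half_pairVec_const hη h2 hyp
  have hA : ∀ i, Finsupp.linearCombination F φ (infA F i) = a i := fun i => by
    simp [infA, hφ]
  have p0 : pairVec η a 0 0 = 0 := by
    rw [pairVec, add_zero, (H.closed 0).idem, ← two_smul F (a 0), smul_smul, mul_comm, hη,
      one_smul, sub_self]
  have hP : ∀ n : ℕ, Finsupp.linearCombination F φ (infP F n) = pairVec η a n 0 := fun n => by
    rcases Nat.eq_zero_or_pos n with rfl | h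
    · rw [Nat.cast_zero, p0]; simp [infP]
    · rw [infP, dif_pos h]; simp [hφ]
  have h8 : (8 : F) ≠ 0 := by rw [show (8 : F) = 2 ^ 3 by norm_num]; exact pow_ne_zero 3 h2
  have h4 : (4 : F) ≠ 0 := by rw [show (4 : F) = 2 ^ 2 by norm_num]; exact pow_ne_zero 2 h2
  have h16 : (16 : F) ≠ 0 := by rw [show (16 : F) = 2 ^ 4 by norm_num]; exact pow_ne_zero 4 h2
  have hap : ∀ (i : ℤ) (j : ℕ+), a i * pairVec η a (j : ℕ) 0 =
      Finsupp.linearCombination F φ (infMulAP F i j) := fun i j => by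
    have e := H.half_mul_pairVec hη h2 i (j : ℕ)
    rw [const _ i] at e
    simp only [infMulAP, map_add, map_sub, map_smul, hA, hP]
    apply smul_right_injective M h8
    simp only
    rw [e, smul_add, smul_sub, smul_smul, smul_smul, smul_smul,
        show (8 : F) * (1 / 2) = 4 by field_simp; norm_num,
        show (8 : F) * (1 / 4) = 2 by field_simp; norm_num,
        show (8 : F) * (1 / 8) = 1 by field_simp, one_smul, add_comm (a (i + _))]
  refine ⟨(infTable F).lift φ ?_, fun i => (infTable F).lift_e φ _ _⟩
  rintro (i | i) (j | j)
  · change a i * a j = Finsupp.linearCombination F φ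
      (infP F (i - j).natAbs + (1 / 2 : F) • (infA F i + infA F j))
    simp only [map_add, map_smul, hA, hP]
    rw [H.pairVec_natAbs, ← const _ i, ← H.pairVec_neg, neg_sub, pairVec, add_sub_cancel,
      show (1 / 2 : F) = η by field_simp; exact hη.symm, sub_add_cancel]
  · exact hap i j
  · exact (mul_comm _ _).trans (hap j i)
  · change pairVec η a (i : ℕ) 0 * pairVec η a (j : ℕ) 0 = Finsupp.linearCombination F φ
      ((-(1 / 4) : F) • (infP F i + infP F j)
        + (1 / 8 : F) • (infP F ((i : ℕ) + j) + infP F (((i : ℕ) : ℤ) - (j : ℕ)).natAbs))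
    simp only [map_add, map_smul, hP]
    rw [H.pairVec_natAbs]
    have e := H.half_pairVec_mul hη h2 0 (i : ℕ) (j : ℕ) (const _) (const _) (const _)
    rw [const _ (_ + _), const _ (0 - _)] at e
    apply smul_right_injective M h16
    simp only
    rw [e, smul_add (16 : F), smul_smul, smul_smul,
        show (16 : F) * -(1 / 4) = -4 by field_simp; norm_num,
        show (16 : F) * (1 / 8) = 2 by field_simp; norm_num, Nat.cast_add]
    module

theorem exists_hom_inf {Φ : Set F} (hΦ : Φ ⊆ {0, 1}) {η : F} (hη : 2 * η = 1)
    (hyp : Φ = ∅ ∨ ((3 : F) ≠ 0 ∧ (5 : F) ≠ 0)) {M : Type*} [NonUnitalNonAssocCommRing M]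
    [Module F M] [SMulCommClass F M M] [IsScalarTower F M M] {b : Fin 2 → M}
    (hb : ∀ i, IsAxis F (jordanFusion Φ η) (b i)) :
    ∃ f : (infTable F).Alg →ₙₐ[F] M, ∀ i, f (infAxis F i) = b i := by
  have h2 : (2 : F) ≠ 0 := by rintro h; simp [h] at hη
  have hη0 : η ≠ 0 := by rintro rfl; simp at hη
  have hη1 : η ≠ 1 := by rintro rfl; exact one_ne_zero (by linear_combination hη : (1 : F) = 0)
  obtain ⟨a, ha0, ha1, H, ha⟩ := exists_dihedralSeq hΦ hη0 hη1 hb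
  obtain ⟨f, hf⟩ := H.exists_hom_inf hη h2 (hyp.imp_left fun h i x y => by
    obtain ⟨e, he, k, hk⟩ := ha i
    rw [hk]
    exact annihilate_map he ((hb k).zero_mul_one_eq_zero hη0 hη1 h) x y)
  refine ⟨f, Fin.forall_fin_two.2 ⟨?_, ?_⟩⟩
  · rw [infAxis_zero, hf, ha0]
  · rw [infAxis_one, hf, ha1]

end InfTable

/-! ### The six-dimensional algebra is generated by two axes. -/

section FourTable

variable {F : Type*} [Field F] {M : Type*} [NonUnitalNonAssocCommRing M] [Module F M]
  [SMulCommClass F M M] [IsScalarTower F M M]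

/-- The multiplication rules of the six-dimensional algebra. -/
structure FourTable (η : F) (q x y z s t : M) : Prop where
  qq : q * q = (η + 1) • q
  qx : q * x = (η + 1) • x
  qy : q * y = (η + 1) • y
  qz : q * z = (η + 1) • z
  xx : x * x = x
  yy : y * y = y
  zz : z * z = z
  xy : (2 : F) • (x * y) = -q + (η + 1) • (x + y) + (1 - η) • z
  xz : (2 : F) • (x * z) = -q + (η + 1) • (x + z) + (1 - η) • y
  yz : (2 : F) • (y * z) = -q + (η + 1) • (y + z) + (1 - η) • x
  ss : s * s = s
  tt : t * t = t
  st : s * t = 0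
  qs : q * s = 0
  qt : q * t = 0
  xs : x * s = 0
  xt : x * t = 0
  ys : y * s = 0
  yt : y * t = 0
  zs : z * s = 0
  zt : z * t = 0
  span_eq : Submodule.span F {q, x, y, z, s, t} = ⊤

namespace FourTable

variable {η : F} {q x y z s t : M}

theorem swap (T : FourTable η q x y z s t) : FourTable η q y x z t s where
  qq := T.qq
  qx := T.qy
  qy := T.qx
  qz := T.qz
  xx := T.yy
  yy := T.xx
  zz := T.zz
  xy := by rw [mul_comm, add_comm y, T.xy]
  xz := T.yz
  yz := T.xz
  ss := T.tt
  tt := T.ss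
  st := by rw [mul_comm, T.st]
  qs := T.qt
  qt := T.qs
  xs := T.yt
  xt := T.ys
  ys := T.xt
  yt := T.xs
  zs := T.zt
  zt := T.zs
  span_eq := by
    rw [← T.span_eq]
    congr 1
    ext m
    simp only [Set.mem_insert_iff, Set.mem_singleton_iff]
    tauto

/-- The eigenvectors of x + s are v = q - (η + 1)x and t for 0, then x, s and w = y + z - v for 1,
and y - z for η. Their products are all explicit. -/
theorem isAxis (T : FourTable η q x y z s t) (Φ : Set F) (h2 : (2 : F) ≠ 0) (hη0 : η ≠ 0)
    (hη1 : η ≠ 1) : IsAxis F (jordanFusion Φ η) (x + s) := by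
  have inj := smul_right_injective M h2
  set v := q - (η + 1) • x with hv
  set w := y + z - v with hw
  set d := y - z with hd
  have xv : x * v = 0 := by
    rw [hv, mul_sub, mul_comm, T.qx, mul_smul_comm, T.xx, sub_self]
  have xw : x * w = w := by
    rw [hw, mul_sub, xv, sub_zero]
    apply inj
    simp only [mul_add, hv]
    linear_combination (norm := module) T.xy + T.xz
  have xd : x * d = η • d := by
    apply inj
    simp only [hd, mul_sub]
    linear_combination (norm := module) T.xy - T.xz
  have qw : q * w = (η + 1) • w := by
    simp only [hw, hv, mul_sub, mul_add, T.qq, T.qx, T.qy, T.qz, mul_smul_comm]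
    module
  have qd : q * d = (η + 1) • d := by
    simp only [hd, mul_sub, T.qy, T.qz]
    module
  have vv : v * v = (η + 1) • v := by
    nth_rewrite 1 [hv]
    rw [sub_mul, smul_mul_assoc, xv, hv, mul_sub, T.qq, mul_smul_comm, T.qx]
    module
  have vw : v * w = 0 := by
    rw [hv, sub_mul, smul_mul_assoc, xw, qw, sub_self]
  have vd : v * d = ((η + 1) * (1 - η)) • d := by
    rw [hv, sub_mul, smul_mul_assoc, xd, qd]
    module
  have wd : w * d = (η ^ 2) • d := by
    rw [hw, sub_mul, vd, hd]
    simp only [add_mul, mul_sub, T.yy, T.zz, mul_comm z y]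
    module
  have ww : w * w = (η + 2) • w - (2 * η) • x := by
    have e : (y + z) * v = (η + 1) • v := by
      have : w * v = 0 := by rw [mul_comm, vw]
      rw [hw, sub_mul, vv] at this
      exact sub_eq_zero.1 this
    have e' : w * w = (y + z) * (y + z) - (η + 1) • v := by
      nth_rewrite 1 [hw]
      rw [sub_mul, vw, sub_zero, hw, mul_sub, e]
    rw [e']
    simp only [add_mul, mul_add, T.yy, T.zz, mul_comm z y, hw, hv]
    linear_combination (norm := module) T.yz
  have dd : d * d = (1 - η) • v - η • w + (2 * η) • x := by
    simp only [hd, mul_sub, sub_mul, T.yy, T.zz, mul_comm z y, hw, hv]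
    linear_combination (norm := module) -T.yz
  have sv : s * v = 0 := by
    rw [mul_comm, hv, sub_mul, smul_mul_assoc, T.xs, T.qs, smul_zero, sub_zero]
  have tv : t * v = 0 := by
    rw [mul_comm, hv, sub_mul, smul_mul_assoc, T.xt, T.qt, smul_zero, sub_zero]
  have sw : s * w = 0 := by
    rw [hw, mul_sub, sv, mul_add, mul_comm, T.ys, mul_comm, T.zs]; simp
  have tw : t * w = 0 := by
    rw [hw, mul_sub, tv, mul_add, mul_comm, T.yt, mul_comm, T.zt]; simp
  have sd : s * d = 0 := by
    rw [hd, mul_sub, mul_comm, T.ys, mul_comm, T.zs, sub_self]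
  have td : t * d = 0 := by
    rw [hd, mul_sub, mul_comm, T.yt, mul_comm, T.zt, sub_self]
  have sx : s * x = 0 := by rw [mul_comm, T.xs]
  have tx : t * x = 0 := by rw [mul_comm, T.xt]
  have ts : t * s = 0 := by rw [mul_comm, T.st]
  have vs : v * s = 0 := by rw [mul_comm, sv]
  have vt : v * t = 0 := by rw [mul_comm, tv]
  have ws : w * s = 0 := by rw [mul_comm, sw]
  have vx : v * x = 0 := by rw [mul_comm, xv]
  have wx : w * x = w := by rw [mul_comm, xw]
  refine isAxis_of_span Φ hη0 hη1 (X₀ := {v, t}) (X₁ := {x, w, s}) (Y := {d})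
    ?_ ?_ ?_ ?_ ?_ ?_ ?_ ?_ ?_ ?_ ?_
  · simp only [add_mul, mul_add, T.xx, T.ss, T.xs, sx, zero_add, add_zero]
  · rintro _ (rfl | rfl)
    · rw [add_mul, xv, sv, add_zero]
    · rw [add_mul, T.xt, T.st, add_zero]
  · rintro _ (rfl | rfl | rfl)
    · rw [add_mul, T.xx, sx, add_zero]
    · rw [add_mul, xw, sw, add_zero]
    · rw [add_mul, T.xs, T.ss, zero_add]
  · rintro _ rfl
    rw [add_mul, xd, sd, add_zero]
  · rw [eq_top_iff, ← T.span_eq, Submodule.span_le, ← Submodule.span_union,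
      ← Submodule.span_union]
    generalize hS : Submodule.span F (({v, t} ∪ {x, w, s} ∪ {d} : Set M)) = S
    have mem : ∀ m ∈ ({v, t} ∪ {x, w, s} ∪ {d} : Set M), m ∈ S := fun m hm =>
      hS ▸ Submodule.subset_span hm
    have mv : v ∈ S := mem _ (by simp)
    have mt : t ∈ S := mem _ (by simp)
    have mx : x ∈ S := mem _ (by simp)
    have mw : w ∈ S := mem _ (by simp)
    have ms : s ∈ S := mem _ (by simp)
    have md : d ∈ S := mem _ (by simp)
    rintro _ (rfl | rfl | rfl | rfl | rfl | rfl)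
    · have := S.add_mem mv (S.smul_mem (η + 1) mx)
      rwa [hv, sub_add_cancel] at this
    · exact mx
    · refine (S.smul_mem_iff h2).1 ?_
      have := S.add_mem (S.add_mem mw mv) md
      rwa [hw, hd, sub_add_cancel, add_add_sub_cancel, ← two_smul F] at this
    · refine (S.smul_mem_iff h2).1 ?_
      have := S.sub_mem (S.add_mem mw mv) md
      rwa [hw, hd, sub_add_cancel, add_sub_sub_cancel, ← two_smul F] at this
    · exact ms
    · exact mt
  · rintro _ (rfl | rfl) _ (rfl | rfl)
    · rw [vv, mul_smul_comm, add_mul, xv, sv, add_zero, smul_zero]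
    · rw [vt, mul_zero]
    · rw [tv, mul_zero]
    · rw [T.tt, add_mul, T.xt, T.st, add_zero]
  · rintro _ (rfl | rfl | rfl) _ (rfl | rfl | rfl) <;>
    simp only [T.xx, xw, T.xs, wx, ww, ws, sx, sw, T.ss, add_mul, mul_sub, mul_smul_comm,
      add_zero, mul_zero, zero_add]
  · rintro _ (rfl | rfl) _ (rfl | rfl | rfl)
    · exact vx
    · exact vw
    · exact vs
    · exact tx
    · exact tw
    · exact ts
  · rintro _ (rfl | rfl) _ rfl
    · rw [vd, mul_smul_comm, add_mul x s, xd, sd, add_zero, smul_comm]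
    · rw [td, mul_zero, smul_zero]
  · rintro _ (rfl | rfl | rfl) _ rfl
    · rw [xd, mul_smul_comm, add_mul, xd, sd, add_zero]
    · rw [wd, mul_smul_comm, add_mul x s, xd, sd, add_zero, smul_comm]
    · rw [sd, mul_zero, smul_zero]
  · rintro _ rfl _ rfl
    simp only [dd, mul_add, mul_sub, add_mul, mul_smul_comm, xv, sv, xw, sw, T.xx, sx, smul_zero,
      mul_zero, add_zero]

/-- The product of the generators is xy, which s and t annihilate, so multiplying it by the
generators yields xz and yz. Differences of these give x - y, y - z, and then (x + s)(x - y) = x -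
xy separates x from s. -/
theorem adjoin_eq_top (T : FourTable η q x y z s t) (h2 : (2 : F) ≠ 0) (hη0 : η ≠ 0) (hη1 : η ≠ 1)
    {u : Set M} (hxs : x + s ∈ u) (hyt : y + t ∈ u) : NonUnitalAlgebra.adjoin F u = ⊤ := by
  set S := NonUnitalAlgebra.adjoin F u with hS
  have b0 : x + s ∈ S := NonUnitalAlgebra.subset_adjoin F hxs
  have b1 : y + t ∈ S := NonUnitalAlgebra.subset_adjoin F hyt
  have div : ∀ {c : F} {m : M}, c ≠ 0 → c • m ∈ S → m ∈ S := fun hc hm =>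
    (S.toSubmodule.smul_mem_iff hc).1 hm
  have sm : ∀ (c : F) {m : M}, m ∈ S → c • m ∈ S := fun c _ hm => SMulMemClass.smul_mem c hm
  have hη1' : 1 - η ≠ 0 := sub_ne_zero.2 hη1.symm
  have sx : s * x = 0 := by rw [mul_comm, T.xs]
  have sy : s * y = 0 := by rw [mul_comm, T.ys]
  have sz : s * z = 0 := by rw [mul_comm, T.zs]
  have sq : s * q = 0 := by rw [mul_comm, T.qs]
  have tx : t * x = 0 := by rw [mul_comm, T.xt]
  have ty : t * y = 0 := by rw [mul_comm, T.yt]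
  have tz : t * z = 0 := by rw [mul_comm, T.zt]
  have tq : t * q = 0 := by rw [mul_comm, T.qt]
  have mxy : x * y ∈ S := by
    have := mul_mem b0 b1
    rwa [add_mul, mul_add, mul_add, T.xt, T.st, sy, add_zero, add_zero, add_zero] at this
  have hs : s * (x * y) = 0 := by
    apply smul_right_injective M h2
    simp only
    rw [← mul_smul_comm, T.xy]
    simp only [mul_add, mul_neg, mul_smul_comm, sx, sy, sz, sq, smul_zero, add_zero, neg_zero]
  have ht : t * (x * y) = 0 := by
    apply smul_right_injective M h2
    simp only
    rw [← mul_smul_comm, T.xy]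
    simp only [mul_add, mul_neg, mul_smul_comm, tx, ty, tz, tq, smul_zero, add_zero, neg_zero]
  have mxz : x * z ∈ S := by
    have e : (1 - η) • (x * z) = (2 : F) • ((x + s) * (x * y)) - (η + 1) • (x * y) := by
      rw [add_mul, hs, add_zero, ← mul_smul_comm (2 : F) x (x * y), T.xy]
      simp only [mul_add, mul_neg, mul_smul_comm, mul_comm x q, T.qx, T.xx]
      module
    exact div hη1' (e ▸ sub_mem (sm _ (mul_mem b0 mxy)) (sm _ mxy))
  have myz : y * z ∈ S := by
    have e : (1 - η) • (y * z) = (2 : F) • ((y + t) * (x * y)) - (η + 1) • (x * y) := by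
      rw [add_mul, ht, add_zero, ← mul_smul_comm (2 : F) y (x * y), T.xy]
      simp only [mul_add, mul_neg, mul_smul_comm, mul_comm y q, T.qy, T.yy, mul_comm y x]
      module
    exact div hη1' (e ▸ sub_mem (sm _ (mul_mem b1 mxy)) (sm _ mxy))
  have h2η : 2 * η ≠ 0 := mul_ne_zero h2 hη0
  have myz' : y - z ∈ S := div h2η (by
    rw [show (2 * η) • (y - z) = (2 : F) • (x * y - x * z) by
      linear_combination (norm := module) T.xz - T.xy]
    exact sm _ (sub_mem mxy mxz))
  have mxz' : x - z ∈ S := div h2η (by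
    rw [show (2 * η) • (x - z) = (2 : F) • (x * y - y * z) by
      linear_combination (norm := module) T.yz - T.xy]
    exact sm _ (sub_mem mxy myz))
  have mx : x ∈ S := by
    have := add_mem (mul_mem b0 (sub_mem mxz' myz')) mxy
    rwa [sub_sub_sub_cancel_right, add_mul, mul_sub, mul_sub, T.xx, sx, sy, sub_self, add_zero,
      sub_add_cancel] at this
  have mz : z ∈ S := by
    have := sub_mem mx mxz'
    rwa [sub_sub_cancel] at this
  have my : y ∈ S := by
    have := add_mem myz' mz
    rwa [sub_add_cancel] at this
  have ms : s ∈ S := by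
    have := sub_mem b0 mx
    rwa [add_sub_cancel_left] at this
  have mt : t ∈ S := by
    have := sub_mem b1 my
    rwa [add_sub_cancel_left] at this
  have mq : q ∈ S := by
    rw [show q = (η + 1) • (x + y) + (1 - η) • z - (2 : F) • (x * y) by
      linear_combination (norm := module) T.xy]
    exact sub_mem (add_mem (sm _ (add_mem mx my)) (sm _ mz)) (sm _ mxy)
  rw [eq_top_iff]
  intro m _
  have hm : m ∈ Submodule.span F {q, x, y, z, s, t} := T.span_eq ▸ Submodule.mem_top
  have le : Submodule.span F {q, x, y, z, s, t} ≤ S.toSubmodule := by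
    rw [Submodule.span_le]
    rintro _ (rfl | rfl | rfl | rfl | rfl | rfl) <;> assumption
  exact le hm

end FourTable

end FourTable

/-! ### The six-dimensional algebra maps to every algebra in the category. -/

section FourHat

variable {F : Type*} [Field F] {η : F}

theorem threeCHat_mul_of_ne (h2 : (2 : F) ≠ 0) {i j k : ZMod 3} (hij : i ≠ j) (hk : k = -(i + j)) :
    (2 : F) • ((threeCHatTable η).e (.a i) * (threeCHatTable η).e (.a j)) =
      -(threeCHatTable η).e .q + (η + 1) • ((threeCHatTable η).e (.a i) +
        (threeCHatTable η).e (.a j)) + (1 - η) • (threeCHatTable η).e (.a k) := by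
  have e : (threeCHatTable η).e (.a i) * (threeCHatTable η).e (.a j) =
      (-(1 / 2) : F) • (threeCHatTable η).e .q + ((η + 1) / 2) • ((threeCHatTable η).e (.a i) +
        (threeCHatTable η).e (.a j)) + ((1 - η) / 2) • (threeCHatTable η).e (.a (-(i + j))) :=
    ((threeCHatTable η).e_mul_e _ _).trans (if_neg hij)
  rw [e, hk, smul_add, smul_add, smul_smul, smul_smul, smul_smul,
    show (2 : F) * -(1 / 2) = -1 by field_simp, show (2 : F) * ((η + 1) / 2) = η + 1 by field_simp,
    show (2 : F) * ((1 - η) / 2) = 1 - η by field_simp, neg_one_smul]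

theorem threeCHat_mul_self (i : ZMod 3) :
    (threeCHatTable η).e (.a i) * (threeCHatTable η).e (.a i) = (threeCHatTable η).e (.a i) :=
  ((threeCHatTable η).e_mul_e _ _).trans (if_pos rfl)

theorem threeCHat_q_mul (x : ThreeCHatIndex) : (threeCHatTable η).e .q * (threeCHatTable η).e x =
    (η + 1) • (threeCHatTable η).e x := by
  cases x <;> exact (threeCHatTable η).e_mul_e _ _

theorem twoA_mul_self (i : Fin 2) :
    (twoATable F).e i * (twoATable F).e i = (twoATable F).e i :=
  ((twoATable F).e_mul_e _ _).trans (if_pos rfl)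

theorem twoA_mul_of_ne {i j : Fin 2} (h : i ≠ j) : (twoATable F).e i * (twoATable F).e j = 0 :=
  ((twoATable F).e_mul_e _ _).trans (if_neg h)

theorem fourTable_fourHat (h2 : (2 : F) ≠ 0) : FourTable (M := FourHat η) η
    ((threeCHatTable η).e .q, 0) ((threeCHatTable η).e (.a 0), 0) ((threeCHatTable η).e (.a 1), 0)
    ((threeCHatTable η).e (.a (-1)), 0) (0, (twoATable F).e 0) (0, (twoATable F).e 1) where
  qq := Prod.ext (threeCHat_q_mul _) (by simp)
  qx := Prod.ext (threeCHat_q_mul _) (by simp)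
  qy := Prod.ext (threeCHat_q_mul _) (by simp)
  qz := Prod.ext (threeCHat_q_mul _) (by simp)
  xx := Prod.ext (threeCHat_mul_self _) (by simp)
  yy := Prod.ext (threeCHat_mul_self _) (by simp)
  zz := Prod.ext (threeCHat_mul_self _) (by simp)
  xy := Prod.ext (threeCHat_mul_of_ne h2 (by decide) (by decide)) (by simp)
  xz := Prod.ext (threeCHat_mul_of_ne h2 (by decide) (by decide)) (by simp)
  yz := Prod.ext (threeCHat_mul_of_ne h2 (by decide) (by decide)) (by simp)
  ss := Prod.ext (by simp) (twoA_mul_self _)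
  tt := Prod.ext (by simp) (twoA_mul_self _)
  st := Prod.ext (by simp) (twoA_mul_of_ne (by decide))
  qs := Prod.ext (by simp) (by simp)
  qt := Prod.ext (by simp) (by simp)
  xs := Prod.ext (by simp) (by simp)
  xt := Prod.ext (by simp) (by simp)
  ys := Prod.ext (by simp) (by simp)
  yt := Prod.ext (by simp) (by simp)
  zs := Prod.ext (by simp) (by simp)
  zt := Prod.ext (by simp) (by simp)
  span_eq := by
    rw [eq_top_iff]
    rintro ⟨x, y⟩ -
    generalize hS : Submodule.span F ({((threeCHatTable η).e .q, 0),
      ((threeCHatTable η).e (.a 0), 0), ((threeCHatTable η).e (.a 1), 0),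
      ((threeCHatTable η).e (.a (-1)), 0), (0, (twoATable F).e 0),
      (0, (twoATable F).e 1)} : Set (FourHat η)) = S
    have left : Submodule.span F (Set.range (threeCHatTable η).e) ≤
        S.comap (LinearMap.inl F (threeCHatTable η).Alg (twoATable F).Alg) := by
      rw [Submodule.span_le]
      rintro _ ⟨_ | i, rfl⟩
      · rw [← hS]; exact Submodule.subset_span (by simp)
      · rw [← hS]
        fin_cases i
        · exact Submodule.subset_span (Or.inr (Or.inl rfl))
        · exact Submodule.subset_span (Or.inr (Or.inr (Or.inl rfl)))
        · exact Submodule.subset_span (Or.inr (Or.inr (Or.inr (Or.inl rfl))))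
    have right : Submodule.span F (Set.range (twoATable F).e) ≤
        S.comap (LinearMap.inr F (threeCHatTable η).Alg (twoATable F).Alg) := by
      rw [Submodule.span_le]
      rintro _ ⟨i, rfl⟩
      rw [← hS]
      fin_cases i
      · exact Submodule.subset_span (by simp)
      · exact Submodule.subset_span (by simp)
    rw [MulTable.span_range_e] at left right
    have := S.add_mem (left (Submodule.mem_top (x := x))) (right (Submodule.mem_top (x := y)))
    simpa using this

theorem isAxialAlgebra_fourHat (Φ : Set F) (h2 : (2 : F) ≠ 0) (hη0 : η ≠ 0) (hη1 : η ≠ 1) :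
    IsAxialAlgebra F (jordanFusion Φ η) (FourHat.axis η) := by
  have T := fourTable_fourHat (η := η) h2
  have e0 : FourHat.axis η 0 = (((threeCHatTable η).e (.a 0), 0) : FourHat η) +
      ((0, (twoATable F).e 0) : FourHat η) :=
    Prod.ext (by simp [FourHat.axis]) (by simp [FourHat.axis])
  have e1 : FourHat.axis η 1 = (((threeCHatTable η).e (.a 1), 0) : FourHat η) +
      ((0, (twoATable F).e 1) : FourHat η) :=
    Prod.ext (by simp [FourHat.axis]) (by simp [FourHat.axis])
  refine ⟨Fin.forall_fin_two.2 ⟨?_, ?_⟩, T.adjoin_eq_top h2 hη0 hη1 ⟨0, e0⟩ ⟨1, e1⟩⟩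
  · rw [e0]; exact T.isAxis Φ h2 hη0 hη1
  · rw [e1]; exact T.swap.isAxis Φ h2 hη0 hη1

variable {M : Type*} [NonUnitalNonAssocCommRing M]
    [Module F M] [SMulCommClass F M M] [IsScalarTower F M M]

/-- The homomorphism from the direct sum given by two homomorphisms with orthogonal images. -/
noncomputable def FourHat.coprod (f : (threeCHatTable η).Alg →ₙₐ[F] M)
    (g : (twoATable F).Alg →ₙₐ[F] M)
    (h : ∀ i j, f ((threeCHatTable η).e i) * g ((twoATable F).e j) = 0) : FourHat η →ₙₐ[F] M :=
  have orth : ∀ x y, f x * g y = 0 := fun x y => by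
    have hx : x ∈ Submodule.span F (Set.range (threeCHatTable η).e) :=
      (threeCHatTable η).span_range_e ▸ Submodule.mem_top
    have hy : y ∈ Submodule.span F (Set.range (twoATable F).e) :=
      (twoATable F).span_range_e ▸ Submodule.mem_top
    induction hx using Submodule.span_induction with
    | zero => rw [map_zero, zero_mul]
    | add x x' _ _ hx hx' => rw [map_add, add_mul, hx, hx', add_zero]
    | smul c x _ hx => rw [map_smul, smul_mul_assoc, hx, smul_zero]
    | mem x hx =>
    induction hy using Submodule.span_induction with
    | zero => rw [map_zero, mul_zero]
    | add x x' _ _ hx hx' => rw [map_add, mul_add, hx, hx', add_zero]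
    | smul c x _ hx => rw [map_smul, mul_smul_comm, hx, smul_zero]
    | mem y hy =>
    obtain ⟨i, rfl⟩ := hx
    obtain ⟨j, rfl⟩ := hy
    exact h i j
  { toFun := fun x => f x.1 + g x.2
    map_smul' := fun c x => by
      change f (c • x.1) + g (c • x.2) = c • (f x.1 + g x.2)
      rw [map_smul, map_smul, smul_add]
    map_zero' := by
      change f 0 + g 0 = 0
      rw [map_zero, map_zero, add_zero]
    map_add' := fun x y => by
      change f (x.1 + y.1) + g (x.2 + y.2) = _
      rw [map_add, map_add, add_add_add_comm]
    map_mul' := fun x y => by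
      change f (x.1 * y.1) + g (x.2 * y.2) = (f x.1 + g x.2) * (f y.1 + g y.2)
      rw [map_mul, map_mul, add_mul, mul_add, mul_add, orth, mul_comm (g x.2) (f y.1), orth,
        add_zero, zero_add] }

theorem FourHat.coprod_apply (f : (threeCHatTable η).Alg →ₙₐ[F] M) (g : (twoATable F).Alg →ₙₐ[F] M)
    (h : ∀ i j, f ((threeCHatTable η).e i) * g ((twoATable F).e j) = 0) (x : FourHat η) :
    FourHat.coprod f g h x = f x.1 + g x.2 := rfl

namespace RigidSeq

variable {a : ℤ → M}

theorem threeCVec_eq_of_cast (R : RigidSeq η a) {i j : ℤ} (h : (i : ZMod 3) = j) :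
    threeCVec a i = threeCVec a j := by
  obtain ⟨k, hk⟩ := (ZMod.intCast_eq_intCast_iff_dvd_sub _ _ 3).1 h
  obtain rfl : j = i + 3 * k := by push_cast at hk; omega
  clear h hk
  induction k using Int.induction_on with
  | zero => simp
  | succ k ih => rw [mul_add, ← add_assoc, mul_one, R.threeCVec_add_three, ih]
  | pred k ih =>
    rw [ih, ← R.threeCVec_add_three (i + 3 * (-(k : ℤ) - 1))]
    congr 1; ring

theorem threeCVec_mul_twoAVec (R : RigidSeq η a) (H : DihedralSeq η a) (h2 : (2 : F) ≠ 0)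
    (i j : ℤ) : threeCVec a i * twoAVec a j = 0 := by
  have per : ∀ i k : ℤ, twoAVec a (i + 2 * k) = twoAVec a i := fun i k => by
    induction k using Int.induction_on with
    | zero => simp
    | succ k ih => rw [mul_add, ← add_assoc, mul_one, R.twoAVec_add_two, ih]
    | pred k ih =>
      rw [← ih, ← R.twoAVec_add_two (i + 2 * (-(k : ℤ) - 1))]
      congr 1; ring
  obtain ⟨k, hk | hk⟩ := Int.even_or_odd' (j - i)
  · rw [show j = i + 2 * k by omega, per, R.threeCVec_mul_twoAVec_self H h2]
  · rw [show j = i + 1 + 2 * k by omega, per, R.threeCVec_mul_twoAVec_succ H h2]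

/-- The vector `threeCUnit η a` is defined so that this table entry holds; the choice works for all
i because its value does not depend on the base point. -/
theorem two_smul_threeCVec_mul (R : RigidSeq η a) (H : DihedralSeq η a) (h2 : (2 : F) ≠ 0) (i : ℤ) :
    (2 : F) • (threeCVec a i * threeCVec a (i + 1)) = -threeCUnit η a +
      (η + 1) • (threeCVec a i + threeCVec a (i + 1)) + (1 - η) • threeCVec a (i - 1) := by
  rw [R.threeCVec_mul_succ H h2, R.threeCUnit_eq i,
    show a i = threeCVec a i + twoAVec a i by rw [threeCVec, sub_add_cancel],
    show a (i + 1) = threeCVec a (i + 1) + twoAVec a (i + 1) by rw [threeCVec, sub_add_cancel]]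
  module

/-- A rigid sequence of axes contains images of both summands. -/
theorem exists_hom_fourHat (R : RigidSeq η a) (H : DihedralSeq η a) (h2 : (2 : F) ≠ 0) :
    ∃ f : FourHat η →ₙₐ[F] M, f (FourHat.axis η 0) = a 0 ∧ f (FourHat.axis η 1) = a 1 := by
  set φ : ThreeCHatIndex → M := fun x => match x with
    | .q => threeCUnit η a
    | .a k => threeCVec a (k.val : ℤ) with hφ
  set ψ : Fin 2 → M := fun i => twoAVec a (i.val : ℤ) with hψ
  have hφa : ∀ k : ℤ, φ (.a k) = threeCVec a k := fun k => R.threeCVec_eq_of_cast (by simp)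
  have hφs : ∀ k : ℤ, (2 : F) • (φ (.a k) * φ (.a (k + 1))) = -φ .q +
      (η + 1) • (φ (.a k) + φ (.a (k + 1))) + (1 - η) • φ (.a (k - 1)) := fun k => by
    have e1 := hφa (k + 1)
    have e2 := hφa (k - 1)
    push_cast at e1 e2
    rw [hφa, e1, e2]
    exact R.two_smul_threeCVec_mul H h2 k
  have hφ' : ∀ i j : ZMod 3, i ≠ j → (2 : F) • (φ (.a i) * φ (.a j)) = -φ .q +
      (η + 1) • (φ (.a i) + φ (.a j)) + (1 - η) • φ (.a (-(i + j))) := fun i j hij => by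
    obtain ⟨k, rfl⟩ := ZMod.intCast_surjective i
    obtain ⟨l, rfl⟩ := ZMod.intCast_surjective j
    -- Two distinct residues modulo 3 are consecutive in one of the two orders, and the third
    -- residue is the predecessor of the first of them.
    have key : ∀ i j : ZMod 3, i ≠ j → (j = i + 1 ∧ -(i + j) = i - 1) ∨
      (i = j + 1 ∧ -(i + j) = j - 1) := by decide
    rcases key _ _ hij with ⟨h, h'⟩ | ⟨h, h'⟩
    · rw [h', h]; exact hφs k
    · rw [h', h, mul_comm, add_comm (φ (.a (l + 1)))]; exact hφs l
  have hψs : ∀ i, ψ i * ψ i = ψ i := fun i => R.twoAVec_mul_self H h2 _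
  have hψ01 : ψ 0 * ψ 1 = 0 := R.twoAVec_mul_succ H h2 0
  have lcφ : ∀ x c, Finsupp.linearCombination F φ (Finsupp.single x c) = c • φ x := fun x c => by
    simp
  let f := (threeCHatTable η).lift φ (by
    rintro (_ | i) (_ | j)
    · change _ = Finsupp.linearCombination F φ ((η + 1) • Finsupp.single .q 1)
      rw [map_smul, lcφ, one_smul]
      exact R.threeCUnit_mul_self H h2
    · change _ = Finsupp.linearCombination F φ ((η + 1) • Finsupp.single (.a j) 1)
      rw [map_smul, lcφ, one_smul]
      exact R.threeCUnit_mul_threeCVec H h2 _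
    · change _ = Finsupp.linearCombination F φ ((η + 1) • Finsupp.single (.a i) 1)
      rw [map_smul, lcφ, one_smul, mul_comm]
      exact R.threeCUnit_mul_threeCVec H h2 _
    · by_cases h : i = j
      · subst h
        rw [show (threeCHatTable η).coeff (.a i) (.a i) = Finsupp.single (.a i) 1 from if_pos rfl,
          lcφ, one_smul]
        exact R.threeCVec_mul_self H h2 _
      · rw [show (threeCHatTable η).coeff (.a i) (.a j) = _ from if_neg h]
        simp only [map_add, map_smul, lcφ, one_smul]
        apply smul_right_injective M h2
        simp only
        rw [hφ' i j h, smul_add (2 : F), smul_add (2 : F), smul_smul, smul_smul, smul_smul,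
          show (2 : F) * -(1 / 2) = -1 by field_simp,
          show (2 : F) * ((η + 1) / 2) = η + 1 by field_simp,
          show (2 : F) * ((1 - η) / 2) = 1 - η by field_simp, neg_one_smul])
  let g := (twoATable F).lift ψ (by
    intro i j
    by_cases h : i = j
    · subst h
      rw [show (twoATable F).coeff i i = Finsupp.single i 1 from if_pos rfl, hψs]
      simp
    · rw [show (twoATable F).coeff i j = 0 from if_neg h, map_zero]
      fin_cases i <;> fin_cases j
      · exact absurd rfl h
      · exact hψ01
      · exact (mul_comm _ _).trans hψ01
      · exact absurd rfl h)
  have hf : ∀ x, f ((threeCHatTable η).e x) = φ x := (threeCHatTable η).lift_e φ _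
  have hg : ∀ i, g ((twoATable F).e i) = ψ i := (twoATable F).lift_e ψ _
  have orth : ∀ i : ℤ, ∀ j : Fin 2, threeCVec a i * ψ j = 0 := fun i j =>
    R.threeCVec_mul_twoAVec H h2 i _
  refine ⟨FourHat.coprod f g fun i j => ?_, ?_, ?_⟩
  · rw [hf, hg]
    rcases i with _ | i
    · exact R.threeCUnit_mul_twoAVec H h2 _
    · exact orth _ j
  · rw [FourHat.coprod_apply]
    change f ((threeCHatTable η).e (.a 0)) + g ((twoATable F).e 0) = a 0
    rw [hf, hg]
    exact sub_add_cancel _ _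
  · rw [FourHat.coprod_apply]
    change f ((threeCHatTable η).e (.a 1)) + g ((twoATable F).e 1) = a 1
    rw [hf, hg]
    exact sub_add_cancel _ _

end RigidSeq

/-- A proper subset of {0, 1} lies in {0} or in {1}. The corresponding rule for mixed products
passes from the two generating axes to the whole sequence, whose members are their images under
automorphisms. -/
theorem exists_hom_fourHat {Φ : Set F} (hΦ : Φ ⊆ {0, 1}) (hΦ' : Φ ≠ {0, 1}) (h2 : (2 : F) ≠ 0)
    (hη0 : η ≠ 0) (hη1 : η ≠ 1) (hh : 1 - 2 * η ≠ 0) {b : Fin 2 → M}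
    (hb : ∀ i, IsAxis F (jordanFusion Φ η) (b i)) :
    ∃ f : FourHat η →ₙₐ[F] M, ∀ i, f (FourHat.axis η i) = b i := by
  obtain ⟨a, ha0, ha1, H, ha⟩ := exists_dihedralSeq hΦ hη0 hη1 hb
  have R : RigidSeq η a := by
    by_cases h : (1 : F) ∈ Φ
    · have h1 : Φ ⊆ {1} := by
        intro x hx
        rcases hΦ hx with rfl | hx'
        · exact absurd (Set.Subset.antisymm hΦ (by rintro _ (rfl | rfl) <;> assumption)) hΦ'
        · exact hx'
      refine H.rigid_of_zeroOneOne (fun i => ?_) h2 hη0 hη1 hh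
      obtain ⟨e, he, k, hk⟩ := ha i
      rw [hk]
      exact ((hb k).zeroOneOne hη0 hη1 h1).map he
    · have h1 : Φ ⊆ {0} := by
        intro x hx
        rcases hΦ hx with hx' | rfl
        · exact hx'
        · exact absurd hx h
      refine H.rigid_of_zeroOneZero (fun i => ?_) h2 hη0 hη1 hh
      obtain ⟨e, he, k, hk⟩ := ha i
      rw [hk]
      exact ((hb k).zeroOneZero hη0 hη1 h1).map he
  obtain ⟨f, hf0, hf1⟩ := R.exists_hom_fourHat H h2
  exact ⟨f, Fin.forall_fin_two.2 ⟨hf0.trans ha0, hf1.trans ha1⟩⟩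

end FourHat

/-! ### The main theorem. -/

theorem theorem2 (F : Type u) [Field F] (hchar : ringChar F ≠ 2)
    (Φ : Set F) (hΦ : Φ ⊆ {0, 1}) (η : F) (hη0 : η ≠ 0) (hη1 : η ≠ 1) :
    (Φ ≠ {0, 1} → η ≠ 1 / 2 →
      IsUniversalAxialAlgebra.{u, u, w} F (jordanFusion Φ η) (FourHat.axis η) ∧
      ∀ (M : Type v) [NonUnitalNonAssocCommRing M] [Module F M] [SMulCommClass F M M]
        [IsScalarTower F M M] (a : Fin 2 → M),
        IsUniversalAxialAlgebra.{u, v, u} F (jordanFusion Φ η) a →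
        ∃ f : M →ₙₐ[F] FourHat η, Function.Bijective f ∧ ∀ i, f (a i) = FourHat.axis η i) ∧
    (η = 1 / 2 → (Φ = ∅ ∨ (ringChar F ≠ 3 ∧ ringChar F ≠ 5)) →
      IsUniversalAxialAlgebra.{u, u, w} F (jordanFusion Φ η) (infAxis F) ∧
      ∀ (M : Type v) [NonUnitalNonAssocCommRing M] [Module F M] [SMulCommClass F M M]
        [IsScalarTower F M M] (a : Fin 2 → M),
        IsUniversalAxialAlgebra.{u, v, u} F (jordanFusion Φ η) a →
        ∃ f : M →ₙₐ[F] (infTable F).Alg, Function.Bijective f ∧ ∀ i, f (a i) = infAxis F i) := by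
  have h2 : (2 : F) ≠ 0 := Ring.two_ne_zero hchar
  constructor
  · intro hΦ' hη
    have hh : 1 - 2 * η ≠ 0 := fun h => hη (by field_simp; linear_combination -h)
    exact universal_of_exists_hom _ (isAxialAlgebra_fourHat Φ h2 hη0 hη1)
      (fun N _ _ _ _ b hb => exists_hom_fourHat hΦ hΦ' h2 hη0 hη1 hh hb.isAxis)
      (fun N _ _ _ _ b hb => exists_hom_fourHat hΦ hΦ' h2 hη0 hη1 hh hb.isAxis)
  · intro hη hyp
    have hη' : 2 * η = 1 := by rw [hη]; field_simp
    have ne : ∀ p : ℕ, p.Prime → ringChar F ≠ p → (p : F) ≠ 0 := fun p hp h h0 => by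
      rcases (Nat.dvd_prime hp).1 (ringChar.dvd h0) with h1 | h1
      · exact CharP.ringChar_ne_one h1
      · exact h h1
    have hyp' : Φ = ∅ ∨ ((3 : F) ≠ 0 ∧ (5 : F) ≠ 0) := hyp.imp_right fun h =>
      ⟨by exact_mod_cast ne 3 Nat.prime_three h.1, by exact_mod_cast ne 5 Nat.prime_five h.2⟩
    exact universal_of_exists_hom _ (isAxialAlgebra_inf Φ hη')
      (fun N _ _ _ _ b hb => exists_hom_inf hΦ hη' hyp' hb.isAxis)
      (fun N _ _ _ _ b hb => exists_hom_inf hΦ hη' hyp' hb.isAxis)
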